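/- Let $X$ be a compact Kähler manifold with Kähler form $\omega_X$, let $\mathcal E$ be a holomorphic vector bundle of finite rank and $\mathcal L$ a holomorphic line bundle on $X$, and let $\phi:\mathcal L\to\mathcal E$ be a holomorphic bundle map. Let $p,q$ be the projections of $X\times\mathbf P^1$ onto $X$ and $\mathbf P^1$, and let $$0\to p^*\mathcal E\to\mathcal F\to p^*\mathcal L\otimes q^*\mathcal O(2)\to 0$$ be the extension of holomorphic bundles on $X\times\mathbf P^1$ whose class corresponds to $\phi$ under $H^1(X\times\mathbf P^1,p^*(\mathcal E\otimes\mathcal L^*)\otimes q^*\mathcal O(-2))\cong H^0(X,\mathcal E\otimes\mathcal L^*)$; explicitly, $\mathcal F$ is the push-out along $p^*\phi$ of the Euler sequence $0\to\mathcal O\to\mathcal O(1)\otimes\mathbf C^2\to\mathcal O(2)\to0$ of $\mathbf P^1$, pulled back by $q$ and tensored with $p^*\mathcal L$. The group $SU(2)$ acts on $X\times\mathbf P^1$ (trivially on $X$, in the standard way on $\mathbf P^1$), and on $\mathcal F$ by the lift that is trivial on $p^*\mathcal E$ and $p^*\mathcal L$ and standard on the Euler sequence. For a Hermitian metric $h$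 on a holomorphic bundle, $F_h$ denotes the curvature of its Chern connection. Let $t,t'\in C^\infty(X,\mathbf R)$ and let $\sigma>0$ be a constant such that $t-t'=4\pi/\sigma$. Let $\omega_\sigma=p^*\omega_X+\sigma\,q^*\omega_{\mathbf P^1}$, where $\omega_{\mathbf P^1}$ is the Fubini–Study form of total volume $1$, and let $\Lambda$ and $\Lambda_\sigma$ be the contractions with $\omega_X$ and $\omega_\sigma$. Then the following are equivalent. 1. There are smooth Hermitian metrics $H$ on $\mathcal E$ and $K$ on $\mathcal L$ that satisfy the coupled vortex equations $$i\Lambda F_H+\phi\phi^*=t\,\mathbf I_{\mathcal E},\qquad i\Lambda F_K-|\phi|^2=t',$$ where $\phi^*:\mathcal E\to\mathcal L$ is the adjoint of $\phi$ with respect to $H$ and $K$, and $|\phi|^2=\phi^*\phi$. 2. There is a smooth $SU(2)$-invariant Hermitian metric $\mathbf H$ on $\mathcal F$ that satisfies the weak Hermitian–Einstein equation $$i\Lambda_\sigma F_{\mathbf H}=t\,\mathbf I$$ on $X\times\mathbf P^1$, where $t$ is pulled back from $X$. -/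

import Mathlib

open Bundle Set Module
open scoped Manifold ContDiff Topology ComplexConjugate

noncomputable section

/-- The complex projective line, as the set of lines `ℓ ⊆ ℂ²`. -/
abbrev P1 : Type := Projectivization ℂ (Fin 2 → ℂ)

namespace P1

instance : TopologicalSpace P1 :=
  inferInstanceAs (TopologicalSpace (Quotient (projectivizationSetoid ℂ (Fin 2 → ℂ))))

lemma continuous_mk' : Continuous (Projectivization.mk' ℂ (V := Fin 2 → ℂ)) :=
  continuous_quotient_mk'

lemma isQuotientMap_mk' : Topology.IsQuotientMap (Projectivization.mk' ℂ (V := Fin 2 → ℂ)) :=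
  isQuotientMap_quotient_mk'

/-- The vector of the line `p` whose `i`-th coordinate is `1` (zero if there is none). -/
def normVec (i : Fin 2) (p : P1) : Fin 2 → ℂ :=
  Projectivization.lift (fun v : {v : Fin 2 → ℂ // v ≠ 0} => (v.1 i)⁻¹ • v.1) (by
    rintro ⟨a, ha⟩ ⟨b, hb⟩ t (rfl : a = t • b)
    have ht : t ≠ 0 := by rintro rfl; simp at ha
    simp only [Pi.smul_apply, smul_eq_mul, mul_inv, smul_smul]
    congr 1
    field_simp) p

@[simp] lemma normVec_mk (i : Fin 2) (v : Fin 2 → ℂ) (hv : v ≠ 0) :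
    normVec i (Projectivization.mk ℂ v hv) = (v i)⁻¹ • v := rfl

/-- The affine open subset `{[v] | v i ≠ 0}`. -/
def U (i : Fin 2) : Set P1 := {p | normVec i p i ≠ 0}

/-- The affine coordinate `v (i + 1) / v i` on `U i`. -/
def coord (i : Fin 2) (p : P1) : ℂ := normVec i p (i + 1)

/-- The vector with `i`-th coordinate `1` and the other coordinate `z`. -/
def affVec (i : Fin 2) (z : ℂ) : Fin 2 → ℂ := fun k => if k = i then 1 else z

lemma affVec_ne_zero (i : Fin 2) (z : ℂ) : affVec i z ≠ 0 :=
  fun h => by simpa [affVec] using congrFun h i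

lemma mk_mem_U (i : Fin 2) (v : Fin 2 → ℂ) (hv : v ≠ 0) :
    Projectivization.mk ℂ v hv ∈ U i ↔ v i ≠ 0 := by
  simp [U]

lemma fin2_cases (i k : Fin 2) : k = i ∨ k = i + 1 := by
  fin_cases i <;> fin_cases k <;> simp

lemma fin2_succ_ne (i : Fin 2) : i + 1 ≠ i := by
  fin_cases i <;> simp

lemma fin2_succ_succ (i : Fin 2) : i + 1 + 1 = i := by
  fin_cases i <;> simp

lemma normVec_self {i : Fin 2} {p : P1} (h : p ∈ U i) : normVec i p i = 1 := by
  induction p using Projectivization.ind with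
  | h v hv =>
    rw [mk_mem_U] at h
    simp [h]

lemma normVec_mem (i : Fin 2) (p : P1) : normVec i p ∈ p.submodule := by
  induction p using Projectivization.ind with
  | h v hv =>
    rw [Projectivization.submodule_mk, normVec_mk]
    exact Submodule.smul_mem _ _ (Submodule.mem_span_singleton_self v)

lemma eq_smul_normVec {i : Fin 2} {p : P1} (h : p ∈ U i) {v : Fin 2 → ℂ}
    (hv : v ∈ p.submodule) : v = v i • normVec i p := by
  induction p using Projectivization.ind with
  | h w hw =>
    rw [mk_mem_U] at h
    rw [Projectivization.submodule_mk, Submodule.mem_span_singleton] at hv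
    obtain ⟨a, rfl⟩ := hv
    simp [smul_smul, h]

lemma continuous_val_apply (k : Fin 2) :
    Continuous (fun v : {v : Fin 2 → ℂ // v ≠ 0} => v.1 k) :=
  (continuous_apply k).comp continuous_subtype_val

lemma isOpen_U (i : Fin 2) : IsOpen (U i) := by
  rw [← isQuotientMap_mk'.isOpen_preimage]
  have : (Projectivization.mk' ℂ ⁻¹' U i) = {v : {v : Fin 2 → ℂ // v ≠ 0} | v.1 i ≠ 0} := by
    ext v; exact mk_mem_U i v.1 v.2
  rw [this]
  exact isOpen_ne_fun (continuous_val_apply i) continuous_const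

lemma continuousOn_coord (i : Fin 2) : ContinuousOn (coord i) (U i) := by
  rw [isQuotientMap_mk'.continuousOn_isOpen_iff (isOpen_U i)]
  have : ContinuousOn (fun v : {v : Fin 2 → ℂ // v ≠ 0} => (v.1 i)⁻¹ * v.1 (i + 1))
      {v | v.1 i ≠ 0} := by
    apply ContinuousOn.mul
    · exact ContinuousOn.inv₀ (continuous_val_apply i).continuousOn (fun v hv => hv)
    · exact (continuous_val_apply (i + 1)).continuousOn
  refine this.mono ?_
  intro v hv
  exact (mk_mem_U i v.1 v.2).1 hv

/-- The affine chart on `U i`. -/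
def chart (i : Fin 2) : OpenPartialHomeomorph P1 ℂ where
  toFun := coord i
  invFun z := Projectivization.mk ℂ (affVec i z) (affVec_ne_zero i z)
  source := U i
  target := univ
  map_source' _ _ := mem_univ _
  map_target' z _ := (mk_mem_U _ _ _).2 (by simp [affVec])
  left_inv' p hp := by
    induction p using Projectivization.ind with
    | h v hv =>
      rw [mk_mem_U] at hp
      rw [Projectivization.mk_eq_mk_iff']
      refine ⟨(v i)⁻¹, ?_⟩
      funext k
      rcases fin2_cases i k with rfl | rfl
      · simp [affVec, hp]
      · simp [affVec, coord]
  right_inv' z _ := by simp [coord, affVec]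
  open_source := isOpen_U i
  open_target := isOpen_univ
  continuousOn_toFun := continuousOn_coord i
  continuousOn_invFun := by
    refine Continuous.continuousOn ?_
    have : Continuous (fun z : ℂ => (⟨affVec i z, affVec_ne_zero i z⟩ :
        {v : Fin 2 → ℂ // v ≠ 0})) := by
      refine Continuous.subtype_mk (continuous_pi fun k => ?_) _
      by_cases h : k = i
      · simpa [affVec, h] using continuous_const
      · simpa [affVec, h] using continuous_id'
    exact continuous_mk'.comp this

open Classical in
/-- The index of the preferred affine chart at `p`. -/
def idx (p : P1) : Fin 2 := if p ∈ U 0 then 0 else 1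

lemma mem_U_idx (p : P1) : p ∈ U (idx p) := by
  unfold idx
  split_ifs with h
  · exact h
  · induction p using Projectivization.ind with
    | h v hv =>
      rw [mk_mem_U] at h ⊢
      intro h1
      apply hv
      funext k
      fin_cases k
      · simpa using h
      · simpa using h1

instance : ChartedSpace ℂ P1 where
  atlas := range chart
  chartAt p := chart (idx p)
  mem_chart_source p := mem_U_idx p
  chart_mem_atlas _ := mem_range_self _

lemma chartAt_eq (p : P1) : chartAt ℂ p = chart (idx p) := rfl

lemma coord_symm_chart {i j : Fin 2} (hij : j = i + 1) (z : ℂ) :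
    coord j ((chart i).symm z) = z⁻¹ := by
  subst hij
  change coord (i + 1) (Projectivization.mk ℂ (affVec i z) (affVec_ne_zero i z)) = _
  simp [coord, affVec, fin2_succ_succ]

instance : IsManifold 𝓘(ℂ) ω P1 := by
  refine isManifold_of_contDiffOn _ _ _ ?_
  rintro _ _ ⟨i, rfl⟩ ⟨j, rfl⟩
  rcases fin2_cases i j with rfl | hij
  · refine contDiffOn_id.congr ?_
    rintro z -
    exact (chart j).right_inv (mem_univ z)
  · have : ContDiffOn ℂ ω (fun z : ℂ => z⁻¹) {z | z ≠ 0} :=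
      fun z hz => (contDiffAt_inv ℂ hz).contDiffWithinAt
    refine (this.mono ?_).congr ?_
    · rintro z hz
      have h2 : (chart i).symm z ∈ U j := hz.1.2
      change Projectivization.mk ℂ (affVec i z) (affVec_ne_zero i z) ∈ U j at h2
      rw [mk_mem_U] at h2
      subst hij
      simpa [affVec, fin2_succ_ne] using h2
    · rintro z -
      exact coord_symm_chart hij z

lemma contMDiffOn_coord (i : Fin 2) : ContMDiffOn 𝓘(ℂ) 𝓘(ℂ) ω (coord i) (U i) :=
  contMDiffOn_of_mem_maximalAtlas (e := chart i)
    (IsManifold.subset_maximalAtlas (mem_range_self i))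

end P1

/-! ### The extension determined by a triple

For a holomorphic map `φ : L → E` of bundles on `X`, the bundle on `X × ℙ¹` is the push-out along
`φ` of the Euler sequence `0 → L → Hom(ℓ, ℂ²) ⊗ L → Hom(ℓ, ℂ²/ℓ) ⊗ L → 0`, where `ℓ = O(-1) ⊆ ℂ²` is
the tautological line. As `Hom(ℓ, ℂ²/ℓ) = Tℙ¹ = O(2)`, it is an extension of `L ⊠ O(2)` by `E`. The
Euler sequence is `SU(2)`-equivariant, and its class generates `H¹(ℙ¹, O(-2))`, so that the
extension class is the one corresponding to `φ` under
`H¹(X × ℙ¹, (E ⊗ L^*) ⊠ O(-2)) ≅ H⁰(X, E ⊗ L^*)`. -/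

namespace Triple

section Algebra

variable {Ex Lx : Type*} [AddCommGroup Ex] [Module ℂ Ex] [AddCommGroup Lx] [Module ℂ Lx]

/-- The map `L → Hom(ℓ, ℂ²) ⊗ L = Hom(ℓ, L²)`, `l ↦ (v ↦ v ⊗ l)`, for the line `ℓ` given by `p`. -/
def eulerMap (p : P1) : Lx →ₗ[ℂ] (p.submodule →ₗ[ℂ] (Fin 2 → Lx)) where
  toFun l :=
    { toFun := fun v k => v.1 k • l
      map_add' := fun _ _ => funext fun _ => add_smul _ _ _
      map_smul' := fun _ _ => funext fun _ => mul_smul _ _ _ }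
  map_add' _ _ := LinearMap.ext fun _ => funext fun _ => smul_add _ _ _
  map_smul' _ _ := LinearMap.ext fun _ => funext fun _ => smul_comm _ _ _

lemma eulerMap_apply (p : P1) (l : Lx) (v : p.submodule) (k : Fin 2) :
    eulerMap p l v k = v.1 k • l := rfl

/-- The map `L → E ⊕ Hom(ℓ, ℂ²) ⊗ L`, `l ↦ (-φ l, v ↦ v ⊗ l)`. -/
def relMap (φ : Lx →ₗ[ℂ] Ex) (p : P1) :
    Lx →ₗ[ℂ] Ex × (p.submodule →ₗ[ℂ] (Fin 2 → Lx)) :=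
  LinearMap.prod (-φ) (eulerMap p)

/-- The map `L → Hom(ℓ, L²)` sending `l` to `v ↦ v i • (l in position i + 1)`. -/
def coordMap (i : Fin 2) (p : P1) : Lx →ₗ[ℂ] (p.submodule →ₗ[ℂ] (Fin 2 → Lx)) where
  toFun l :=
    { toFun := fun v => v.1 i • Pi.single (i + 1) l
      map_add' := fun _ _ => add_smul _ _ _
      map_smul' := fun _ _ => mul_smul _ _ _ }
  map_add' l l' := LinearMap.ext fun v => by
    change v.1 i • (Pi.single (i + 1) (l + l') : Fin 2 → Lx) = _
    rw [Pi.single_add, smul_add]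
    rfl
  map_smul' c l := LinearMap.ext fun v => by
    change v.1 i • (Pi.single (i + 1) (c • l) : Fin 2 → Lx) = _
    rw [Pi.single_smul, smul_comm]
    rfl

lemma coordMap_apply (i : Fin 2) (p : P1) (l : Lx) (v : p.submodule) (k : Fin 2) :
    coordMap i p l v k = if k = i + 1 then v.1 i • l else 0 := by
  change (v.1 i • (Pi.single (i + 1) l : Fin 2 → Lx)) k = _
  rw [Pi.smul_apply, Pi.single_apply, smul_ite, smul_zero]

/-- The fibre `(E ⊕ Hom(ℓ, ℂ²) ⊗ L) / L` of the push-out. -/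
abbrev FibAt (φ : Lx →ₗ[ℂ] Ex) (p : P1) : Type _ :=
  (Ex × (p.submodule →ₗ[ℂ] (Fin 2 → Lx))) ⧸ LinearMap.range (relMap φ p)

/-- `ψ ↦ (ψ n) k` where `n` is the vector of `ℓ` with `n i = 1`. -/
def evalMap (i : Fin 2) (p : P1) (k : Fin 2) : (p.submodule →ₗ[ℂ] (Fin 2 → Lx)) →ₗ[ℂ] Lx :=
  LinearMap.proj k ∘ₗ LinearMap.applyₗ (⟨_, P1.normVec_mem i p⟩ : p.submodule)

lemma evalMap_apply (i : Fin 2) (p : P1) (k : Fin 2) (ψ : p.submodule →ₗ[ℂ] (Fin 2 → Lx)) :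
    evalMap i p k ψ = ψ ⟨_, P1.normVec_mem i p⟩ k := rfl

/-- On the `i`-th affine open set of `ℙ¹`: a class `[e, ψ]` is written uniquely as `[e', ψ']`
where the `i`-th coordinate of `ψ' n` vanishes, `n` being the vector of `ℓ` with `n i = 1`; this is
the map `[e, ψ] ↦ (e', ψ' n (i + 1))`. -/
def toProd (φ : Lx →ₗ[ℂ] Ex) (i : Fin 2) (p : P1) (hp : p ∈ P1.U i) :
    FibAt φ p →ₗ[ℂ] Ex × Lx :=
  Submodule.liftQ _
    (LinearMap.prod (LinearMap.fst _ _ _ + φ ∘ₗ evalMap i p i ∘ₗ LinearMap.snd _ _ _)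
      ((evalMap i p (i + 1) - P1.coord i p • evalMap i p i) ∘ₗ LinearMap.snd _ _ _))
    (by
      rintro _ ⟨l, rfl⟩
      rw [LinearMap.mem_ker]
      simp [relMap, P1.normVec_self hp, P1.coord, evalMap_apply, eulerMap_apply])

/-- The inverse of `toProd`: `(e, l) ↦ [e, v ↦ v i • (l in position i + 1)]`. -/
def ofProd (φ : Lx →ₗ[ℂ] Ex) (i : Fin 2) (p : P1) : Ex × Lx →ₗ[ℂ] FibAt φ p :=
  Submodule.mkQ _ ∘ₗ LinearMap.prodMap LinearMap.id (coordMap i p)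

lemma toProd_mk (φ : Lx →ₗ[ℂ] Ex) (i : Fin 2) (p : P1) (hp : p ∈ P1.U i) (e : Ex)
    (ψ : p.submodule →ₗ[ℂ] (Fin 2 → Lx)) :
    toProd φ i p hp (Submodule.mkQ _ (e, ψ)) =
      (e + φ (evalMap i p i ψ), evalMap i p (i + 1) ψ - P1.coord i p • evalMap i p i ψ) := rfl

lemma ofProd_mk (φ : Lx →ₗ[ℂ] Ex) (i : Fin 2) (p : P1) (e : Ex) (l : Lx) :
    ofProd φ i p (e, l) = Submodule.mkQ _ (e, coordMap i p l) := rfl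

lemma toProd_ofProd (φ : Lx →ₗ[ℂ] Ex) (i : Fin 2) (p : P1) (hp : p ∈ P1.U i) (q : Ex × Lx) :
    toProd φ i p hp (ofProd φ i p q) = q := by
  obtain ⟨e, l⟩ := q
  have h := P1.fin2_succ_ne i
  rw [ofProd_mk, toProd_mk]
  simp [evalMap_apply, coordMap_apply, P1.normVec_self hp, h.symm]

lemma ofProd_toProd (φ : Lx →ₗ[ℂ] Ex) (i : Fin 2) (p : P1) (hp : p ∈ P1.U i) (q : FibAt φ p) :
    ofProd φ i p (toProd φ i p hp q) = q := by
  obtain ⟨⟨e, ψ⟩, rfl⟩ := Submodule.mkQ_surjective (LinearMap.range (relMap φ p)) q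
  have h := P1.fin2_succ_ne i
  rw [toProd_mk, ofProd_mk, ← sub_eq_zero, ← map_sub, ← LinearMap.mem_ker, Submodule.ker_mkQ]
  refine ⟨-evalMap i p i ψ, ?_⟩
  refine Prod.ext ?_ ?_
  · simp [relMap]
  · refine LinearMap.ext fun v => funext fun k => ?_
    have hv : v = v.1 i • (⟨_, P1.normVec_mem i p⟩ : p.submodule) :=
      Subtype.ext (P1.eq_smul_normVec hp v.2)
    have hψ : ∀ k, ψ v k = v.1 i • evalMap i p k ψ := by
      intro k
      conv_lhs => rw [hv, map_smul]
      rfl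
    have hc : v.1 (i + 1) = v.1 i * P1.coord i p := by
      have := congrFun (congrArg Subtype.val hv) (i + 1)
      simpa [P1.coord] using this
    change eulerMap p (-evalMap i p i ψ) v k =
      coordMap i p (evalMap i p (i + 1) ψ - P1.coord i p • evalMap i p i ψ) v k - ψ v k
    rw [eulerMap_apply, coordMap_apply, hψ]
    rcases P1.fin2_cases i k with rfl | rfl
    · simp [h.symm]
    · simp [hc, smul_sub, mul_smul]

/-- `toProd` as a linear equivalence. -/
def prodEquiv (φ : Lx →ₗ[ℂ] Ex) (i : Fin 2) (p : P1) (hp : p ∈ P1.U i) :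
    FibAt φ p ≃ₗ[ℂ] Ex × Lx :=
  LinearEquiv.ofLinearMap (toProd φ i p hp) (ofProd φ i p)
    (LinearMap.ext (toProd_ofProd φ i p hp)) (LinearMap.ext (ofProd_toProd φ i p hp))

/-- The change of frame on the overlap, in the coordinate `u = v i / v j` of the `j`-th affine
open set, `j ≠ i`: it is `(e, l) ↦ (e + u φ l, - u² l)`. -/
lemma toProd_ofProd_ne (φ : Lx →ₗ[ℂ] Ex) {i j : Fin 2} (hij : i = j + 1) (p : P1)
    (hp : p ∈ P1.U j) (q : Ex × Lx) :
    toProd φ j p hp (ofProd φ i p q) =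
      (q.1 + P1.coord j p • φ q.2, (-(P1.coord j p) ^ 2) • q.2) := by
  subst hij
  obtain ⟨e, l⟩ := q
  have h := P1.fin2_succ_ne j
  rw [ofProd_mk, toProd_mk]
  refine Prod.ext ?_ ?_
  · simp [evalMap_apply, coordMap_apply, P1.fin2_succ_succ, P1.coord]
  · simp [evalMap_apply, coordMap_apply, P1.fin2_succ_succ, h, P1.coord, smul_smul, sq]

end Algebra
end Triple

namespace Triple

section Bundle

variable {EX : Type*} [NormedAddCommGroup EX] [NormedSpace ℂ EX]
  {X : Type*} [TopologicalSpace X] [ChartedSpace EX X]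
  {FE : Type*} [NormedAddCommGroup FE] [NormedSpace ℂ FE]
  {E : X → Type*} [TopologicalSpace (TotalSpace FE E)]
  [∀ x, AddCommGroup (E x)] [∀ x, Module ℂ (E x)] [∀ x, TopologicalSpace (E x)]
  [∀ x, IsTopologicalAddGroup (E x)] [∀ x, ContinuousSMul ℂ (E x)]
  [FiberBundle FE E] [VectorBundle ℂ FE E]
  {L : X → Type*} [TopologicalSpace (TotalSpace ℂ L)]
  [∀ x, AddCommGroup (L x)] [∀ x, Module ℂ (L x)] [∀ x, TopologicalSpace (L x)]
  [FiberBundle ℂ L] [VectorBundle ℂ ℂ L]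

variable (EX FE E L) in
/-- Holomorphic bundle maps `φ : L → E`. -/
abbrev HolHom : Type _ :=
  ContMDiffSection 𝓘(ℂ, EX) (ℂ →L[ℂ] FE) ω (fun x => L x →L[ℂ] E x)

/-- The fibre over `(x, ℓ)` of the bundle determined by `φ`. -/
def Fib (φ : HolHom EX FE E L) (b : X × P1) : Type _ :=
  FibAt (φ b.1 : L b.1 →ₗ[ℂ] E b.1) b.2

variable (φ : HolHom EX FE E L)

instance (b : X × P1) : AddCommGroup (Fib φ b) :=
  inferInstanceAs (AddCommGroup (FibAt (φ b.1 : L b.1 →ₗ[ℂ] E b.1) b.2))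

instance (b : X × P1) : Module ℂ (Fib φ b) :=
  inferInstanceAs (Module ℂ (FibAt (φ b.1 : L b.1 →ₗ[ℂ] E b.1) b.2))

/-- The identification of a fibre with `E x × L x` over the `i`-th affine open subset. -/
def fibEquiv (i : Fin 2) (b : X × P1) (hb : b.2 ∈ P1.U i) : Fib φ b ≃ₗ[ℂ] E b.1 × L b.1 :=
  prodEquiv (φ b.1 : L b.1 →ₗ[ℂ] E b.1) i b.2 hb

lemma fibEquiv_fibEquiv_symm {i j : Fin 2} (hij : i = j + 1) (b : X × P1) (hi : b.2 ∈ P1.U i)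
    (hj : b.2 ∈ P1.U j) (q : E b.1 × L b.1) :
    fibEquiv φ j b hj ((fibEquiv φ i b hi).symm q) =
      (q.1 + P1.coord j b.2 • φ b.1 q.2, (-(P1.coord j b.2) ^ 2) • q.2) :=
  toProd_ofProd_ne (φ b.1 : L b.1 →ₗ[ℂ] E b.1) hij b.2 hj q

/-- The topology making the identification with `E x × L x` a homeomorphism. -/
instance (b : X × P1) : TopologicalSpace (Fib φ b) :=
  TopologicalSpace.induced (fibEquiv φ (P1.idx b.2) b (P1.mem_U_idx b.2)) inferInstance

open Classical in
/-- The holomorphic trivialization over `(U_E ∩ U_L) × U i` given by trivializations of `E`, `L`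
over `U_E`, `U_L` and by the `i`-th affine chart of `ℙ¹`. -/
def pretriv (eE : Trivialization FE (π FE E)) (eL : Trivialization ℂ (π ℂ L))
    [eE.IsLinear ℂ] [eL.IsLinear ℂ] (i : Fin 2) :
    Pretrivialization (FE × ℂ) (π (FE × ℂ) (Fib φ)) where
  toFun q := (q.1, if h : q.1.2 ∈ P1.U i then
    Prod.map (eE.linearMapAt ℂ q.1.1) (eL.linearMapAt ℂ q.1.1) (fibEquiv φ i q.1 h q.2) else 0)
  invFun q := ⟨q.1, if h : q.1.2 ∈ P1.U i then
    (fibEquiv φ i q.1 h).symm (eE.symmₗ ℂ q.1.1 q.2.1, eL.symmₗ ℂ q.1.1 q.2.2) else 0⟩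
  source := TotalSpace.proj ⁻¹' ((eE.baseSet ∩ eL.baseSet) ×ˢ P1.U i)
  target := ((eE.baseSet ∩ eL.baseSet) ×ˢ P1.U i) ×ˢ univ
  map_source' := fun _ h => ⟨h, mem_univ _⟩
  map_target' := fun _ h => h.1
  left_inv' := by
    rintro ⟨b, q⟩ ⟨⟨h1, h2⟩, h3⟩
    have h3' : b.2 ∈ P1.U i := h3
    simp only [TotalSpace.mk_inj, h3', dif_pos, Prod.map]
    rw [LinearEquiv.symm_apply_eq]
    refine Prod.ext ?_ ?_
    · exact eE.symmₗ_linearMapAt (R := ℂ) h1 _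
    · exact eL.symmₗ_linearMapAt (R := ℂ) h2 _
  right_inv' := by
    rintro ⟨b, q⟩ ⟨⟨⟨h1, h2⟩, h3⟩, -⟩
    have h3' : b.2 ∈ P1.U i := h3
    simp only [h3', dif_pos, Prod.map, LinearEquiv.apply_symm_apply]
    refine Prod.ext rfl (Prod.ext ?_ ?_)
    · exact eE.linearMapAt_symmₗ (R := ℂ) h1 _
    · exact eL.linearMapAt_symmₗ (R := ℂ) h2 _
  open_target := ((eE.open_baseSet.inter eL.open_baseSet).prod (P1.isOpen_U i)).prod isOpen_univ
  baseSet := (eE.baseSet ∩ eL.baseSet) ×ˢ P1.U i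
  open_baseSet := (eE.open_baseSet.inter eL.open_baseSet).prod (P1.isOpen_U i)
  source_eq := rfl
  target_eq := rfl
  proj_toFun _ _ := rfl

lemma pretriv_apply (eE : Trivialization FE (π FE E)) (eL : Trivialization ℂ (π ℂ L))
    [eE.IsLinear ℂ] [eL.IsLinear ℂ] (i : Fin 2) (b : X × P1) (hb : b.2 ∈ P1.U i) (q : Fib φ b) :
    (pretriv φ eE eL i ⟨b, q⟩).2 =
      (eE.linearMapAt ℂ b.1 (fibEquiv φ i b hb q).1,
        eL.linearMapAt ℂ b.1 (fibEquiv φ i b hb q).2) := by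
  classical
  change (if h : b.2 ∈ P1.U i then _ else _) = _
  rw [dif_pos hb]
  rfl

lemma pretriv_symm_apply (eE : Trivialization FE (π FE E)) (eL : Trivialization ℂ (π ℂ L))
    [eE.IsLinear ℂ] [eL.IsLinear ℂ] (i : Fin 2) (b : X × P1)
    (hb : b ∈ (eE.baseSet ∩ eL.baseSet) ×ˢ P1.U i) (q : FE × ℂ) :
    (pretriv φ eE eL i).symm b q =
      (fibEquiv φ i b hb.2).symm (eE.symmₗ ℂ b.1 q.1, eL.symmₗ ℂ b.1 q.2) := by
  have h : (⟨b, (pretriv φ eE eL i).symm b q⟩ : TotalSpace (FE × ℂ) (Fib φ)) =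
      (pretriv φ eE eL i).toPartialEquiv.symm (b, q) :=
    (pretriv φ eE eL i).mk_symm hb q
  have h' : (pretriv φ eE eL i).toPartialEquiv.symm (b, q) =
      (⟨b, (fibEquiv φ i b hb.2).symm (eE.symmₗ ℂ b.1 q.1, eL.symmₗ ℂ b.1 q.2)⟩ :
        TotalSpace (FE × ℂ) (Fib φ)) := by
    have := dif_pos (c := b.2 ∈ P1.U i) (t := fun h => (fibEquiv φ i b h).symm
      (eE.symmₗ ℂ b.1 q.1, eL.symmₗ ℂ b.1 q.2)) (e := fun _ => 0) hb.2
        (h := Classical.propDecidable _)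
    exact congrArg (TotalSpace.mk b) this
  exact TotalSpace.mk_inj.1 (h.trans h')

instance (eE : Trivialization FE (π FE E)) (eL : Trivialization ℂ (π ℂ L))
    [eE.IsLinear ℂ] [eL.IsLinear ℂ] (i : Fin 2) : (pretriv φ eE eL i).IsLinear ℂ where
  linear b hb :=
    { map_add q q' := by simp [pretriv_apply φ eE eL i b hb.2]
      map_smul c q := by simp [pretriv_apply φ eE eL i b hb.2] }

/-- The transition functions: the block matrix with diagonal entries the transition functions of
`E` and `L ⊗ O(2)`, and with upper right entry `u • φ` in frames. -/
def transition (eE eE' : Trivialization FE (π FE E)) (eL eL' : Trivialization ℂ (π ℂ L))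
    [eE.IsLinear ℂ] [eE'.IsLinear ℂ] [eL.IsLinear ℂ] [eL'.IsLinear ℂ] (i j : Fin 2) (b : X × P1) :
    (FE × ℂ) →L[ℂ] (FE × ℂ) :=
  ContinuousLinearMap.prod
    ((eE.coordChangeL ℂ eE' b.1 : FE →L[ℂ] FE) ∘L ContinuousLinearMap.fst ℂ FE ℂ +
      (if i = j then 0 else P1.coord j b.2) •
        (((eE'.continuousLinearMapAt ℂ b.1) ∘L (φ b.1) ∘L (eL.symmL ℂ b.1)) ∘L
          ContinuousLinearMap.snd ℂ FE ℂ))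
    ((if i = j then 1 else -(P1.coord j b.2) ^ 2) •
      ((eL.coordChangeL ℂ eL' b.1 : ℂ →L[ℂ] ℂ) ∘L ContinuousLinearMap.snd ℂ FE ℂ))

lemma transition_apply (eE eE' : Trivialization FE (π FE E)) (eL eL' : Trivialization ℂ (π ℂ L))
    [eE.IsLinear ℂ] [eE'.IsLinear ℂ] [eL.IsLinear ℂ] [eL'.IsLinear ℂ] (i j : Fin 2) (b : X × P1)
    (hb : b ∈ (eE.baseSet ∩ eL.baseSet) ×ˢ P1.U i ∩ (eE'.baseSet ∩ eL'.baseSet) ×ˢ P1.U j)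
    (q : FE × ℂ) :
    transition φ eE eE' eL eL' i j b q =
      (pretriv φ eE' eL' j ⟨b, (pretriv φ eE eL i).symm b q⟩).2 := by
  rw [pretriv_apply φ eE' eL' j b hb.2.2, pretriv_symm_apply φ eE eL i b hb.1]
  have hE : ∀ v, eE'.linearMapAt ℂ b.1 (eE.symmₗ ℂ b.1 v) = eE.coordChangeL ℂ eE' b.1 v := by
    intro v
    rw [eE.coordChangeL_apply eE' ⟨hb.1.1.1, hb.2.1.1⟩, eE'.coe_linearMapAt_of_mem hb.2.1.1,
      eE.symmₗ_apply hb.1.1.1]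
  have hL : ∀ v, eL'.linearMapAt ℂ b.1 (eL.symmₗ ℂ b.1 v) = eL.coordChangeL ℂ eL' b.1 v := by
    intro v
    rw [eL.coordChangeL_apply eL' ⟨hb.1.1.2, hb.2.1.2⟩, eL'.coe_linearMapAt_of_mem hb.2.1.2,
      eL.symmₗ_apply hb.1.1.2]
  rcases P1.fin2_cases j i with rfl | hij
  · rw [LinearEquiv.apply_symm_apply]
    simp [transition, hE, hL]
  · have hne : i ≠ j := by rw [hij]; exact P1.fin2_succ_ne j
    rw [fibEquiv_fibEquiv_symm φ hij b hb.1.2 hb.2.2]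
    simp only [transition, hne, if_false, map_add, map_smul, hE, hL]
    rfl

lemma contMDiffOn_transition [IsManifold 𝓘(ℂ, EX) ω X]
    [ContMDiffVectorBundle ω FE E 𝓘(ℂ, EX)] [ContMDiffVectorBundle ω ℂ L 𝓘(ℂ, EX)]
    (eE eE' : Trivialization FE (π FE E)) (eL eL' : Trivialization ℂ (π ℂ L))
    [MemTrivializationAtlas eE] [MemTrivializationAtlas eE']
    [MemTrivializationAtlas eL] [MemTrivializationAtlas eL'] (i j : Fin 2) :
    ContMDiffOn (𝓘(ℂ, EX).prod 𝓘(ℂ)) 𝓘(ℂ, (FE × ℂ) →L[ℂ] (FE × ℂ)) ω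
      (transition φ eE eE' eL eL' i j)
      ((eE.baseSet ∩ eL.baseSet) ×ˢ P1.U i ∩ (eE'.baseSet ∩ eL'.baseSet) ×ˢ P1.U j) := by
  have h1 : ContMDiffOn (𝓘(ℂ, EX).prod 𝓘(ℂ)) 𝓘(ℂ, FE →L[ℂ] FE) ω
      (fun b : X × P1 => (eE.coordChangeL ℂ eE' b.1 : FE →L[ℂ] FE))
      ((eE.baseSet ∩ eL.baseSet) ×ˢ P1.U i ∩ (eE'.baseSet ∩ eL'.baseSet) ×ˢ P1.U j) :=
    (contMDiffOn_coordChangeL (IB := 𝓘(ℂ, EX)) eE eE' (n := ω)).comp contMDiffOn_fst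
      (fun b hb => ⟨hb.1.1.1, hb.2.1.1⟩)
  have h2 : ContMDiffOn (𝓘(ℂ, EX).prod 𝓘(ℂ)) 𝓘(ℂ, ℂ →L[ℂ] ℂ) ω
      (fun b : X × P1 => (eL.coordChangeL ℂ eL' b.1 : ℂ →L[ℂ] ℂ))
      ((eE.baseSet ∩ eL.baseSet) ×ˢ P1.U i ∩ (eE'.baseSet ∩ eL'.baseSet) ×ˢ P1.U j) :=
    (contMDiffOn_coordChangeL (IB := 𝓘(ℂ, EX)) eL eL' (n := ω)).comp contMDiffOn_fst
      (fun b hb => ⟨hb.1.1.2, hb.2.1.2⟩)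
  have h3 : ContMDiffOn (𝓘(ℂ, EX).prod 𝓘(ℂ)) 𝓘(ℂ, ℂ →L[ℂ] FE) ω
      (fun b : X × P1 => (eE'.continuousLinearMapAt ℂ b.1) ∘L (φ b.1) ∘L (eL.symmL ℂ b.1))
      ((eE.baseSet ∩ eL.baseSet) ×ˢ P1.U i ∩ (eE'.baseSet ∩ eL'.baseSet) ×ˢ P1.U j) := by
    have h := ((eL.continuousLinearMap (RingHom.id ℂ) eE').contMDiffOn_section_baseSet_iff
      (IB := 𝓘(ℂ, EX)) (n := ω) (s := φ)).1 φ.contMDiff.contMDiffOn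
    exact h.comp contMDiffOn_fst (fun b hb => ⟨hb.1.1.2, hb.2.1.1⟩)
  have h4 : ContMDiffOn (𝓘(ℂ, EX).prod 𝓘(ℂ)) 𝓘(ℂ) ω (fun b : X × P1 => P1.coord j b.2)
      ((eE.baseSet ∩ eL.baseSet) ×ˢ P1.U i ∩ (eE'.baseSet ∩ eL'.baseSet) ×ˢ P1.U j) :=
    (P1.contMDiffOn_coord j).comp contMDiffOn_snd (fun b hb => hb.2.2)
  have h5 : ContMDiffOn (𝓘(ℂ, EX).prod 𝓘(ℂ)) 𝓘(ℂ) ω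
      (fun b : X × P1 => if i = j then 0 else P1.coord j b.2)
      ((eE.baseSet ∩ eL.baseSet) ×ˢ P1.U i ∩ (eE'.baseSet ∩ eL'.baseSet) ×ˢ P1.U j) := by
    split_ifs
    · exact contMDiffOn_const
    · exact h4
  have h6 : ContMDiffOn (𝓘(ℂ, EX).prod 𝓘(ℂ)) 𝓘(ℂ) ω
      (fun b : X × P1 => if i = j then 1 else -(P1.coord j b.2) ^ 2)
      ((eE.baseSet ∩ eL.baseSet) ×ˢ P1.U i ∩ (eE'.baseSet ∩ eL'.baseSet) ×ˢ P1.U j) := by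
    split_ifs
    · exact contMDiffOn_const
    · exact (contDiff_neg.comp (contDiff_id.pow 2)).contMDiff.comp_contMDiffOn h4
  have h7 := (contMDiffOn_const (c := ContinuousLinearMap.inl ℂ FE ℂ)).clm_comp
    ((h1.clm_comp (contMDiffOn_const (c := ContinuousLinearMap.fst ℂ FE ℂ))).add
      (h5.smul (h3.clm_comp (contMDiffOn_const (c := ContinuousLinearMap.snd ℂ FE ℂ)))))
  have h8 := (contMDiffOn_const (c := ContinuousLinearMap.inr ℂ FE ℂ)).clm_comp
    (h6.smul (h2.clm_comp (contMDiffOn_const (c := ContinuousLinearMap.snd ℂ FE ℂ))))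
  refine (h7.add h8).congr fun b _ => ?_
  refine ContinuousLinearMap.ext fun q => Prod.ext ?_ ?_
  · simp [transition]
  · by_cases hij : i = j <;> simp [transition, hij]

section Holomorphic

variable [IsManifold 𝓘(ℂ, EX) ω X]
  [ContMDiffVectorBundle ω FE E 𝓘(ℂ, EX)] [ContMDiffVectorBundle ω ℂ L 𝓘(ℂ, EX)]

/-- The trivializations `pretriv` assemble to a vector bundle over `X × ℙ¹`. -/
def vectorPrebundle : VectorPrebundle ℂ (FE × ℂ) (Fib φ) where
  pretrivializationAtlas :=
    {e | ∃ (eE : Trivialization FE (π FE E)) (eL : Trivialization ℂ (π ℂ L))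
      (_ : MemTrivializationAtlas eE) (_ : MemTrivializationAtlas eL) (i : Fin 2),
        e = pretriv φ eE eL i}
  pretrivialization_linear' := by
    rintro _ ⟨eE, eL, hE, hL, i, rfl⟩
    infer_instance
  pretrivializationAt b :=
    pretriv φ (trivializationAt FE E b.1) (trivializationAt ℂ L b.1) (P1.idx b.2)
  mem_base_pretrivializationAt b :=
    ⟨⟨mem_baseSet_trivializationAt FE E b.1, mem_baseSet_trivializationAt ℂ L b.1⟩,
      P1.mem_U_idx b.2⟩
  pretrivialization_mem_atlas b :=
    ⟨trivializationAt FE E b.1, trivializationAt ℂ L b.1, inferInstance, inferInstance, _, rfl⟩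
  exists_coordChange := by
    rintro _ ⟨eE, eL, hE, hL, i, rfl⟩ _ ⟨eE', eL', hE', hL', j, rfl⟩
    exact ⟨transition φ eE eE' eL eL' i j,
      (contMDiffOn_transition φ eE eE' eL eL' i j).continuousOn,
      fun b hb q => transition_apply φ eE eE' eL eL' i j b hb q⟩
  totalSpaceMk_isInducing b := by
    have hE := mem_baseSet_trivializationAt FE E b.1
    have hL := mem_baseSet_trivializationAt ℂ L b.1
    let A := (trivializationAt FE E b.1).continuousLinearEquivAt ℂ b.1 hE
    let B := (trivializationAt ℂ L b.1).continuousLinearEquivAt ℂ b.1 hL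
    have h0 : Topology.IsInducing (fibEquiv φ (P1.idx b.2) b (P1.mem_U_idx b.2)) := ⟨rfl⟩
    have h1 := (A.toHomeomorph.isInducing.prodMap B.toHomeomorph.isInducing).comp h0
    have h2 := (Topology.isInducing_const_prod (x := b)).mpr h1
    convert h2 using 1
    funext q
    refine Prod.ext rfl ?_
    refine (pretriv_apply φ _ _ _ b (P1.mem_U_idx b.2) q).trans ?_
    rw [Trivialization.coe_linearMapAt_of_mem _ hE, Trivialization.coe_linearMapAt_of_mem _ hL]
    rfl

instance : TopologicalSpace (TotalSpace (FE × ℂ) (Fib φ)) :=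
  (vectorPrebundle φ).totalSpaceTopology

instance : FiberBundle (FE × ℂ) (Fib φ) := (vectorPrebundle φ).toFiberBundle

instance : VectorBundle ℂ (FE × ℂ) (Fib φ) := (vectorPrebundle φ).toVectorBundle

instance : (vectorPrebundle φ).IsContMDiff (𝓘(ℂ, EX).prod 𝓘(ℂ)) ω where
  exists_contMDiffCoordChange := by
    rintro _ ⟨eE, eL, hE, hL, i, rfl⟩ _ ⟨eE', eL', hE', hL', j, rfl⟩
    exact ⟨transition φ eE eE' eL eL' i j, contMDiffOn_transition φ eE eE' eL eL' i j,
      fun b hb q => transition_apply φ eE eE' eL eL' i j b hb q⟩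

instance : ContMDiffVectorBundle ω (FE × ℂ) (Fib φ) (𝓘(ℂ, EX).prod 𝓘(ℂ)) :=
  (vectorPrebundle φ).contMDiffVectorBundle (𝓘(ℂ, EX).prod 𝓘(ℂ))

end Holomorphic

end Bundle
end Triple

/-! ### Hermitian metrics, Chern curvature, contraction with the fundamental form -/

section Hermitian

variable {EM : Type*} [NormedAddCommGroup EM] [NormedSpace ℂ EM]
  {HM : Type*} [TopologicalSpace HM] (I : ModelWithCorners ℂ EM HM)
  {M : Type*} [TopologicalSpace M] [ChartedSpace HM M]
  (F : Type*) [NormedAddCommGroup F] [NormedSpace ℂ F]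
  (V : M → Type*) [TopologicalSpace (TotalSpace F V)]
  [∀ b, AddCommGroup (V b)] [∀ b, Module ℂ (V b)] [∀ b, TopologicalSpace (V b)]
  [FiberBundle F V] [VectorBundle ℂ F V]

/-- A family `h` of sesquilinear forms on the fibres of a holomorphic vector bundle, written in the
preferred chart and the preferred holomorphic frame at `b₀`, as a function of the point of the
chart; `gram h b₀ z t s = h s t` for the frame vectors `s`, `t` at the point with coordinate
`z`. -/
def gram (h : ∀ b, V b →L⋆[ℂ] V b →L[ℂ] ℂ) (b₀ : M) (z : EM) : F →L[ℂ] F →L⋆[ℂ] ℂ :=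
  let S := (trivializationAt F V b₀).symmL ℂ ((extChartAt I b₀).symm z)
  ContinuousLinearMap.flip
    ((ContinuousLinearMap.precomp ℂ S).comp ((h ((extChartAt I b₀).symm z)).comp S))

/-- A smooth Hermitian metric on a holomorphic vector bundle `V`. It is conjugate linear in the
first variable. -/
structure HermitianMetric where
  inner (b : M) : V b →L⋆[ℂ] V b →L[ℂ] ℂ
  conj_symm (b : M) (v w : V b) : conj (inner b w v) = inner b v w
  pos (b : M) (v : V b) (hv : v ≠ 0) : 0 < (inner b v v).re
  smooth (b₀ : M) : ContDiffOn ℝ ∞ (gram I F V inner b₀)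
    ((extChartAt I b₀).target ∩ (extChartAt I b₀).symm ⁻¹' (trivializationAt F V b₀).baseSet)

/-- The connection form `θ = h⁻¹ ∂h`, as a function of the point `z` and of the tangent vector `v`,
of the Chern connection of a metric with Gram matrix `A` in a holomorphic frame. -/
def chernForm {F : Type*} [NormedAddCommGroup F] [NormedSpace ℂ F]
    (A : EM → F →L[ℂ] F →L⋆[ℂ] ℂ) (z v : EM) : F →L[ℂ] F :=
  (A z).inverse ∘L
    ((1 / 2 : ℂ) • (fderiv ℝ A z v - Complex.I • fderiv ℝ A z (Complex.I • v)))

/-- The curvature `dθ + θ ∧ θ` at `z`, evaluated on the tangent vectors `u`, `v`. -/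
def chernCurvature {F : Type*} [NormedAddCommGroup F] [NormedSpace ℂ F]
    (A : EM → F →L[ℂ] F →L⋆[ℂ] ℂ) (z u v : EM) : F →L[ℂ] F :=
  fderiv ℝ (fun y => chernForm A y v) z u - fderiv ℝ (fun y => chernForm A y u) z v +
    (chernForm A z u ∘L chernForm A z v - chernForm A z v ∘L chernForm A z u)

variable {I F V}

/-- A Hermitian metric as an inner product on each fibre. -/
@[reducible] def HermitianMetric.core (h : HermitianMetric I F V) (b : M) : InnerProductSpace.Core ℂ (V b) where
  inner v w := h.inner b v w
  conj_inner_symm v w := h.conj_symm b v w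
  re_inner_nonneg v := by
    by_cases hv : v = 0
    · simp [hv]
    · exact (h.pos b v hv).le
  add_left v w u := by simp
  smul_left v w c := by simp
  definite v hv := by
    by_contra h0
    have := h.pos b v h0
    rw [hv] at this
    simp at this

/-- The curvature of the Chern connection of `h`, an `End V`-valued 2-form on `M`. -/
def HermitianMetric.curvature (h : HermitianMetric I F V) (b : M) (u v : TangentSpace I b) :
    V b →ₗ[ℂ] V b :=
  (trivializationAt F V b).symmₗ ℂ b ∘ₗ
    (chernCurvature (gram I F V h.inner b) (extChartAt I b b) u v : F →ₗ[ℂ] F) ∘ₗ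
    (trivializationAt F V b).linearMapAt ℂ b

/-- The contraction `Λ α` of a 2-form `α` (of type (1,1)) with the fundamental form of a Hermitian
inner product `g`: it is `∑ j, α (e j) (i e j)` for any `g`-unitary basis `e`. -/
def contraction {T W : Type*} [AddCommGroup T] [Module ℂ T] [FiniteDimensional ℂ T]
    [AddCommGroup W] (g : InnerProductSpace.Core ℂ T) (α : T → T → W) : W :=
  letI : NormedAddCommGroup T := g.toNormedAddCommGroup
  letI : InnerProductSpace ℂ T := InnerProductSpace.ofCore g.toCore
  ∑ j, α (stdOrthonormalBasis ℂ T j) (Complex.I • stdOrthonormalBasis ℂ T j)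

instance [FiniteDimensional ℂ EM] (b : M) : FiniteDimensional ℂ (TangentSpace I b) :=
  inferInstanceAs (FiniteDimensional ℂ EM)

/-- The endomorphism `i Λ F_h` of `V`, for a Hermitian metric `h` on `V` and Hermitian inner
products `g` on the tangent spaces. -/
def HermitianMetric.iLambdaCurvature [FiniteDimensional ℂ EM] (h : HermitianMetric I F V)
    (g : ∀ b : M, InnerProductSpace.Core ℂ (TangentSpace I b)) (b : M) : V b →ₗ[ℂ] V b :=
  Complex.I • contraction (g b) (h.curvature b)

end Hermitian

/-- A Kähler metric on a complex manifold: a Hermitian metric on the tangent bundle whose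
fundamental form is closed. In a chart the fundamental form is `(u, v) ↦ Re h(i u, v) = Im h(u, v)`,
which is `Im (gram z v u)`. -/
structure KahlerMetric (EX : Type*) [NormedAddCommGroup EX] [NormedSpace ℂ EX]
    (X : Type*) [TopologicalSpace X] [ChartedSpace EX X] [IsManifold 𝓘(ℂ, EX) ω X] extends
    HermitianMetric 𝓘(ℂ, EX) EX (TangentSpace 𝓘(ℂ, EX) : X → Type _) where
  closed (b₀ : X) (z : EX) (hz : z ∈ (extChartAt 𝓘(ℂ, EX) b₀).target) (u v w : EX) :
    let G := gram 𝓘(ℂ, EX) EX (TangentSpace 𝓘(ℂ, EX) : X → Type _) inner b₀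
    (fderiv ℝ G z u w v).im + (fderiv ℝ G z v u w).im + (fderiv ℝ G z w v u).im = 0

/-- The Hermitian inner product `conj a * b / c` on `ℂ`. -/
@[reducible] def coreDiv (c : ℝ) (hc : 0 < c) : InnerProductSpace.Core ℂ ℂ where
  inner a b := conj a * b / c
  conj_inner_symm a b := by simp [mul_comm]
  re_inner_nonneg a := by
    change 0 ≤ (conj a * a / c : ℂ).re
    rw [Complex.conj_mul', ← Complex.ofReal_pow, ← Complex.ofReal_div, Complex.ofReal_re]
    positivity
  add_left a b d := by
    change conj (a + b) * d / _ = conj a * d / _ + conj b * d / _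
    rw [map_add]; ring
  smul_left a b r := by
    change conj (r * a) * b / _ = conj r * (conj a * b / _)
    rw [map_mul]; ring
  definite a h := by
    change (conj a * a / c : ℂ) = 0 at h
    rw [div_eq_zero_iff, Complex.conj_mul'] at h
    rcases h with h | h
    · simpa using h
    · exact absurd (Complex.ofReal_eq_zero.1 h) hc.ne'

/-- The Hermitian inner product `g + σ g'` on a direct sum. -/
@[reducible] def coreProd {T T' : Type*} [AddCommGroup T] [Module ℂ T] [AddCommGroup T']
    [Module ℂ T'] (g : InnerProductSpace.Core ℂ T) (g' : InnerProductSpace.Core ℂ T')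
    (σ : ℝ) (hσ : 0 < σ) : InnerProductSpace.Core ℂ (T × T') where
  inner u v := g.inner u.1 v.1 + σ * g'.inner u.2 v.2
  conj_inner_symm u v := by
    rw [map_add, map_mul, g.conj_inner_symm, g'.conj_inner_symm, Complex.conj_ofReal]
  re_inner_nonneg u := by
    have h1 := g.re_inner_nonneg u.1
    have h2 := g'.re_inner_nonneg u.2
    change 0 ≤ (g.inner u.1 u.1 + σ * g'.inner u.2 u.2).re
    rw [Complex.add_re, Complex.re_ofReal_mul]
    exact add_nonneg h1 (mul_nonneg hσ.le h2)
  add_left u v w := by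
    change g.inner (u.1 + v.1) w.1 + σ * g'.inner (u.2 + v.2) w.2 =
      (g.inner u.1 w.1 + σ * g'.inner u.2 w.2) + (g.inner v.1 w.1 + σ * g'.inner v.2 w.2)
    rw [g.add_left, g'.add_left]; ring
  smul_left u v r := by
    change g.inner (r • u.1) v.1 + σ * g'.inner (r • u.2) v.2 =
      conj r * (g.inner u.1 v.1 + σ * g'.inner u.2 v.2)
    rw [g.smul_left, g'.smul_left]; ring
  definite u h := by
    have h1 : 0 ≤ (g.inner u.1 u.1).re := g.re_inner_nonneg u.1
    have h2 : 0 ≤ (g'.inner u.2 u.2).re := g'.re_inner_nonneg u.2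
    have h' : (g.inner u.1 u.1).re + σ * (g'.inner u.2 u.2).re = 0 := by
      rw [← Complex.re_ofReal_mul, ← Complex.add_re]
      exact congrArg Complex.re h
    have h3 := mul_nonneg hσ.le h2
    have e1 : (g.inner u.1 u.1).re = 0 := by linarith
    have e2 : (g'.inner u.2 u.2).re = 0 := by
      have : σ * (g'.inner u.2 u.2).re = 0 := by linarith
      exact (mul_eq_zero.1 this).resolve_left hσ.ne'
    have i1 : (g.inner u.1 u.1).im = 0 := Complex.conj_eq_iff_im.1 (g.conj_inner_symm u.1 u.1)
    have i2 : (g'.inner u.2 u.2).im = 0 := Complex.conj_eq_iff_im.1 (g'.conj_inner_symm u.2 u.2)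
    exact Prod.ext (g.definite _ (Complex.ext e1 i1)) (g'.definite _ (Complex.ext e2 i2))

/-- The Fubini–Study Hermitian inner product on `T_p ℙ¹`, normalized so that `ℙ¹` has volume `1`:
it is `conj a * b / (π (1 + |z|²)²)` in each affine coordinate `z`, with fundamental form
`(i / 2π) dz ∧ dz̄ / (1 + |z|²)²`. -/
@[reducible] def fubiniStudy (p : P1) : InnerProductSpace.Core ℂ (TangentSpace 𝓘(ℂ) p) :=
  coreDiv (Real.pi * (1 + ‖chartAt ℂ p p‖ ^ 2) ^ 2) (by positivity)

/-- The Kähler metric on `X × ℙ¹` with fundamental form `ω_σ = p^* ω_X + σ q^* ω_{ℙ¹}`; the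
tangent space of the product is the product of the tangent spaces. -/
@[reducible] def KahlerMetric.prodP1 {EX : Type*} [NormedAddCommGroup EX] [NormedSpace ℂ EX]
    {X : Type*} [TopologicalSpace X] [ChartedSpace EX X] [IsManifold 𝓘(ℂ, EX) ω X]
    (g : KahlerMetric EX X) (σ : ℝ) (hσ : 0 < σ) (b : X × P1) :
    InnerProductSpace.Core ℂ (TangentSpace (𝓘(ℂ, EX).prod 𝓘(ℂ)) b) :=
  coreProd (g.core b.1) (fubiniStudy b.2) σ hσ

/-! ### The coupled vortex equations and invariant metrics -/

namespace Triple

section Action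

variable {Ex Lx : Type*} [AddCommGroup Ex] [Module ℂ Ex] [AddCommGroup Lx] [Module ℂ Lx]

/-- The standard linear action of `SU(2)` on `ℂ²`. -/
abbrev su2Lin (s : Matrix.specialUnitaryGroup (Fin 2) ℂ) : (Fin 2 → ℂ) →ₗ[ℂ] (Fin 2 → ℂ) :=
  Matrix.toLin' s.1

lemma su2Lin_inv (s : Matrix.specialUnitaryGroup (Fin 2) ℂ) (v : Fin 2 → ℂ) :
    su2Lin s (su2Lin s⁻¹ v) = v := by
  rw [← LinearMap.comp_apply, ← Matrix.toLin'_mul]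
  have : (s.1 * (s⁻¹).1 : Matrix (Fin 2) (Fin 2) ℂ) = 1 := congrArg Subtype.val (mul_inv_cancel s)
  rw [this, Matrix.toLin'_one, LinearMap.id_apply]

lemma su2Lin_injective (s : Matrix.specialUnitaryGroup (Fin 2) ℂ) :
    Function.Injective (su2Lin s) := by
  intro v w h
  have := congrArg (su2Lin s⁻¹) h
  have h2 := su2Lin_inv s⁻¹
  rw [inv_inv] at h2
  rwa [h2, h2] at this

/-- The action of `SU(2)` on `ℙ¹`. -/
def su2P1 (s : Matrix.specialUnitaryGroup (Fin 2) ℂ) (p : P1) : P1 :=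
  Projectivization.map (su2Lin s) (su2Lin_injective s) p

lemma su2Lin_inv_mem (s : Matrix.specialUnitaryGroup (Fin 2) ℂ) (p : P1) {v : Fin 2 → ℂ}
    (hv : v ∈ (su2P1 s p).submodule) : su2Lin s⁻¹ v ∈ p.submodule := by
  induction p using Projectivization.ind with
  | h w hw =>
    rw [su2P1, Projectivization.map_mk, Projectivization.submodule_mk,
      Submodule.mem_span_singleton] at hv
    obtain ⟨a, rfl⟩ := hv
    have h2 := su2Lin_inv s⁻¹
    rw [inv_inv] at h2
    rw [map_smul, h2, Projectivization.submodule_mk]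
    exact Submodule.smul_mem _ _ (Submodule.mem_span_singleton_self w)

/-- The inverse of `s`, as a map from the line `s ℓ` to the line `ℓ`. -/
def su2InvOn (s : Matrix.specialUnitaryGroup (Fin 2) ℂ) (p : P1) :
    (su2P1 s p).submodule →ₗ[ℂ] p.submodule :=
  (su2Lin s⁻¹).restrict (fun _ hv => su2Lin_inv_mem s p hv)

/-- The action of `SU(2)` on `ℂ² ⊗ L = L²`. -/
def su2Tensor (s : Matrix.specialUnitaryGroup (Fin 2) ℂ) : (Fin 2 → Lx) →ₗ[ℂ] (Fin 2 → Lx) :=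
  LinearMap.pi fun k => ∑ j, s.1 k j • LinearMap.proj j

/-- The action `[e, ψ] ↦ [e, s ∘ ψ ∘ s⁻¹]` on the fibres. -/
def su2FibAt (φ : Lx →ₗ[ℂ] Ex) (s : Matrix.specialUnitaryGroup (Fin 2) ℂ) (p : P1) :
    FibAt φ p →ₗ[ℂ] FibAt φ (su2P1 s p) :=
  Submodule.mapQ _ _
    (LinearMap.prodMap LinearMap.id
      ((su2Tensor s).compRight ℂ ∘ₗ LinearMap.lcomp ℂ (Fin 2 → Lx) (su2InvOn s p)))
    (by
      rintro _ ⟨l, rfl⟩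
      refine ⟨l, Prod.ext rfl (LinearMap.ext fun v => funext fun k => ?_)⟩
      have h := congrFun (su2Lin_inv s v.1) k
      change v.1 k • l = su2Tensor s (eulerMap p l (su2InvOn s p v)) k
      rw [← h]
      simp [su2Tensor, eulerMap_apply, su2InvOn, Matrix.toLin'_apply, Matrix.mulVec,
        dotProduct]
      simp only [add_smul, mul_smul])

end Action

section Main

variable {EX : Type*} [NormedAddCommGroup EX] [NormedSpace ℂ EX]
  {X : Type*} [TopologicalSpace X] [ChartedSpace EX X] [IsManifold 𝓘(ℂ, EX) ω X]
  {FE : Type*} [NormedAddCommGroup FE] [NormedSpace ℂ FE]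
  {E : X → Type*} [TopologicalSpace (TotalSpace FE E)]
  [∀ x, AddCommGroup (E x)] [∀ x, Module ℂ (E x)] [∀ x, TopologicalSpace (E x)]
  [∀ x, IsTopologicalAddGroup (E x)] [∀ x, ContinuousSMul ℂ (E x)]
  [FiberBundle FE E] [VectorBundle ℂ FE E] [ContMDiffVectorBundle ω FE E 𝓘(ℂ, EX)]
  {L : X → Type*} [TopologicalSpace (TotalSpace ℂ L)]
  [∀ x, AddCommGroup (L x)] [∀ x, Module ℂ (L x)] [∀ x, TopologicalSpace (L x)]
  [FiberBundle ℂ L] [VectorBundle ℂ ℂ L] [ContMDiffVectorBundle ω ℂ L 𝓘(ℂ, EX)]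

/-- The `SU(2)`-action on the bundle over `X × ℙ¹` determined by a triple: trivial on `E`, `L` and
on `X`, and standard on `ℙ¹` and `O(2)`. -/
def su2Fib (φ : HolHom EX FE E L) (s : Matrix.specialUnitaryGroup (Fin 2) ℂ) (x : X) (p : P1) :
    Fib φ (x, p) →ₗ[ℂ] Fib φ (x, su2P1 s p) :=
  su2FibAt (φ x : L x →ₗ[ℂ] E x) s p

/-- A Hermitian metric on the bundle over `X × ℙ¹` is invariant if `SU(2)` acts by isometries. -/
def IsSU2Invariant {φ : HolHom EX FE E L}
    (h : HermitianMetric (𝓘(ℂ, EX).prod 𝓘(ℂ)) (FE × ℂ) (Fib φ)) : Prop :=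
  ∀ (s : Matrix.specialUnitaryGroup (Fin 2) ℂ) (x : X) (p : P1) (ξ η : Fib φ (x, p)),
    h.inner (x, su2P1 s p) (su2Fib φ s x p ξ) (su2Fib φ s x p η) = h.inner (x, p) ξ η

/-- The coupled vortex equations with functions `t`, `t'` as parameters:
`i Λ F_H + φ φ^* = t I_E` and `i Λ F_K - φ^* φ = t' I_L`, where `φ^*` is the adjoint of `φ : L → E`
with respect to `H` and `K`. (As `L` is a line bundle, `φ^* φ` is the scalar `|φ|²`.) -/
def CoupledVortex [FiniteDimensional ℂ EX] (g : KahlerMetric EX X) (φ : HolHom EX FE E L)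
    (t t' : X → ℝ) (H : HermitianMetric 𝓘(ℂ, EX) FE E) (K : HermitianMetric 𝓘(ℂ, EX) ℂ L) :
    Prop :=
  ∃ φs : ∀ x, E x →ₗ[ℂ] L x,
    (∀ x (e : E x) (l : L x), K.inner x (φs x e) l = H.inner x e (φ x l)) ∧
    (∀ x, H.iLambdaCurvature g.core x + (φ x : L x →ₗ[ℂ] E x) ∘ₗ φs x =
      (t x : ℂ) • LinearMap.id) ∧
    (∀ x, K.iLambdaCurvature g.core x - φs x ∘ₗ (φ x : L x →ₗ[ℂ] E x) =
      (t' x : ℂ) • LinearMap.id)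

/-- The weak Hermitian–Einstein equation `i Λ_σ F_h = t I` for a metric on the bundle over `X × ℙ¹`
determined by a triple, with respect to `ω_σ`. -/
def WeakHermitianEinstein [FiniteDimensional ℂ EX] (g : KahlerMetric EX X) (σ : ℝ) (hσ : 0 < σ)
    {φ : HolHom EX FE E L} (t : X → ℝ)
    (h : HermitianMetric (𝓘(ℂ, EX).prod 𝓘(ℂ)) (FE × ℂ) (Fib φ)) : Prop :=
  ∀ b : X × P1, h.iLambdaCurvature (g.prodP1 σ hσ) b = (t b.1 : ℂ) • LinearMap.id

end Main

end Triple

end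

/-!
The bundle on `X × ℙ¹` splits orthogonally for any `SU(2)`-invariant metric. Over the line spanned
by `v ∈ ℂ²` the splitting is
`[e, ψ] ↦ (e + φ ⟨v, ψ v⟩ / |v|², v ∧ ψ v / |v|²)` (`Triple.split`), a smooth, non-holomorphic
identification of the fibre with `E ⊕ L`. It is `SU(2)`-equivariant, and it does not depend on `v`
except for a phase in the second component, so that metrics `H` on `E` and `K` on `L` give an
invariant metric `H ⊕ c K` (`Triple.IsSplit`, `Triple.splitMetric`). Conversely every invariant
metric is of this form: as `SU(2)` is transitive on unit vectors, the metric is determined by its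
values over `[1 : 0]`, and there the diagonal elements of `SU(2)` act on the two summands by
different characters, which makes the summands orthogonal (`Triple.IsSU2Invariant.isSplit`). The
metrics `H` and `K` are the restrictions to the slice `X × {[1 : 0]}`, hence smooth.

It remains to compute the curvature of `H ⊕ c K`. In the holomorphic frame over the affine
coordinate `w` the splitting is the shear `(e, l) ↦ (e + μ φ l, l)` with `μ = w̄ / (1 + |w|²)`, and
the Gram matrix is the pull-back by this shear of `H ⊕ c ρ K`, with `ρ = 1 / (1 + |w|²)²`
(`modelForm`). The contraction with `ω_σ` involves the curvature only in the directions of `X` and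
of `ℙ¹` separately (`contraction_coreProd_coreDiv`):
* in the directions of `X`, for fixed `w`, the shear is holomorphic, and the curvature is
  `F_H ⊕ F_K`, conjugated by the shear (`curvForm_modelForm_base`);
* in the direction of `ℙ¹` all coefficients but `μ` and `ρ` are constant, the connection form is a
  quadratic polynomial in `μ`, and the curvature is `ρ` times
  `(-φ φ^* / c) ⊕ (φ^* φ / c - 2)`, conjugated by the shear (`FibreDirection.curvForm_eq`,
  `curvForm_modelForm_fibre`).

Contracted with `σ ω_{ℙ¹}`, the second term is multiplied by `-2 π / (σ ρ)`. The choice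
`c = 2 π / σ` therefore turns it into `φ φ^* ⊕ (-φ^* φ + 4 π / σ)`, so that `i Λ_σ F` is conjugate
to `(i Λ F_H + φ φ^*) ⊕ (i Λ F_K - φ^* φ + 4 π / σ)` (`I_smul_contraction_modelForm`). Since
`t - t' = 4 π / σ`, this is `t I` at a point of `X × ℙ¹` exactly if the vortex equations hold at the
point of `X` below it (`Triple.IsSplit.iLambdaCurvature_eq_iff`).
-/

noncomputable section

/-! ### Contraction with a fundamental form -/

/-- The contraction may be computed in any unitary basis, for a 2-form `α` which is of type (1,1)
in the sense that `α(u, i u) = R(u, u)` for a sesquilinear form `R`. -/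
lemma contraction_eq_sum {T W : Type*} [AddCommGroup T] [Module ℂ T] [FiniteDimensional ℂ T]
    [AddCommGroup W] [Module ℂ W] (g : InnerProductSpace.Core ℂ T) (α : T → T → W)
    (R : T →ₗ⋆[ℂ] T →ₗ[ℂ] W) (hα : ∀ u, α u (Complex.I • u) = R u u)
    {ι : Type*} [Fintype ι] [DecidableEq ι] (b : ι → T)
    (hb : ∀ i j, g.inner (b i) (b j) = if i = j then 1 else 0)
    (hspan : ⊤ ≤ Submodule.span ℂ (range b)) :
    contraction g α = ∑ i, α (b i) (Complex.I • b i) := by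
  let : NormedAddCommGroup T := g.toNormedAddCommGroup
  let : InnerProductSpace ℂ T := InnerProductSpace.ofCore g.toCore
  have hon : Orthonormal ℂ b := orthonormal_iff_ite.2 hb
  let B : OrthonormalBasis ι ℂ T := OrthonormalBasis.mk hon hspan
  have hB : ∀ i, B i = b i := fun i => by simp [B]
  change ∑ j, α (stdOrthonormalBasis ℂ T j) (Complex.I • stdOrthonormalBasis ℂ T j) = _
  set e := stdOrthonormalBasis ℂ T
  simp only [hα, ← hB]
  have h1 : ∀ j, R (e j) (e j) =
      ∑ k, ∑ l, (inner ℂ (e j) (B k) * inner ℂ (B l) (e j)) • R (B k) (B l) := by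
    intro j
    conv_lhs => rw [← B.sum_repr' (e j)]
    simp only [map_sum, LinearMap.sum_apply, map_smulₛₗ, LinearMap.smul_apply, RingHom.id_apply,
      Finset.smul_sum, smul_smul, inner_conj_symm]
    rw [Finset.sum_comm]
    refine Finset.sum_congr rfl fun k _ => Finset.sum_congr rfl fun l _ => ?_
    rw [mul_comm]
  simp only [h1]
  rw [Finset.sum_comm]
  refine Finset.sum_congr rfl fun k _ => ?_
  rw [Finset.sum_comm]
  simp only [← Finset.sum_smul]
  rw [Finset.sum_eq_single k]
  · have : ∑ j, inner ℂ (e j) (B k) * inner ℂ (B k) (e j) = 1 := by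
      have := e.sum_inner_mul_inner (B k) (B k)
      rw [inner_self_eq_norm_sq_to_K, B.norm_eq_one] at this
      rw [← Finset.sum_congr rfl fun j _ => mul_comm (inner ℂ (B k) (e j)) (inner ℂ (e j) (B k)),
        this]
      simp
    rw [this, one_smul]
  · intro l _ hl
    have : ∑ j, inner ℂ (e j) (B k) * inner ℂ (B l) (e j) = 0 := by
      rw [← Finset.sum_congr rfl fun j _ => mul_comm (inner ℂ (B l) (e j)) (inner ℂ (e j) (B k)),
        e.sum_inner_mul_inner (B l) (B k), B.inner_eq_ite, if_neg hl]
    rw [this, zero_smul]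
  · simp

/-- Contraction with the fundamental form of `g + σ |·|² / c` on `T ⊕ ℂ`: the vector
`(0, √(c / σ))` completes a unitary basis of `T`. -/
lemma contraction_coreProd_coreDiv {T W : Type*} [AddCommGroup T] [Module ℂ T]
    [FiniteDimensional ℂ T] [AddCommGroup W] [Module ℂ W] (g : InnerProductSpace.Core ℂ T)
    (c : ℝ) (hc : 0 < c) (σ : ℝ) (hσ : 0 < σ) (α : T × ℂ → T × ℂ → W)
    (R : T × ℂ →ₗ⋆[ℂ] T × ℂ →ₗ[ℂ] W) (hα : ∀ u, α u (Complex.I • u) = R u u) :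
    contraction (coreProd g (coreDiv c hc) σ hσ) α =
      contraction g (fun u v => α (u, 0) (v, 0)) +
        ((c / σ : ℝ) : ℂ) • α (0, 1) (0, Complex.I) := by
  let : NormedAddCommGroup T := g.toNormedAddCommGroup
  let : InnerProductSpace ℂ T := InnerProductSpace.ofCore g.toCore
  let e := stdOrthonormalBasis ℂ T
  let r : ℝ := Real.sqrt (c / σ)
  have hr : r * r = c / σ := Real.mul_self_sqrt (by positivity)
  have hr0 : r ≠ 0 := (Real.sqrt_pos.2 (by positivity)).ne'
  let b : Fin (finrank ℂ T) ⊕ Unit → T × ℂ := Sum.elim (fun j => (e j, 0)) (fun _ => (0, (r : ℂ)))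
  have hg : ∀ i j, g.inner (e i) (e j) = if i = j then 1 else 0 := fun i j =>
    orthonormal_iff_ite.1 e.orthonormal i j
  have hz : ∀ u, g.inner 0 u = 0 := fun u => inner_zero_left (𝕜 := ℂ) u
  have hz' : ∀ u, g.inner u 0 = 0 := fun u => inner_zero_right (𝕜 := ℂ) u
  rw [contraction_eq_sum (coreProd g (coreDiv c hc) σ hσ) α R hα b]
  · rw [Fintype.sum_sum_type]
    congr 1
    · change _ = ∑ j, α (e j, 0) (Complex.I • e j, 0)
      refine Finset.sum_congr rfl fun j _ => ?_
      simp [b]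
    · have h2 : ((0, Complex.I) : T × ℂ) = Complex.I • ((0, 1) : T × ℂ) := by simp
      have h3 : ((0, (r : ℂ)) : T × ℂ) = (r : ℂ) • ((0, 1) : T × ℂ) := by simp
      simp only [Finset.univ_unique, Finset.sum_singleton, b, Sum.elim_inr]
      rw [hα, h2, hα, h3]
      simp only [map_smulₛₗ, LinearMap.smul_apply, RingHom.id_apply, smul_smul, Complex.conj_ofReal]
      rw [← Complex.ofReal_mul, hr]
  · have hσ' : (σ : ℂ) ≠ 0 := by exact_mod_cast hσ.ne'
    have hc' : (c : ℂ) ≠ 0 := by exact_mod_cast hc.ne'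
    have h4 : (r : ℂ) * r = c / σ := by exact_mod_cast hr
    rintro (i | i) (j | j)
    · change g.inner (e i) (e j) + σ * (conj 0 * 0 / c) = _
      simp [hg]
    · change g.inner (e i) 0 + σ * (conj 0 * _ / c) = _
      simp [hz']
    · change g.inner 0 (e j) + σ * (_ * 0 / c) = _
      simp [hz]
    · change g.inner 0 0 + σ * (conj (r : ℂ) * r / c) = _
      rw [Complex.conj_ofReal, h4, hz]
      simp
      field_simp
  · rintro ⟨u, z⟩ -
    have h1 : ((u, 0) : T × ℂ) ∈ Submodule.span ℂ (range b) := by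
      have : u ∈ Submodule.span ℂ (range e) := by
        rw [← e.coe_toBasis, e.toBasis.span_eq]; trivial
      have h := Submodule.mem_map_of_mem (f := LinearMap.inl ℂ T ℂ) this
      rw [Submodule.map_span] at h
      refine Submodule.span_mono ?_ h
      rintro _ ⟨_, ⟨j, rfl⟩, rfl⟩
      exact ⟨Sum.inl j, rfl⟩
    have h2 : ((0, z) : T × ℂ) ∈ Submodule.span ℂ (range b) := by
      have : ((0, z) : T × ℂ) = (z / r) • b (Sum.inr ()) := by
        have : (r : ℂ) ≠ 0 := by exact_mod_cast hr0
        simp [b, this]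
      rw [this]
      exact Submodule.smul_mem _ _ (Submodule.subset_span ⟨_, rfl⟩)
    simpa using Submodule.add_mem _ h1 h2

/-! ### Wirtinger derivatives and the Chern connection -/

section Wirtinger

variable {EM : Type*} [NormedAddCommGroup EM] [NormedSpace ℂ EM]
  {W : Type*} [NormedAddCommGroup W] [NormedSpace ℂ W]

/-- The (1,0)-derivative `∂f` of `f` at `z`, evaluated on the tangent vector `v`. -/
def dz (f : EM → W) (z v : EM) : W :=
  (1 / 2 : ℂ) • (fderiv ℝ f z v - Complex.I • fderiv ℝ f z (Complex.I • v))

/-- The (0,1)-derivative `∂̄f` of `f` at `z`, evaluated on the tangent vector `v`. -/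
def dzb (f : EM → W) (z v : EM) : W :=
  (1 / 2 : ℂ) • (fderiv ℝ f z v + Complex.I • fderiv ℝ f z (Complex.I • v))

lemma dz_I_smul (f : EM → W) (z v : EM) : dz f z (Complex.I • v) = Complex.I • dz f z v := by
  simp only [dz, smul_smul Complex.I Complex.I, Complex.I_mul_I, neg_one_smul, map_neg]
  rw [smul_comm Complex.I, smul_sub Complex.I, smul_smul, Complex.I_mul_I]
  module

lemma dzb_I_smul (f : EM → W) (z v : EM) :
    dzb f z (Complex.I • v) = -(Complex.I • dzb f z v) := by
  simp only [dzb, smul_smul Complex.I Complex.I, Complex.I_mul_I, neg_one_smul, map_neg]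
  rw [smul_comm Complex.I, smul_add Complex.I, smul_smul, Complex.I_mul_I]
  module

lemma dz_add_right (f : EM → W) (z u v : EM) : dz f z (u + v) = dz f z u + dz f z v := by
  simp only [dz, smul_add, map_add]; module

lemma dzb_add_right (f : EM → W) (z u v : EM) : dzb f z (u + v) = dzb f z u + dzb f z v := by
  simp only [dzb, smul_add, map_add]; module

lemma dz_smul_right (f : EM → W) (z v : EM) (c : ℂ) : dz f z (c • v) = c • dz f z v := by
  have hr : ∀ (r : ℝ) (u : EM), dz f z (r • u) = r • dz f z u := by
    intro r u
    rw [dz, dz, smul_comm Complex.I r u, map_smul, map_smul, smul_comm Complex.I r, ← smul_sub,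
      smul_comm]
  conv_lhs => rw [← Complex.re_add_im c, add_smul, mul_smul]
  rw [dz_add_right, Complex.coe_smul, Complex.coe_smul, hr, hr, dz_I_smul]
  conv_rhs => rw [← Complex.re_add_im c, add_smul, mul_smul]
  rw [Complex.coe_smul, Complex.coe_smul]

lemma dzb_smul_right (f : EM → W) (z v : EM) (c : ℂ) : dzb f z (c • v) = conj c • dzb f z v := by
  have hr : ∀ (r : ℝ) (u : EM), dzb f z (r • u) = r • dzb f z u := by
    intro r u
    rw [dzb, dzb, smul_comm Complex.I r u, map_smul, map_smul, smul_comm Complex.I r, ← smul_add,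
      smul_comm]
  have hc : conj c = (c.re : ℂ) + (c.im : ℂ) * (-Complex.I) := by
    apply Complex.ext <;> simp
  conv_lhs => rw [← Complex.re_add_im c, add_smul, mul_smul]
  rw [dzb_add_right, Complex.coe_smul, Complex.coe_smul, hr, hr, dzb_I_smul, hc, add_smul, mul_smul,
    Complex.coe_smul, Complex.coe_smul, neg_smul]

lemma dz_add {f g : EM → W} {z : EM} (hf : DifferentiableAt ℝ f z) (hg : DifferentiableAt ℝ g z)
    (v : EM) : dz (fun y => f y + g y) z v = dz f z v + dz g z v := by
  simp only [dz, fderiv_fun_add hf hg, add_apply]; module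

lemma dzb_add {f g : EM → W} {z : EM} (hf : DifferentiableAt ℝ f z) (hg : DifferentiableAt ℝ g z)
    (v : EM) : dzb (fun y => f y + g y) z v = dzb f z v + dzb g z v := by
  simp only [dzb, fderiv_fun_add hf hg, add_apply]; module

lemma dz_const (c : W) (z v : EM) : dz (fun _ => c) z v = 0 := by
  simp [dz]

lemma dzb_const (c : W) (z v : EM) : dzb (fun _ => c) z v = 0 := by
  simp [dzb]

lemma dz_congr {f g : EM → W} {z : EM} (h : f =ᶠ[𝓝 z] g) (v : EM) : dz f z v = dz g z v := by
  simp only [dz, h.fderiv_eq]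

lemma dzb_congr {f g : EM → W} {z : EM} (h : f =ᶠ[𝓝 z] g) (v : EM) : dzb f z v = dzb g z v := by
  simp only [dzb, h.fderiv_eq]

lemma fderiv_real_eq {f : EM → W} {z : EM} (h : DifferentiableAt ℂ f z) (v : EM) :
    fderiv ℝ f z v = fderiv ℂ f z v := by
  rw [h.fderiv_restrictScalars ℝ]; rfl

lemma dz_of_holomorphic {f : EM → W} {z : EM} (h : DifferentiableAt ℂ f z) (v : EM) :
    dz f z v = fderiv ℂ f z v := by
  simp only [dz, fderiv_real_eq h, map_smul, smul_smul, Complex.I_mul_I]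
  module

lemma dzb_of_holomorphic {f : EM → W} {z : EM} (h : DifferentiableAt ℂ f z) (v : EM) :
    dzb f z v = 0 := by
  simp only [dzb, fderiv_real_eq h, map_smul, smul_smul, Complex.I_mul_I]
  module

variable {W₁ W₂ W₃ : Type*} [NormedAddCommGroup W₁] [NormedSpace ℂ W₁]
  [NormedAddCommGroup W₂] [NormedSpace ℂ W₂] [NormedAddCommGroup W₃] [NormedSpace ℂ W₃]

lemma hasFDerivAt_clm (B : W₁ →L[ℂ] W₂) {f : EM → W₁} {z : EM} (hf : DifferentiableAt ℝ f z) :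
    HasFDerivAt (𝕜 := ℝ) (fun y => B (f y)) ((B.restrictScalars ℝ).comp (fderiv ℝ f z)) z :=
  (B.restrictScalars ℝ).hasFDerivAt.comp z hf.hasFDerivAt

lemma dzb_clm (B : W₁ →L[ℂ] W₂) {f : EM → W₁} {z : EM} (hf : DifferentiableAt ℝ f z) (v : EM) :
    dzb (fun y => B (f y)) z v = B (dzb f z v) := by
  simp [dzb, (hasFDerivAt_clm B hf).fderiv]

/-- A continuous conjugate linear map, regarded as a real linear map. -/
def realOfConj (B : W₁ →L⋆[ℂ] W₂) : W₁ →L[ℝ] W₂ :=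
  AddMonoidHom.toRealLinearMap (B : W₁ →+ W₂) B.continuous

lemma realOfConj_apply (B : W₁ →L⋆[ℂ] W₂) (x : W₁) : realOfConj B x = B x := rfl

lemma hasFDerivAt_conj_clm (B : W₁ →L⋆[ℂ] W₂) {f : EM → W₁} {z : EM}
    (hf : DifferentiableAt ℝ f z) :
    HasFDerivAt (𝕜 := ℝ) (fun y => B (f y)) ((realOfConj B).comp (fderiv ℝ f z)) z :=
  (realOfConj B).hasFDerivAt.comp z hf.hasFDerivAt

lemma dz_conj_clm (B : W₁ →L⋆[ℂ] W₂) {f : EM → W₁} {z : EM} (hf : DifferentiableAt ℝ f z)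
    (v : EM) : dz (fun y => B (f y)) z v = B (dzb f z v) := by
  simp [dz, dzb, (hasFDerivAt_conj_clm B hf).fderiv, realOfConj_apply, map_smulₛₗ, sub_eq_add_neg,
    map_ofNat]

lemma hasFDerivAt_bilin (B : W₁ →L[ℂ] W₂ →L[ℂ] W₃) {f : EM → W₁} {g : EM → W₂} {z : EM}
    (hf : DifferentiableAt ℝ f z) (hg : DifferentiableAt ℝ g z) :
    HasFDerivAt (𝕜 := ℝ) (fun y => B (f y) (g y))
      (((B.bilinearRestrictScalars ℝ).precompR EM (f z) (fderiv ℝ g z)) +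
        ((B.bilinearRestrictScalars ℝ).precompL EM (fderiv ℝ f z) (g z))) z :=
  (B.bilinearRestrictScalars ℝ).hasFDerivAt_of_bilinear hf.hasFDerivAt hg.hasFDerivAt

lemma fderiv_bilin (B : W₁ →L[ℂ] W₂ →L[ℂ] W₃) {f : EM → W₁} {g : EM → W₂} {z : EM}
    (hf : DifferentiableAt ℝ f z) (hg : DifferentiableAt ℝ g z) (v : EM) :
    fderiv ℝ (fun y => B (f y) (g y)) z v =
      B (f z) (fderiv ℝ g z v) + B (fderiv ℝ f z v) (g z) := by
  rw [(hasFDerivAt_bilin B hf hg).fderiv]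
  rfl

lemma dz_bilin (B : W₁ →L[ℂ] W₂ →L[ℂ] W₃) {f : EM → W₁} {g : EM → W₂} {z : EM}
    (hf : DifferentiableAt ℝ f z) (hg : DifferentiableAt ℝ g z) (v : EM) :
    dz (fun y => B (f y) (g y)) z v = B (dz f z v) (g z) + B (f z) (dz g z v) := by
  simp only [dz, fderiv_bilin B hf hg, map_smul, map_sub,
    smul_apply, sub_apply]
  module

lemma dzb_bilin (B : W₁ →L[ℂ] W₂ →L[ℂ] W₃) {f : EM → W₁} {g : EM → W₂} {z : EM}
    (hf : DifferentiableAt ℝ f z) (hg : DifferentiableAt ℝ g z) (v : EM) :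
    dzb (fun y => B (f y) (g y)) z v = B (dzb f z v) (g z) + B (f z) (dzb g z v) := by
  simp only [dzb, fderiv_bilin B hf hg, map_smul, map_add,
    smul_apply, add_apply]
  module

lemma DifferentiableAt.compC {f : EM → W₂ →L[ℂ] W₃} {g : EM → W₁ →L[ℂ] W₂} {z : EM}
    (hf : DifferentiableAt ℝ f z) (hg : DifferentiableAt ℝ g z) :
    DifferentiableAt ℝ (fun y => f y ∘L g y) z :=
  (hasFDerivAt_bilin (ContinuousLinearMap.compL ℂ W₁ W₂ W₃) hf hg).differentiableAt

lemma dz_comp {f : EM → W₂ →L[ℂ] W₃} {g : EM → W₁ →L[ℂ] W₂} {z : EM}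
    (hf : DifferentiableAt ℝ f z) (hg : DifferentiableAt ℝ g z) (v : EM) :
    dz (fun y => f y ∘L g y) z v = dz f z v ∘L g z + f z ∘L dz g z v :=
  dz_bilin (ContinuousLinearMap.compL ℂ W₁ W₂ W₃) hf hg v

lemma dzb_comp {f : EM → W₂ →L[ℂ] W₃} {g : EM → W₁ →L[ℂ] W₂} {z : EM}
    (hf : DifferentiableAt ℝ f z) (hg : DifferentiableAt ℝ g z) (v : EM) :
    dzb (fun y => f y ∘L g y) z v = dzb f z v ∘L g z + f z ∘L dzb g z v :=
  dzb_bilin (ContinuousLinearMap.compL ℂ W₁ W₂ W₃) hf hg v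

lemma DifferentiableAt.smulC {f : EM → ℂ} {g : EM → W} {z : EM}
    (hf : DifferentiableAt ℝ f z) (hg : DifferentiableAt ℝ g z) :
    DifferentiableAt ℝ (fun y => f y • g y) z :=
  (hasFDerivAt_bilin (ContinuousLinearMap.lsmul ℂ ℂ) hf hg).differentiableAt

lemma dz_smul_const {f : EM → ℂ} {z : EM} (hf : DifferentiableAt ℝ f z) (c : W) (v : EM) :
    dz (fun y => f y • c) z v = dz f z v • c := by
  have := dz_bilin (ContinuousLinearMap.lsmul ℂ ℂ) hf (differentiableAt_const c) v
  rw [dz_const, map_zero, add_zero] at this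
  exact this

lemma dzb_smul_const {f : EM → ℂ} {z : EM} (hf : DifferentiableAt ℝ f z) (c : W) (v : EM) :
    dzb (fun y => f y • c) z v = dzb f z v • c := by
  have := dzb_bilin (ContinuousLinearMap.lsmul ℂ ℂ) hf (differentiableAt_const c) v
  rw [dzb_const, map_zero, add_zero] at this
  exact this

variable {EM' : Type*} [NormedAddCommGroup EM'] [NormedSpace ℂ EM']

lemma hasFDerivAt_affine (ι : EM' →L[ℂ] EM) (c : EM) (y : EM') :
    HasFDerivAt (𝕜 := ℝ) (fun y => c + ι y) (ι.restrictScalars ℝ) y :=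
  (ι.restrictScalars ℝ).hasFDerivAt.const_add c

lemma fderiv_comp_affine (ι : EM' →L[ℂ] EM) (c : EM) {f : EM → W} {y : EM'}
    (hf : DifferentiableAt ℝ f (c + ι y)) (w : EM') :
    fderiv ℝ (fun y => f (c + ι y)) y w = fderiv ℝ f (c + ι y) (ι w) := by
  have : HasFDerivAt (fun y => f (c + ι y)) _ y :=
    hf.hasFDerivAt.comp y (hasFDerivAt_affine ι c y)
  rw [this.fderiv]
  rfl

lemma dz_comp_affine (ι : EM' →L[ℂ] EM) (c : EM) {f : EM → W} {y : EM'}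
    (hf : DifferentiableAt ℝ f (c + ι y)) (w : EM') :
    dz (fun y => f (c + ι y)) y w = dz f (c + ι y) (ι w) := by
  simp only [dz, fderiv_comp_affine ι c hf, map_smul]

lemma dzb_comp_affine (ι : EM' →L[ℂ] EM) (c : EM) {f : EM → W} {y : EM'}
    (hf : DifferentiableAt ℝ f (c + ι y)) (w : EM') :
    dzb (fun y => f (c + ι y)) y w = dzb f (c + ι y) (ι w) := by
  simp only [dzb, fderiv_comp_affine ι c hf, map_smul]

end Wirtinger

section Connection

variable {EM : Type*} [NormedAddCommGroup EM] [NormedSpace ℂ EM]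
  {F : Type*} [NormedAddCommGroup F] [NormedSpace ℂ F]
  {D : Type*} [NormedAddCommGroup D] [NormedSpace ℂ D]

/-- The form `θ = A⁻¹ ∂A`, for a function `A` with values in the operators from `F` to a further
space `D`. For a Hermitian metric `D` is the space of conjugate linear functionals on `F`; only its
structure of a normed space matters for the calculus. -/
def connForm (A : EM → F →L[ℂ] D) (z v : EM) : F →L[ℂ] F :=
  (A z).inverse ∘L dz A z v

/-- The curvature form `∂̄(A⁻¹ ∂A)`, conjugate linear in `u` and linear in `v`. -/
def curvForm (A : EM → F →L[ℂ] D) (z u v : EM) : F →L[ℂ] F :=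
  dzb (fun y => connForm A y v) z u

/-- The connection form of `A` is characterized by `A θ = ∂A`. -/
lemma connForm_eq_of_comp {A : EM → F →L[ℂ] D} {z v : EM} (hA : (A z).IsInvertible)
    {θ : F →L[ℂ] F} (h : A z ∘L θ = dz A z v) : connForm A z v = θ := by
  rw [connForm, ← h, ← ContinuousLinearMap.comp_assoc, hA.inverse_comp_self,
    ContinuousLinearMap.id_comp]

lemma comp_connForm {A : EM → F →L[ℂ] D} {z : EM} (hA : (A z).IsInvertible) (v : EM) :
    A z ∘L connForm A z v = dz A z v := by
  rw [connForm, ← ContinuousLinearMap.comp_assoc, hA.self_comp_inverse,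
    ContinuousLinearMap.id_comp]

lemma connForm_add_right (A : EM → F →L[ℂ] D) (z u v : EM) :
    connForm A z (u + v) = connForm A z u + connForm A z v := by
  simp only [connForm, dz_add_right, ContinuousLinearMap.comp_add]

lemma connForm_smul_right (A : EM → F →L[ℂ] D) (z v : EM) (c : ℂ) :
    connForm A z (c • v) = c • connForm A z v := by
  simp only [connForm, dz_smul_right, ContinuousLinearMap.comp_smul]

lemma connForm_congr {A A' : EM → F →L[ℂ] D} {z : EM} (h : A =ᶠ[𝓝 z] A') (v : EM) :
    connForm A z v = connForm A' z v := by
  rw [connForm, connForm, dz_congr h, h.eq_of_nhds]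

lemma curvForm_congr {A A' : EM → F →L[ℂ] D} {z : EM} (h : A =ᶠ[𝓝 z] A')
    (u v : EM) : curvForm A z u v = curvForm A' z u v := by
  refine dzb_congr ?_ u
  filter_upwards [h.eventuallyEq_nhds] with y hy using connForm_congr hy v

lemma contDiffAt_connForm [CompleteSpace F] {A : EM → F →L[ℂ] D} {z : EM}
    (hA : ContDiffAt ℝ 2 A z) (hinv : (A z).IsInvertible) (v : EM) :
    ContDiffAt ℝ 1 (fun y => connForm A y v) z := by
  have h1 : ContDiffAt ℝ 1 (fun y => (A y).inverse) z :=
    ((hinv.contDiffAt_map_inverse (n := 1)).restrict_scalars ℝ).comp z (hA.of_le (by norm_num))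
  have h2 : ∀ w, ContDiffAt ℝ 1 (fun y => fderiv ℝ A y w) z := fun w =>
    (hA.fderiv_right (m := 1) (by norm_num)).clm_apply contDiffAt_const
  have h3 : ContDiffAt ℝ 1 (fun y => dz A y v) z :=
    ((h2 v).sub ((h2 (Complex.I • v)).const_smul Complex.I)).const_smul (1 / 2 : ℂ)
  exact ((ContinuousLinearMap.compL ℂ F D F).bilinearRestrictScalars
    ℝ).isBoundedBilinearMap.contDiff.contDiffAt.comp z (h1.prodMk h3)

lemma differentiableAt_connForm [CompleteSpace F] {A : EM → F →L[ℂ] D} {z : EM}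
    (hA : ContDiffAt ℝ 2 A z) (hinv : (A z).IsInvertible) (v : EM) :
    DifferentiableAt ℝ (fun y => connForm A y v) z :=
  (contDiffAt_connForm hA hinv v).differentiableAt (by norm_num)

lemma exists_sesq_curvForm [CompleteSpace F] {A : EM → F →L[ℂ] D} {z : EM}
    (hA : ContDiffAt ℝ 2 A z) (hinv : (A z).IsInvertible) :
    ∃ R : EM →ₗ⋆[ℂ] EM →ₗ[ℂ] (F →L[ℂ] F), ∀ u v, curvForm A z u v = R u v := by
  have hd := differentiableAt_connForm hA hinv
  refine ⟨LinearMap.mk₂'ₛₗ _ _ (fun u v => curvForm A z u v) ?_ ?_ ?_ ?_, fun u v => rfl⟩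
  · intro u u' v
    exact dzb_add_right _ _ _ _
  · intro c u v
    exact dzb_smul_right _ _ _ _
  · intro u v v'
    simp only [curvForm, connForm_add_right]
    rw [dzb_add (hd v) (hd v')]
  · intro c u v
    simp only [curvForm, connForm_smul_right]
    have := dzb_clm (c • ContinuousLinearMap.id ℂ (F →L[ℂ] F)) (hd v) u
    simp only [smul_apply, ContinuousLinearMap.id_apply] at this
    rw [this, RingHom.id_apply]

/-- The curvature is natural under restriction to affine subspaces. -/
lemma curvForm_comp_affine [CompleteSpace F] {EM' : Type*} [NormedAddCommGroup EM']
    [NormedSpace ℂ EM'] (ι : EM' →L[ℂ] EM) (c : EM) {A : EM → F →L[ℂ] D} {z : EM'}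
    (hA : ContDiffAt ℝ 2 A (c + ι z)) (hinv : (A (c + ι z)).IsInvertible) (u v : EM') :
    curvForm (fun y => A (c + ι y)) z u v = curvForm A (c + ι z) (ι u) (ι v) := by
  have hev : ∀ᶠ y in 𝓝 z, DifferentiableAt ℝ A (c + ι y) := by
    have h1 : ∀ᶠ y in 𝓝 (c + ι z), ContDiffAt ℝ 2 A y := hA.eventually (by simp)
    exact ((hasFDerivAt_affine ι c z).continuousAt.eventually h1).mono fun y hy =>
      hy.differentiableAt (by norm_num)
  have hform : (fun y => connForm (fun y => A (c + ι y)) y v) =ᶠ[𝓝 z]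
      fun y => connForm A (c + ι y) (ι v) := by
    filter_upwards [hev] with y hy
    rw [connForm, connForm, dz_comp_affine ι c hy]
  rw [curvForm, curvForm, dzb_congr hform,
    dzb_comp_affine ι c (differentiableAt_connForm hA hinv (ι v))]

/-- Naturality of the curvature under a change of frame: if `S` is holomorphic with inverse `S'`
and `T` is antiholomorphic, then the curvature of `T A S` is that of `A`, conjugated by `S`. -/
lemma curvForm_gauge [CompleteSpace F] {D' : Type*} [NormedAddCommGroup D'] [NormedSpace ℂ D']
    {A : EM → F →L[ℂ] D} {S S' : EM → F →L[ℂ] F} {T : EM → D →L[ℂ] D'} {z : EM}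
    (hA : ContDiffAt ℝ 2 A z) (hinv : (A z).IsInvertible)
    (hinvB : ∀ᶠ y in 𝓝 z, (T y ∘L (A y ∘L S y)).IsInvertible)
    (hinvA : ∀ᶠ y in 𝓝 z, (A y).IsInvertible)
    (hS : ContDiffAt ℂ 2 S z) (hS' : DifferentiableAt ℂ S' z)
    (hT : ∀ᶠ y in 𝓝 z, DifferentiableAt ℝ T y) (hT' : ∀ᶠ y in 𝓝 z, ∀ v, dz T y v = 0)
    (h1 : ∀ y, S y ∘L S' y = .id ℂ F) (u v : EM) :
    curvForm (fun y => T y ∘L (A y ∘L S y)) z u v = S' z ∘L curvForm A z u v ∘L S z := by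
  have hdS : ∀ᶠ y in 𝓝 z, DifferentiableAt ℂ S y :=
    (hS.eventually (by simp)).mono fun y hy => hy.differentiableAt (by norm_num)
  have hdA : ∀ᶠ y in 𝓝 z, DifferentiableAt ℝ A y :=
    (hA.eventually (by simp)).mono fun y hy => hy.differentiableAt (by norm_num)
  have hθ : (fun y => connForm (fun y => T y ∘L (A y ∘L S y)) y v) =ᶠ[𝓝 z]
      fun y => S' y ∘L (connForm A y v ∘L S y) + S' y ∘L fderiv ℂ S y v := by
    filter_upwards [hdS, hdA, hinvA, hinvB, hT, hT'] with y hSy hAy hiA hiB hTy hTy'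
    refine connForm_eq_of_comp (A := fun y => T y ∘L (A y ∘L S y)) (z := y) hiB ?_
    have hr := hSy.restrictScalars ℝ
    rw [dz_comp hTy (hAy.compC hr), dz_comp hAy hr, dz_of_holomorphic hSy, hTy',
      ContinuousLinearMap.zero_comp, zero_add, ← comp_connForm hiA]
    ext s
    have h3 : ∀ x, S y (S' y x) = x := fun x => congrArg (fun T : F →L[ℂ] F => T x) (h1 y)
    simp [h3]
  have hdθ := differentiableAt_connForm hA hinv v
  have hSz : DifferentiableAt ℂ S z := hdS.self_of_nhds
  have hdSz : DifferentiableAt ℂ (fun y => fderiv ℂ S y v) z :=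
    ((hS.fderiv_right (m := 1) (by norm_num)).clm_apply contDiffAt_const).differentiableAt
      (by norm_num)
  have r1 := hS'.restrictScalars ℝ
  have r2 := hSz.restrictScalars ℝ
  have r3 := hdSz.restrictScalars ℝ
  rw [curvForm, dzb_congr hθ,
    dzb_add (r1.compC (hdθ.compC r2)) (r1.compC r3), dzb_comp r1 (hdθ.compC r2),
    dzb_comp hdθ r2, dzb_comp r1 r3, dzb_of_holomorphic hS', dzb_of_holomorphic hSz,
    dzb_of_holomorphic hdSz]
  ext s
  simp [curvForm]

variable {G : Type*} [NormedAddCommGroup G] [NormedSpace ℂ G]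

/-- The operator with diagonal blocks `A` and `B`. -/
def diagOp (A : F →L[ℂ] F) (B : G →L[ℂ] G) : F × G →L[ℂ] F × G :=
  ContinuousLinearMap.inl ℂ F G ∘L (A ∘L ContinuousLinearMap.fst ℂ F G) +
    ContinuousLinearMap.inr ℂ F G ∘L (B ∘L ContinuousLinearMap.snd ℂ F G)

lemma diagOp_apply (A : F →L[ℂ] F) (B : G →L[ℂ] G) (s : F × G) :
    diagOp A B s = (A s.1, B s.2) := by
  simp [diagOp]

lemma DifferentiableAt.constCompC {W₁ W₂ W₃ W₄ : Type*} [NormedAddCommGroup W₁] [NormedSpace ℂ W₁]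
    [NormedAddCommGroup W₂] [NormedSpace ℂ W₂] [NormedAddCommGroup W₃] [NormedSpace ℂ W₃]
    [NormedAddCommGroup W₄] [NormedSpace ℂ W₄] {f : EM → W₂ →L[ℂ] W₃} {z : EM}
    (hf : DifferentiableAt ℝ f z) (g : W₁ →L[ℂ] W₂) (h : W₃ →L[ℂ] W₄) :
    DifferentiableAt ℝ (fun y => h ∘L (f y ∘L g)) z :=
  (differentiableAt_const h).compC (hf.compC (differentiableAt_const g))

lemma dz_const_comp {W₁ W₂ W₃ W₄ : Type*} [NormedAddCommGroup W₁] [NormedSpace ℂ W₁]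
    [NormedAddCommGroup W₂] [NormedSpace ℂ W₂] [NormedAddCommGroup W₃] [NormedSpace ℂ W₃]
    [NormedAddCommGroup W₄] [NormedSpace ℂ W₄] {f : EM → W₂ →L[ℂ] W₃} {z : EM}
    (hf : DifferentiableAt ℝ f z) (g : W₁ →L[ℂ] W₂) (h : W₃ →L[ℂ] W₄) (v : EM) :
    dz (fun y => h ∘L (f y ∘L g)) z v = h ∘L (dz f z v ∘L g) := by
  rw [dz_comp (differentiableAt_const h) (hf.compC (differentiableAt_const g)),
    dz_comp hf (differentiableAt_const g), dz_const, dz_const]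
  simp

lemma dzb_const_comp {W₁ W₂ W₃ W₄ : Type*} [NormedAddCommGroup W₁] [NormedSpace ℂ W₁]
    [NormedAddCommGroup W₂] [NormedSpace ℂ W₂] [NormedAddCommGroup W₃] [NormedSpace ℂ W₃]
    [NormedAddCommGroup W₄] [NormedSpace ℂ W₄] {f : EM → W₂ →L[ℂ] W₃} {z : EM}
    (hf : DifferentiableAt ℝ f z) (g : W₁ →L[ℂ] W₂) (h : W₃ →L[ℂ] W₄) (v : EM) :
    dzb (fun y => h ∘L (f y ∘L g)) z v = h ∘L (dzb f z v ∘L g) := by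
  rw [dzb_comp (differentiableAt_const h) (hf.compC (differentiableAt_const g)),
    dzb_comp hf (differentiableAt_const g), dzb_const, dzb_const]
  simp

/-- The curvature of an orthogonal sum. -/
lemma curvForm_sum [CompleteSpace F] [CompleteSpace G] {D₁ D₂ : Type*}
    [NormedAddCommGroup D₁] [NormedSpace ℂ D₁] [NormedAddCommGroup D₂] [NormedSpace ℂ D₂]
    (T₁ : D₁ →L[ℂ] D) (T₂ : D₂ →L[ℂ] D) {a : EM → F →L[ℂ] D₁} {k : EM → G →L[ℂ] D₂} {z : EM}
    (ha : ContDiffAt ℝ 2 a z) (hk : ContDiffAt ℝ 2 k z)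
    (hia : ∀ᶠ y in 𝓝 z, (a y).IsInvertible) (hik : ∀ᶠ y in 𝓝 z, (k y).IsInvertible)
    (his : ∀ᶠ y in 𝓝 z, (T₁ ∘L (a y ∘L ContinuousLinearMap.fst ℂ F G) +
      T₂ ∘L (k y ∘L ContinuousLinearMap.snd ℂ F G)).IsInvertible) (u v : EM) :
    curvForm (fun y => T₁ ∘L (a y ∘L ContinuousLinearMap.fst ℂ F G) +
      T₂ ∘L (k y ∘L ContinuousLinearMap.snd ℂ F G)) z u v =
      diagOp (curvForm a z u v) (curvForm k z u v) := by
  have hda : ∀ᶠ y in 𝓝 z, DifferentiableAt ℝ a y :=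
    (ha.eventually (by simp)).mono fun y hy => hy.differentiableAt (by norm_num)
  have hdk : ∀ᶠ y in 𝓝 z, DifferentiableAt ℝ k y :=
    (hk.eventually (by simp)).mono fun y hy => hy.differentiableAt (by norm_num)
  have hθ : (fun y => connForm (fun y => T₁ ∘L (a y ∘L ContinuousLinearMap.fst ℂ F G) +
      T₂ ∘L (k y ∘L ContinuousLinearMap.snd ℂ F G)) y v) =ᶠ[𝓝 z]
      fun y => diagOp (connForm a y v) (connForm k y v) := by
    filter_upwards [hda, hdk, hia, hik, his] with y hay hky hiay hiky hisy
    refine connForm_eq_of_comp (A := fun y => T₁ ∘L (a y ∘L ContinuousLinearMap.fst ℂ F G) +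
      T₂ ∘L (k y ∘L ContinuousLinearMap.snd ℂ F G)) (z := y) hisy ?_
    rw [dz_add (hay.constCompC _ _) (hky.constCompC _ _), dz_const_comp hay, dz_const_comp hky,
      ← comp_connForm hiay, ← comp_connForm hiky]
    ext s <;> simp [diagOp_apply]
  have dθa := differentiableAt_connForm ha hia.self_of_nhds v
  have dθk := differentiableAt_connForm hk hik.self_of_nhds v
  rw [curvForm, dzb_congr hθ]
  unfold diagOp
  rw [dzb_add (dθa.constCompC _ _) (dθk.constCompC _ _), dzb_const_comp dθa, dzb_const_comp dθk]
  rfl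

end Connection

/-! ### The curvature along the projective line -/

namespace FibreDirection

/-- The function `1 + |w|²`, as a complex valued function. -/
def q (w : ℂ) : ℂ := 1 + w * conj w

/-- The coefficient `w̄ / (1 + |w|²)` of the projection to the line through `(1, w)`. -/
def mu (w : ℂ) : ℂ := conj w * (q w)⁻¹

/-- The factor `1 / (1 + |w|²)²` of the Fubini–Study metric. -/
def rho (w : ℂ) : ℂ := (q w)⁻¹ * (q w)⁻¹

lemma q_eq (w : ℂ) : q w = ((1 + ‖w‖ ^ 2 : ℝ) : ℂ) := by
  rw [q, Complex.mul_conj']; push_cast; rfl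

lemma q_ne_zero (w : ℂ) : q w ≠ 0 := by
  rw [q_eq, Complex.ofReal_ne_zero]; positivity

lemma conj_q (w : ℂ) : conj (q w) = q w := by rw [q_eq, Complex.conj_ofReal]

lemma conj_mu (w : ℂ) : conj (mu w) = w * (q w)⁻¹ := by
  rw [mu, map_mul, map_inv₀, conj_q, Complex.conj_conj]

lemma rho_eq (w : ℂ) : rho w = ((((1 + ‖w‖ ^ 2) ^ 2)⁻¹ : ℝ) : ℂ) := by
  rw [rho, q_eq, ← mul_inv, ← sq]; push_cast; rfl

lemma contDiff_q {n : WithTop ℕ∞} : ContDiff ℝ n q :=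
  contDiff_const.add (contDiff_id.mul Complex.conjCLE.contDiff)

lemma contDiff_mu {n : WithTop ℕ∞} : ContDiff ℝ n mu :=
  Complex.conjCLE.contDiff.mul (contDiff_q.inv q_ne_zero)

lemma contDiff_conj_mu {n : WithTop ℕ∞} : ContDiff ℝ n (fun w => conj (mu w)) :=
  Complex.conjCLE.contDiff.comp contDiff_mu

lemma contDiff_rho {n : WithTop ℕ∞} : ContDiff ℝ n rho :=
  (contDiff_q.inv q_ne_zero).mul (contDiff_q.inv q_ne_zero)

lemma dz_mul {f g : ℂ → ℂ} {w : ℂ} (hf : DifferentiableAt ℝ f w) (hg : DifferentiableAt ℝ g w)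
    (v : ℂ) : dz (fun y => f y * g y) w v = dz f w v * g w + f w * dz g w v :=
  dz_bilin (ContinuousLinearMap.mul ℂ ℂ) hf hg v

lemma dzb_mul {f g : ℂ → ℂ} {w : ℂ} (hf : DifferentiableAt ℝ f w) (hg : DifferentiableAt ℝ g w)
    (v : ℂ) : dzb (fun y => f y * g y) w v = dzb f w v * g w + f w * dzb g w v :=
  dzb_bilin (ContinuousLinearMap.mul ℂ ℂ) hf hg v

lemma fderiv_conj (w v : ℂ) : fderiv ℝ (fun y : ℂ => conj y) w v = conj v := by
  have : HasFDerivAt (𝕜 := ℝ) (fun y : ℂ => conj y) Complex.conjCLE.toContinuousLinearMap w :=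
    Complex.conjCLE.hasFDerivAt
  rw [this.fderiv]
  rfl

lemma differentiableAt_conj (w : ℂ) : DifferentiableAt ℝ (fun y : ℂ => conj y) w :=
  Complex.conjCLE.differentiableAt

lemma dz_conj (w : ℂ) : dz (fun y : ℂ => conj y) w 1 = 0 := by
  simp [dz, fderiv_conj]

lemma dzb_conj (w : ℂ) : dzb (fun y : ℂ => conj y) w 1 = 1 := by
  simp [dzb, fderiv_conj]; norm_num

lemma dz_id (w : ℂ) : dz (fun y : ℂ => y) w 1 = 1 := by
  rw [dz_of_holomorphic differentiableAt_fun_id]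
  simp

lemma dzb_id (w : ℂ) : dzb (fun y : ℂ => y) w 1 = 0 :=
  dzb_of_holomorphic differentiableAt_fun_id _

lemma differentiableAt_q (w : ℂ) : DifferentiableAt ℝ q w :=
  (contDiff_q (n := 1)).differentiable (by norm_num) w

lemma differentiableAt_q_inv (w : ℂ) : DifferentiableAt ℝ (fun y => (q y)⁻¹) w :=
  (contDiff_q.inv q_ne_zero (n := 1)).differentiable (by norm_num) w

lemma differentiableAt_mu (w : ℂ) : DifferentiableAt ℝ mu w :=
  (contDiff_mu (n := 1)).differentiable (by norm_num) w

lemma differentiableAt_conj_mu (w : ℂ) : DifferentiableAt ℝ (fun w => conj (mu w)) w :=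
  (contDiff_conj_mu (n := 1)).differentiable (by norm_num) w

lemma differentiableAt_rho (w : ℂ) : DifferentiableAt ℝ rho w :=
  (contDiff_rho (n := 1)).differentiable (by norm_num) w

lemma dz_q (w : ℂ) : dz q w 1 = conj w := by
  unfold q
  rw [dz_add (differentiableAt_const _) (differentiableAt_fun_id.fun_mul (differentiableAt_conj w)),
    dz_mul differentiableAt_fun_id (differentiableAt_conj w), dz_const, dz_conj, dz_id]
  ring

lemma dzb_q (w : ℂ) : dzb q w 1 = w := by
  unfold q
  rw [dzb_add (differentiableAt_const _)
      (differentiableAt_fun_id.fun_mul (differentiableAt_conj w)),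
    dzb_mul differentiableAt_fun_id (differentiableAt_conj w), dzb_const, dzb_conj, dzb_id]
  ring

lemma dz_q_inv (w : ℂ) : dz (fun y => (q y)⁻¹) w 1 = -(conj w * ((q w)⁻¹) ^ 2) := by
  have h := dz_mul (differentiableAt_q w) (differentiableAt_q_inv w) 1
  have h1 : (fun y => q y * (q y)⁻¹) = fun _ => 1 := funext fun y => mul_inv_cancel₀ (q_ne_zero y)
  rw [h1, dz_const, dz_q] at h
  have h0 := q_ne_zero w
  field_simp at h ⊢
  linear_combination -h

lemma dzb_q_inv (w : ℂ) : dzb (fun y => (q y)⁻¹) w 1 = -(w * ((q w)⁻¹) ^ 2) := by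
  have h := dzb_mul (differentiableAt_q w) (differentiableAt_q_inv w) 1
  have h1 : (fun y => q y * (q y)⁻¹) = fun _ => 1 := funext fun y => mul_inv_cancel₀ (q_ne_zero y)
  rw [h1, dzb_const, dzb_q] at h
  have h0 := q_ne_zero w
  field_simp at h ⊢
  linear_combination -h

lemma dz_mu (w : ℂ) : dz mu w 1 = -(mu w) ^ 2 := by
  unfold mu
  rw [dz_mul (differentiableAt_conj w) (differentiableAt_q_inv w), dz_conj, dz_q_inv]
  ring

lemma dzb_mu (w : ℂ) : dzb mu w 1 = rho w := by
  have h0 := q_ne_zero w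
  unfold mu
  rw [dzb_mul (differentiableAt_conj w) (differentiableAt_q_inv w), dzb_conj, dzb_q_inv, rho]
  field_simp
  rw [q]
  ring

lemma dz_conj_mu (w : ℂ) : dz (fun y => conj (mu y)) w 1 = rho w := by
  have h0 := q_ne_zero w
  simp only [conj_mu]
  rw [dz_mul differentiableAt_fun_id (differentiableAt_q_inv w), dz_id, dz_q_inv, rho]
  field_simp
  rw [q]
  ring

lemma dz_rho (w : ℂ) : dz rho w 1 = -(2 * mu w * rho w) := by
  unfold rho
  rw [dz_mul (differentiableAt_q_inv w) (differentiableAt_q_inv w), dz_q_inv, mu]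
  ring

variable {F : Type*} [NormedAddCommGroup F] [NormedSpace ℂ F]
  {D : Type*} [NormedAddCommGroup D] [NormedSpace ℂ D]

/-- The curvature of `T (A + ρ K) S` in the direction of the affine coordinate `w`, where
`S = 1 + μ N` and `T = 1 + μ̄ N'`, for constant operators which satisfy the relations of the
following block matrices: `N` is the upper right block `φ`, `M` the lower left block `φ*`, `P` the
projection to the second summand, and `A`, `K` the metrics of the two summands.
The connection form is the polynomial `M + μ ([M, N] - 2 P) + μ² (N - N M N)` in `μ`. -/
lemma curvForm_eq (A K : F →L[ℂ] D) (N M P : F →L[ℂ] F) (N' : D →L[ℂ] D)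
    (hNN : ∀ x, N (N x) = 0) (hPN : ∀ x, P (N x) = 0) (hNP : ∀ x, N (P x) = N x)
    (hAM : ∀ x, A (M x) = 0) (hAP : ∀ x, A (P x) = 0) (hKP : ∀ x, K (P x) = K x)
    (hKN : ∀ x, K (N x) = 0)
    (hN'N' : ∀ x, N' (N' x) = 0) (hN'K : ∀ x, N' (K x) = 0) (hKM : ∀ x, K (M x) = N' (A x))
    (hinv : ∀ w, ((.id ℂ D + conj (mu w) • N') ∘L ((A + rho w • K) ∘L
      (.id ℂ F + mu w • N))).IsInvertible) (w : ℂ) :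
    curvForm (fun w => (.id ℂ D + conj (mu w) • N') ∘L ((A + rho w • K) ∘L
      (.id ℂ F + mu w • N))) w 1 1 =
    (.id ℂ F - mu w • N) ∘L ((rho w • (M ∘L N - N ∘L M - (2 : ℂ) • P)) ∘L
      (.id ℂ F + mu w • N)) := by
  set T : ℂ → D →L[ℂ] D := fun w => .id ℂ D + conj (mu w) • N' with hT
  set S : ℂ → F →L[ℂ] F := fun w => .id ℂ F + mu w • N with hS
  set B : ℂ → F →L[ℂ] D := fun w => A + rho w • K with hB
  have d1 := fun y => (differentiableAt_conj_mu y).smulC (differentiableAt_const N')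
  have d2 := fun y => (differentiableAt_rho y).smulC (differentiableAt_const K)
  have d3 := fun y => (differentiableAt_mu y).smulC (differentiableAt_const N)
  have e1 : ∀ y, DifferentiableAt ℝ T y := fun y => (differentiableAt_const _).fun_add (d1 y)
  have e2 : ∀ y, DifferentiableAt ℝ B y := fun y => (differentiableAt_const _).fun_add (d2 y)
  have e3 : ∀ y, DifferentiableAt ℝ S y := fun y => (differentiableAt_const _).fun_add (d3 y)
  have f1 : ∀ y, dz T y 1 = rho y • N' := fun y => by
    rw [hT, dz_add (differentiableAt_const _) (d1 y), dz_smul_const (differentiableAt_conj_mu y),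
      dz_conj_mu, dz_const, zero_add]
  have f2 : ∀ y, dz B y 1 = -(2 * mu y * rho y) • K := fun y => by
    rw [hB, dz_add (differentiableAt_const _) (d2 y), dz_smul_const (differentiableAt_rho y),
      dz_rho, dz_const, zero_add]
  have f3 : ∀ y, dz S y 1 = -(mu y) ^ 2 • N := fun y => by
    rw [hS, dz_add (differentiableAt_const _) (d3 y), dz_smul_const (differentiableAt_mu y),
      dz_mu, dz_const, zero_add]
  have hθ : (fun y => connForm (fun w => T w ∘L (B w ∘L S w)) y 1) = fun y =>
      M + (mu y • (M ∘L N - N ∘L M - (2 : ℂ) • P) + (mu y * mu y) • (N - N ∘L (M ∘L N))) := by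
    funext y
    -- It suffices to verify `A θ = ∂A`, which is an identity of polynomials in `μ` and `μ̄`.
    refine connForm_eq_of_comp (A := fun w => T w ∘L (B w ∘L S w)) (hinv y) ?_
    rw [dz_comp (e1 y) ((e2 y).compC (e3 y)), dz_comp (e2 y) (e3 y), f1, f2, f3]
    refine ContinuousLinearMap.ext fun x => ?_
    simp only [hT, hB, hS, ContinuousLinearMap.comp_apply, add_apply, sub_apply, smul_apply,
      ContinuousLinearMap.id_apply, map_add, map_sub, map_smul, hNN, hNP, hAM, hAP, hKP, hKN,
      hN'N', hN'K, hKM, neg_smul, neg_apply, map_neg, map_zero, smul_zero]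
    module
  have d4 : DifferentiableAt ℝ (fun y => mu y * mu y) w :=
    (differentiableAt_mu w).fun_mul (differentiableAt_mu w)
  have g1 := (differentiableAt_mu w).smulC
    (differentiableAt_const (M ∘L N - N ∘L M - (2 : ℂ) • P))
  have g2 := d4.smulC (differentiableAt_const (N - N ∘L (M ∘L N)))
  rw [curvForm, hθ, dzb_add (differentiableAt_const _) (g1.fun_add g2), dzb_add g1 g2,
    dzb_smul_const (differentiableAt_mu w), dzb_smul_const d4,
    dzb_mul (differentiableAt_mu w) (differentiableAt_mu w), dzb_mu, dzb_const]
  refine ContinuousLinearMap.ext fun x => ?_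
  simp only [ContinuousLinearMap.comp_apply, add_apply, sub_apply, smul_apply, zero_apply,
      ContinuousLinearMap.id_apply, map_add, map_sub, map_smul, hNN, hPN, hNP, map_zero,
      smul_zero]
  module

end FibreDirection

/-! ### Sesquilinear forms and the curvature of the model metric -/

lemma ContDiffAt.constCompC {EM W₁ W₂ W₃ W₄ : Type*} [NormedAddCommGroup EM] [NormedSpace ℂ EM]
    [NormedAddCommGroup W₁] [NormedSpace ℂ W₁]
    [NormedAddCommGroup W₂] [NormedSpace ℂ W₂] [NormedAddCommGroup W₃] [NormedSpace ℂ W₃]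
    [NormedAddCommGroup W₄] [NormedSpace ℂ W₄] {n : WithTop ℕ∞} {f : EM → W₂ →L[ℂ] W₃} {z : EM}
    (hf : ContDiffAt ℝ n f z) (g : W₁ →L[ℂ] W₂) (h : W₃ →L[ℂ] W₄) :
    ContDiffAt ℝ n (fun y => h ∘L (f y ∘L g)) z :=
  ((ContinuousLinearMap.compL ℂ W₁ W₃ W₄ h ∘L
    (ContinuousLinearMap.compL ℂ W₁ W₂ W₃).flip g).restrictScalars ℝ).contDiff.contDiffAt.comp z hf

section Forms

variable {F : Type*} [NormedAddCommGroup F] [NormedSpace ℂ F]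
  {G : Type*} [NormedAddCommGroup G] [NormedSpace ℂ G]

variable (F G) in
/-- The transpose `S ↦ (ℓ ↦ ℓ ∘ S)` on conjugate linear functionals. -/
def conjTranspose : (F →L[ℂ] G) →L⋆[ℂ] ((G →L⋆[ℂ] ℂ) →L[ℂ] (F →L⋆[ℂ] ℂ)) :=
  (ContinuousLinearMap.compSL F G ℂ (RingHom.id ℂ) (starRingEnd ℂ)).flip

lemma conjTranspose_apply (S : F →L[ℂ] G) (l : G →L⋆[ℂ] ℂ) (s : F) :
    conjTranspose F G S l s = l (S s) := rfl

/-- The pull-back `(s, t) ↦ B(S s, S t)` of a sesquilinear form. -/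
def pullForm (S : F →L[ℂ] G) (B : G →L[ℂ] G →L⋆[ℂ] ℂ) : F →L[ℂ] F →L⋆[ℂ] ℂ :=
  conjTranspose F G S ∘L (B ∘L S)

lemma pullForm_apply (S : F →L[ℂ] G) (B : G →L[ℂ] G →L⋆[ℂ] ℂ) (s t : F) :
    pullForm S B s t = B (S s) (S t) := rfl

/-- The sum `a ⊕ c k` of sesquilinear forms. -/
def sumForm (a : F →L[ℂ] F →L⋆[ℂ] ℂ) (c : ℂ) (k : G →L[ℂ] G →L⋆[ℂ] ℂ) :
    F × G →L[ℂ] F × G →L⋆[ℂ] ℂ :=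
  conjTranspose (F × G) F (.fst ℂ F G) ∘L (a ∘L .fst ℂ F G) +
    (c • conjTranspose (F × G) G (.snd ℂ F G)) ∘L (k ∘L .snd ℂ F G)

lemma sumForm_apply (a : F →L[ℂ] F →L⋆[ℂ] ℂ) (c : ℂ) (k : G →L[ℂ] G →L⋆[ℂ] ℂ) (s t : F × G) :
    sumForm a c k s t = a s.1 t.1 + c * k s.2 t.2 := rfl

/-- The off-diagonal operator `(e, l) ↦ (f l, 0)`. -/
def upperOp (f : G →L[ℂ] F) : F × G →L[ℂ] F × G := .inl ℂ F G ∘L f ∘L .snd ℂ F G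

lemma upperOp_apply (f : G →L[ℂ] F) (s : F × G) : upperOp f s = (f s.2, 0) := rfl

/-- The shear `(e, l) ↦ (e + m f l, l)`. -/
def shear (m : ℂ) (f : G →L[ℂ] F) : F × G →L[ℂ] F × G := .id ℂ (F × G) + m • upperOp f

lemma shear_apply (m : ℂ) (f : G →L[ℂ] F) (s : F × G) :
    shear m f s = (s.1 + m • f s.2, s.2) := by
  simp [shear, upperOp_apply, Prod.ext_iff]

lemma shear_shear_neg (m : ℂ) (f : G →L[ℂ] F) (s : F × G) : shear m f (shear (-m) f s) = s := by
  simp [shear_apply]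

lemma shear_neg_shear (m : ℂ) (f : G →L[ℂ] F) (s : F × G) : shear (-m) f (shear m f s) = s := by
  simp [shear_apply]

lemma re_sumForm_pos {a : F →L[ℂ] F →L⋆[ℂ] ℂ} {c : ℝ} {k : G →L[ℂ] G →L⋆[ℂ] ℂ} (hc : 0 < c)
    (ha : ∀ s, s ≠ 0 → 0 < (a s s).re) (hk : ∀ s, s ≠ 0 → 0 < (k s s).re) (s : F × G)
    (hs : s ≠ 0) : 0 < (sumForm a c k s s).re := by
  obtain ⟨e, l⟩ := s
  have ha' : 0 ≤ (a e e).re := by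
    by_cases he : e = 0
    · simp [he]
    · exact (ha e he).le
  rw [sumForm_apply, Complex.add_re, Complex.re_ofReal_mul]
  by_cases hl : l = 0
  · have he : e ≠ 0 := by rintro rfl; exact hs (by rw [hl]; rfl)
    simpa [hl] using ha e he
  · exact add_pos_of_nonneg_of_pos ha' (mul_pos hc (hk l hl))

lemma re_pullForm_pos {S : F →L[ℂ] G} (hS : Function.Injective S) {B : G →L[ℂ] G →L⋆[ℂ] ℂ}
    (hB : ∀ s, s ≠ 0 → 0 < (B s s).re) (s : F) (hs : s ≠ 0) : 0 < (pullForm S B s s).re :=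
  hB _ fun h => hs (hS (h.trans (map_zero S).symm))

/-- A positive definite sesquilinear form is nondegenerate. -/
lemma isInvertible_of_re_pos [FiniteDimensional ℂ F] {B : F →L[ℂ] F →L⋆[ℂ] ℂ}
    (hB : ∀ s, s ≠ 0 → 0 < (B s s).re) : B.IsInvertible := by
  have : CompleteSpace F := FiniteDimensional.complete ℂ F
  have hinj : Function.Injective B := by
    rw [injective_iff_map_eq_zero]
    intro s hs
    by_contra h
    have := hB s h
    rw [hs] at this
    exact lt_irrefl _ this
  let b := Module.finBasis ℂ F
  let ev : (F →L⋆[ℂ] ℂ) →ₗ[ℂ] (Fin (finrank ℂ F) → ℂ) :=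
    { toFun := fun l i => l (b i), map_add' := fun _ _ => rfl, map_smul' := fun _ _ => rfl }
  have hev : Function.Injective ev := by
    intro l l' h
    have : (l : F →ₗ⋆[ℂ] ℂ) = l' := b.ext fun i => congrFun h i
    exact ContinuousLinearMap.coe_injective this
  have : FiniteDimensional ℂ (F →L⋆[ℂ] ℂ) := FiniteDimensional.of_injective ev hev
  have h1 : finrank ℂ (F →L⋆[ℂ] ℂ) ≤ finrank ℂ F := by
    simpa using LinearMap.finrank_le_finrank_of_injective hev
  have h2 : finrank ℂ F ≤ finrank ℂ (F →L⋆[ℂ] ℂ) :=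
    LinearMap.finrank_le_finrank_of_injective (f := (B : F →ₗ[ℂ] F →L⋆[ℂ] ℂ)) hinj
  have hsurj : Function.Surjective B :=
    (LinearMap.injective_iff_surjective_of_finrank_eq_finrank (f := (B : F →ₗ[ℂ] F →L⋆[ℂ] ℂ))
      (le_antisymm h2 h1)).1 hinj
  exact ⟨ContinuousLinearEquiv.ofBijective B (LinearMap.ker_eq_bot.2 hinj)
    (LinearMap.range_eq_top.2 hsurj), ContinuousLinearMap.ext fun _ => rfl⟩

variable {EM : Type*} [NormedAddCommGroup EM] [NormedSpace ℂ EM]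

/-- On the vectors `u`, `i u` the curvature `dθ + θ ∧ θ` is `2 i ∂̄θ`, with both forms evaluated
on `u`: the form `θ` is of type (1,0), so that `θ ∧ θ` does not contribute. -/
lemma chernCurvature_I_smul (A : EM → F →L[ℂ] F →L⋆[ℂ] ℂ) (z u : EM) :
    chernCurvature A z u (Complex.I • u) = (2 * Complex.I) • curvForm A z u u := by
  have h0 : ∀ y v, chernForm A y v = connForm A y v := fun _ _ => rfl
  have h : fderiv ℝ (fun y => Complex.I • connForm A y u) z u =
      Complex.I • fderiv ℝ (fun y => connForm A y u) z u :=
    congrArg (fun T => T z u) (fderiv_const_smul_field (𝕜 := ℝ) (f := fun y => connForm A y u)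
      Complex.I)
  simp only [chernCurvature, h0, connForm_smul_right, h, curvForm, dzb,
    ContinuousLinearMap.comp_smul, ContinuousLinearMap.smul_comp, sub_self, add_zero, smul_add,
    smul_smul]
  have h1 : 2 * Complex.I * (1 / 2) = Complex.I := by ring
  have h2 : 2 * Complex.I * (1 / 2 * Complex.I) = -1 := by
    linear_combination Complex.I_mul_I
  rw [h1, h2, neg_one_smul, ← sub_eq_add_neg]

lemma diagOp_smul (c : ℂ) (A : F →L[ℂ] F) (B : G →L[ℂ] G) :
    diagOp (c • A) (c • B) = c • diagOp A B := by
  refine ContinuousLinearMap.ext fun s => ?_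
  simp [diagOp_apply]

lemma diagOp_add (A A' : F →L[ℂ] F) (B B' : G →L[ℂ] G) :
    diagOp (A + A') (B + B') = diagOp A B + diagOp A' B' := by
  refine ContinuousLinearMap.ext fun s => ?_
  simp [diagOp_apply]

end Forms

section Model

open FibreDirection

variable {EX : Type*}
  {F : Type*} [NormedAddCommGroup F] [NormedSpace ℂ F]
  {G : Type*} [NormedAddCommGroup G] [NormedSpace ℂ G]

/-- The metric on `E ⊕ L` in the frame of the extension determined by `f` over the affine
coordinate `w`. -/
def modelForm (a : EX → F →L[ℂ] F →L⋆[ℂ] ℂ) (c : ℝ) (k : EX → G →L[ℂ] G →L⋆[ℂ] ℂ)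
    (f : EX → G →L[ℂ] F) (y : EX × ℂ) : F × G →L[ℂ] F × G →L⋆[ℂ] ℂ :=
  pullForm (shear (mu y.2) (f y.1)) (sumForm (a y.1) (c * rho y.2) (k y.1))

lemma re_modelForm_pos {a : EX → F →L[ℂ] F →L⋆[ℂ] ℂ} {c : ℝ} (hc : 0 < c)
    {k : EX → G →L[ℂ] G →L⋆[ℂ] ℂ} (f : EX → G →L[ℂ] F) {y : EX × ℂ}
    (ha : ∀ s, s ≠ 0 → 0 < (a y.1 s s).re) (hk : ∀ s, s ≠ 0 → 0 < (k y.1 s s).re)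
    (s : F × G) (hs : s ≠ 0) : 0 < (modelForm a c k f y s s).re := by
  have h1 : (0 : ℝ) < c * ((1 + ‖y.2‖ ^ 2) ^ 2)⁻¹ := by positivity
  have hinj : Function.Injective (shear (mu y.2) (f y.1)) :=
    Function.LeftInverse.injective (g := shear (-mu y.2) (f y.1)) (shear_neg_shear _ _)
  refine re_pullForm_pos hinj ?_ s hs
  rw [rho_eq, ← Complex.ofReal_mul]
  exact re_sumForm_pos h1 ha hk

variable [FiniteDimensional ℂ F] [FiniteDimensional ℂ G] {a : EX → F →L[ℂ] F →L⋆[ℂ] ℂ} {c : ℝ}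
  {k : EX → G →L[ℂ] G →L⋆[ℂ] ℂ} {f : EX → G →L[ℂ] F} {z : EX}

/-- The curvature of the model metric in the direction of the projective line; `fs` is the adjoint
of `f`. -/
lemma curvForm_modelForm_fibre (hc : 0 < c) (hap : ∀ s, s ≠ 0 → 0 < (a z s s).re)
    (hkp : ∀ s, s ≠ 0 → 0 < (k z s s).re) (fs : F →L[ℂ] G)
    (hfs : ∀ e l, k z (fs e) l = a z e (f z l)) (w : ℂ) :
    curvForm (fun w => modelForm a c k f (z, w)) w 1 1 =
      shear (-mu w) (f z) ∘L (rho w • diagOp (-((c : ℂ)⁻¹ • (f z ∘L fs)))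
        ((c : ℂ)⁻¹ • (fs ∘L f z) - (2 : ℂ) • .id ℂ G)) ∘L shear (mu w) (f z) := by
  have hc' : (c : ℂ) ≠ 0 := by exact_mod_cast hc.ne'
  let N := upperOp (f z)
  let M : F × G →L[ℂ] F × G := .inr ℂ F G ∘L ((c : ℂ)⁻¹ • fs) ∘L .fst ℂ F G
  let P : F × G →L[ℂ] F × G := .inr ℂ F G ∘L .snd ℂ F G
  let A := conjTranspose (F × G) F (.fst ℂ F G) ∘L (a z ∘L .fst ℂ F G)
  let K := (c : ℂ) • conjTranspose (F × G) G (.snd ℂ F G) ∘L (k z ∘L .snd ℂ F G)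
  have hmod : (fun w => modelForm a c k f (z, w)) = fun w =>
      (.id ℂ (F × G →L⋆[ℂ] ℂ) + conj (mu w) • conjTranspose _ _ N) ∘L ((A + rho w • K) ∘L
        (.id ℂ (F × G) + mu w • N)) := by
    funext w
    refine ContinuousLinearMap.ext fun s => ContinuousLinearMap.ext fun t => ?_
    change a z _ _ + c * rho w * k z _ _ = (A + rho w • K) _ _ + conj (mu w) • (A + rho w • K) _ _
    simp [A, K, N, conjTranspose_apply, shear_apply, upperOp_apply]
    ring
  have hinv : ∀ w, ((.id ℂ (F × G →L⋆[ℂ] ℂ) + conj (mu w) • conjTranspose _ _ N) ∘L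
      ((A + rho w • K) ∘L (.id ℂ (F × G) + mu w • N))).IsInvertible := by
    intro w
    rw [← congrFun hmod w]
    exact isInvertible_of_re_pos (re_modelForm_pos hc f (y := (z, w)) hap hkp)
  -- The remaining goals are the relations between the block matrices.
  rw [hmod, curvForm_eq A K N M P (conjTranspose _ _ N) ?_ ?_ ?_ ?_ ?_ ?_ ?_ ?_ ?_ ?_ hinv w]
  · have hN : shear (mu w) (f z) = .id ℂ (F × G) + mu w • N := rfl
    have hN' : shear (-mu w) (f z) = .id ℂ (F × G) - mu w • N := by
      refine ContinuousLinearMap.ext fun s => ?_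
      simp [shear, N, sub_eq_add_neg]
    rw [hN, hN']
    congr 3
    refine ContinuousLinearMap.ext fun s => ?_
    simp [N, M, P, upperOp_apply, diagOp_apply]
  all_goals intro s
  · simp [N, upperOp_apply]
  · simp [N, P, upperOp_apply]
  · simp [N, P, upperOp_apply]
  · refine ContinuousLinearMap.ext fun t => ?_
    simp [A, M]
  · refine ContinuousLinearMap.ext fun t => ?_
    simp [A, P]
  · refine ContinuousLinearMap.ext fun t => ?_
    simp [K, P, conjTranspose_apply]
  · refine ContinuousLinearMap.ext fun t => ?_
    simp [K, N, upperOp_apply]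
  · refine ContinuousLinearMap.ext fun t => ?_
    simp [N, upperOp_apply, conjTranspose_apply]
    exact s.map_zero
  · refine ContinuousLinearMap.ext fun t => ?_
    simp [K, N, upperOp_apply, conjTranspose_apply]
  · refine ContinuousLinearMap.ext fun t => ?_
    simp [K, A, M, N, upperOp_apply, conjTranspose_apply, hfs, hc']

variable [NormedAddCommGroup EX] [NormedSpace ℂ EX]

/-- In the directions of `X` the model metric differs from an orthogonal sum by a holomorphic change
of frame. -/
lemma curvForm_modelForm_base (hc : 0 < c) (ha : ContDiffAt ℝ 2 a z) (hk : ContDiffAt ℝ 2 k z)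
    (hf : ContDiffAt ℂ 2 f z) (hap : ∀ᶠ y in 𝓝 z, ∀ s, s ≠ 0 → 0 < (a y s s).re)
    (hkp : ∀ᶠ y in 𝓝 z, ∀ s, s ≠ 0 → 0 < (k y s s).re) (w : ℂ) (u v : EX) :
    curvForm (fun y => modelForm a c k f (y, w)) z u v =
      shear (-mu w) (f z) ∘L diagOp (curvForm a z u v) (curvForm k z u v) ∘L
        shear (mu w) (f z) := by
  have : CompleteSpace F := FiniteDimensional.complete ℂ F
  have : CompleteSpace G := FiniteDimensional.complete ℂ G
  have hsp : ∀ᶠ y in 𝓝 z, ∀ s, s ≠ 0 → 0 < (sumForm (a y) (c * rho w) (k y) s s).re := by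
    filter_upwards [hap, hkp] with y h1 h2
    rw [rho_eq, ← Complex.ofReal_mul]
    exact re_sumForm_pos (by positivity) h1 h2
  have hsi := hsp.mono fun y hy => isInvertible_of_re_pos hy
  have hsd : ContDiffAt ℝ 2 (fun y => sumForm (a y) (c * rho w) (k y)) z :=
    (ha.constCompC _ _).add (hk.constCompC _ _)
  have hshear : ∀ m : ℂ, ContDiffAt ℂ 2 (fun y => shear m (f y)) z := fun m =>
    contDiffAt_const.add ((contDiffAt_const.clm_comp (hf.clm_comp contDiffAt_const)).const_smul m)
  have hdshear : ∀ᶠ y in 𝓝 z, DifferentiableAt ℂ (fun y => shear (mu w) (f y)) y :=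
    ((hshear (mu w)).eventually (by simp)).mono fun y hy => hy.differentiableAt (by norm_num)
  have hT : ∀ᶠ y in 𝓝 z,
      DifferentiableAt ℝ (fun y => conjTranspose (F × G) (F × G) (shear (mu w) (f y))) y :=
    hdshear.mono fun y hy => (hasFDerivAt_conj_clm (W₁ := F × G →L[ℂ] F × G)
      (W₂ := (F × G →L⋆[ℂ] ℂ) →L[ℂ] (F × G →L⋆[ℂ] ℂ)) _ (hy.restrictScalars ℝ)).differentiableAt
  have hT' : ∀ᶠ y in 𝓝 z, ∀ v,
      dz (fun y => conjTranspose (F × G) (F × G) (shear (mu w) (f y))) y v = 0 :=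
    hdshear.mono fun y hy v => by
      rw [dz_conj_clm (W₁ := F × G →L[ℂ] F × G) (W₂ := (F × G →L⋆[ℂ] ℂ) →L[ℂ] (F × G →L⋆[ℂ] ℂ)) _
        (hy.restrictScalars ℝ), dzb_of_holomorphic hy]
      exact ContinuousLinearMap.map_zero _
  have hB : ∀ᶠ y in 𝓝 z, (conjTranspose (F × G) (F × G) (shear (mu w) (f y)) ∘L
      (sumForm (a y) (c * rho w) (k y) ∘L shear (mu w) (f y))).IsInvertible := by
    filter_upwards [hap, hkp] with y h1 h2
    exact isInvertible_of_re_pos (re_modelForm_pos hc f (y := (y, w)) h1 h2)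
  -- The transpose of the shear is antiholomorphic, so that `curvForm_gauge` applies.
  rw [← curvForm_sum _ _ ha hk (hap.mono fun y hy => isInvertible_of_re_pos hy)
    (hkp.mono fun y hy => isInvertible_of_re_pos hy) hsi u v]
  exact curvForm_gauge hsd hsi.self_of_nhds hB hsi (hshear _)
    ((hshear (-mu w)).differentiableAt (by norm_num)) hT hT'
    (fun y => ContinuousLinearMap.ext (shear_shear_neg _ _)) u v

/-- The contracted curvature of the model metric with `c = 2 π / σ`, for the metric
`g + σ |dw|² / (π (1 + |w|²)²)`: in the frame adapted to the orthogonal splitting it is block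
diagonal, and its blocks are the left hand sides of the vortex equations, the second one increased
by `4 π / σ`. -/
lemma I_smul_contraction_modelForm [FiniteDimensional ℂ EX] (g : InnerProductSpace.Core ℂ EX)
    (σ : ℝ) (hσ : 0 < σ) (hcσ : c = 2 * Real.pi / σ) (ha : ContDiffAt ℝ 2 a z)
    (hk : ContDiffAt ℝ 2 k z) (hf : ContDiffAt ℂ 2 f z)
    (hap : ∀ᶠ y in 𝓝 z, ∀ s, s ≠ 0 → 0 < (a y s s).re)
    (hkp : ∀ᶠ y in 𝓝 z, ∀ s, s ≠ 0 → 0 < (k y s s).re) (fs : F →L[ℂ] G)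
    (hfs : ∀ e l, k z (fs e) l = a z e (f z l)) (w : ℂ)
    {A : EX × ℂ → F × G →L[ℂ] F × G →L⋆[ℂ] ℂ} (hA : ContDiffAt ℝ 2 A (z, w))
    (hAm : A =ᶠ[𝓝 (z, w)] modelForm a c k f)
    (hpos : 0 < Real.pi * (1 + ‖w‖ ^ 2) ^ 2) :
    Complex.I • contraction (coreProd g (coreDiv (Real.pi * (1 + ‖w‖ ^ 2) ^ 2) hpos) σ hσ)
      (chernCurvature A (z, w)) =
    shear (-mu w) (f z) ∘L diagOp (Complex.I • contraction g (chernCurvature a z) + f z ∘L fs)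
      (Complex.I • contraction g (chernCurvature k z) - fs ∘L f z +
        ((4 * Real.pi / σ : ℝ) : ℂ) • .id ℂ G) ∘L shear (mu w) (f z) := by
  have : CompleteSpace F := FiniteDimensional.complete ℂ F
  have : CompleteSpace G := FiniteDimensional.complete ℂ G
  have hc : 0 < c := by rw [hcσ]; positivity
  have hinv : (A (z, w)).IsInvertible := by
    rw [hAm.eq_of_nhds]
    exact isInvertible_of_re_pos (re_modelForm_pos hc f (y := (z, w)) hap.self_of_nhds
      hkp.self_of_nhds)
  obtain ⟨R, hR⟩ := exists_sesq_curvForm hA hinv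
  have hbase : ∀ u : EX, chernCurvature A (z, w) (u, 0) (Complex.I • u, 0) =
      shear (-mu w) (f z) ∘L diagOp (chernCurvature a z u (Complex.I • u))
        (chernCurvature k z u (Complex.I • u)) ∘L shear (mu w) (f z) := by
    intro u
    have h0 : ((Complex.I • u, 0) : EX × ℂ) = Complex.I • (u, 0) := by simp
    have h1 : ∀ y : EX, (y, w) = ((0, w) : EX × ℂ) + ContinuousLinearMap.inl ℂ EX ℂ y := fun y => by
      simp
    have h2 : (fun y => A ((0, w) + ContinuousLinearMap.inl ℂ EX ℂ y)) =ᶠ[𝓝 z]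
        fun y => modelForm a c k f (y, w) := by
      have h3 : ContinuousAt (fun y : EX => (y, w)) z := by fun_prop
      filter_upwards [h3.eventually hAm] with y hy
      rw [← h1, hy]
    rw [h1 z] at hA hinv
    have h4 := curvForm_comp_affine (ContinuousLinearMap.inl ℂ EX ℂ) (0, w) hA hinv u u
    rw [curvForm_congr h2, curvForm_modelForm_base hc ha hk hf hap hkp, ← h1] at h4
    rw [h0, chernCurvature_I_smul, chernCurvature_I_smul, chernCurvature_I_smul]
    change (2 * Complex.I) • curvForm A (z, w) (ContinuousLinearMap.inl ℂ EX ℂ u)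
      (ContinuousLinearMap.inl ℂ EX ℂ u) = _
    rw [← h4]
    refine ContinuousLinearMap.ext fun s => ?_
    simp [diagOp_apply, shear_apply, Prod.ext_iff]
    module
  have hfibre : chernCurvature A (z, w) (0, 1) (0, Complex.I) = (2 * Complex.I) •
      (shear (-mu w) (f z) ∘L (rho w • diagOp (-((c : ℂ)⁻¹ • (f z ∘L fs)))
        ((c : ℂ)⁻¹ • (fs ∘L f z) - (2 : ℂ) • .id ℂ G)) ∘L shear (mu w) (f z)) := by
    have h0 : ((0, Complex.I) : EX × ℂ) = Complex.I • (0, 1) := by simp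
    have h1 : ∀ y : ℂ, (z, y) = ((z, 0) : EX × ℂ) + ContinuousLinearMap.inr ℂ EX ℂ y := fun y => by
      simp
    have h2 : (fun y => A ((z, 0) + ContinuousLinearMap.inr ℂ EX ℂ y)) =ᶠ[𝓝 w]
        fun y => modelForm a c k f (z, y) := by
      have h3 : ContinuousAt (fun y : ℂ => (z, y)) w := by fun_prop
      filter_upwards [h3.eventually hAm] with y hy
      rw [← h1, hy]
    rw [h1 w] at hA hinv
    have h4 := curvForm_comp_affine (ContinuousLinearMap.inr ℂ EX ℂ) (z, 0) hA hinv 1 1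
    rw [curvForm_congr h2, curvForm_modelForm_fibre hc hap.self_of_nhds hkp.self_of_nhds fs hfs,
      ← h1] at h4
    rw [h0, chernCurvature_I_smul, h4]
    rfl
  have hRI : ∀ u, chernCurvature A (z, w) u (Complex.I • u) = ((2 * Complex.I) • R) u u :=
    fun u => by rw [chernCurvature_I_smul, hR]; rfl
  rw [contraction_coreProd_coreDiv g _ hpos σ hσ _ ((2 * Complex.I) • R) hRI, hfibre]
  have hsum : contraction g (fun u v => chernCurvature A (z, w) (u, 0) (v, 0)) =
      shear (-mu w) (f z) ∘L diagOp (contraction g (chernCurvature a z))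
        (contraction g (chernCurvature k z)) ∘L shear (mu w) (f z) := by
    unfold contraction
    simp only [hbase]
    refine ContinuousLinearMap.ext fun s => ?_
    simp [diagOp_apply, shear_apply, Prod.ext_iff, Prod.fst_sum,
      Prod.snd_sum, Finset.sum_add_distrib, Finset.smul_sum]
  have hσ' : (σ : ℂ) ≠ 0 := by exact_mod_cast hσ.ne'
  have hc' : (c : ℂ) ≠ 0 := by exact_mod_cast hc.ne'
  have hpi : (Real.pi : ℂ) ≠ 0 := by exact_mod_cast Real.pi_ne_zero
  have hw : ((1 + ‖w‖ ^ 2 : ℝ) : ℂ) ≠ 0 := by rw [← q_eq]; exact q_ne_zero w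
  -- `i` times the squared length of the unit vector along `ℙ¹`, times `2 i ρ`, is `-2 π / σ = -c`.
  have hcoef : Complex.I * (((Real.pi * (1 + ‖w‖ ^ 2) ^ 2 / σ : ℝ) : ℂ) *
      ((2 * Complex.I) * rho w)) = -(c : ℂ) := by
    have h1 : (c : ℂ) = 2 * Real.pi / σ := by rw [hcσ]; push_cast; rfl
    rw [rho, q_eq, h1]
    rw [Complex.ofReal_div, Complex.ofReal_mul, Complex.ofReal_pow]
    field_simp
    linear_combination Complex.I_sq
  have h4c : ((4 * Real.pi / σ : ℝ) : ℂ) = 2 * c := by rw [hcσ]; push_cast; ring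
  rw [hsum, h4c, smul_add]
  have hfib : Complex.I • (((Real.pi * (1 + ‖w‖ ^ 2) ^ 2 / σ : ℝ) : ℂ) • ((2 * Complex.I) •
      (shear (-mu w) (f z) ∘L (rho w • diagOp (-((c : ℂ)⁻¹ • (f z ∘L fs)))
        ((c : ℂ)⁻¹ • (fs ∘L f z) - (2 : ℂ) • .id ℂ G)) ∘L shear (mu w) (f z)))) =
      (shear (-mu w) (f z) ∘L (diagOp (f z ∘L fs) (-(fs ∘L f z) + (2 * c : ℂ) • .id ℂ G)) ∘L
        shear (mu w) (f z)) := by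
    rw [ContinuousLinearMap.smul_comp, ContinuousLinearMap.comp_smul, smul_smul, smul_smul,
      smul_smul]
    have h1 : Complex.I * ((Real.pi * (1 + ‖w‖ ^ 2) ^ 2 / σ : ℝ) : ℂ) *
        (2 * Complex.I) * rho w = -(c : ℂ) := by
      rw [← hcoef]; ring
    rw [h1, ← ContinuousLinearMap.comp_smul, ← ContinuousLinearMap.smul_comp, ← diagOp_smul]
    congr 3
    · rw [smul_neg, neg_smul, neg_neg, smul_smul, mul_inv_cancel₀ hc', one_smul]
    · rw [smul_sub, smul_smul, smul_smul, neg_mul, mul_inv_cancel₀ hc', neg_one_smul]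
      refine ContinuousLinearMap.ext fun s => ?_
      simp
      ring_nf
  rw [hfib, ← ContinuousLinearMap.comp_smul, ← ContinuousLinearMap.smul_comp, ← diagOp_smul,
    ← ContinuousLinearMap.comp_add, ← ContinuousLinearMap.add_comp, ← diagOp_add]
  congr 3
  rw [← add_assoc, ← sub_eq_add_neg]

end Model

/-! ### The orthogonal splitting of the fibres of the extension -/

namespace Triple

open FibreDirection

/-- The squared length of a vector of `ℂ²`, as a complex number. -/
def sqLen (v : Fin 2 → ℂ) : ℂ := conj (v 0) * v 0 + conj (v 1) * v 1

lemma sqLen_eq (v : Fin 2 → ℂ) : sqLen v = ((‖v 0‖ ^ 2 + ‖v 1‖ ^ 2 : ℝ) : ℂ) := by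
  rw [sqLen, Complex.conj_mul', Complex.conj_mul']; push_cast; rfl

lemma sqLen_ne_zero {v : Fin 2 → ℂ} (hv : v ≠ 0) : sqLen v ≠ 0 := by
  rw [sqLen_eq, Complex.ofReal_ne_zero]
  intro h
  apply hv
  have h0 : ‖v 0‖ ^ 2 = 0 := by nlinarith [sq_nonneg ‖v 0‖, sq_nonneg ‖v 1‖]
  have h1 : ‖v 1‖ ^ 2 = 0 := by nlinarith [sq_nonneg ‖v 0‖, sq_nonneg ‖v 1‖]
  funext k
  fin_cases k
  · simpa using h0
  · simpa using h1

lemma sqLen_smul (c : ℂ) (v : Fin 2 → ℂ) : sqLen (c • v) = conj c * c * sqLen v := by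
  simp only [sqLen, Pi.smul_apply, smul_eq_mul, map_mul]; ring

section Algebra

variable {Ex Lx : Type*} [AddCommGroup Ex] [Module ℂ Ex] [AddCommGroup Lx] [Module ℂ Lx]

/-- The map `w ↦ ⟨v, w⟩ / |v|²` from `ℂ² ⊗ L` to `L`. -/
def dotMap (v : Fin 2 → ℂ) : (Fin 2 → Lx) →ₗ[ℂ] Lx :=
  (sqLen v)⁻¹ • (conj (v 0) • LinearMap.proj 0 + conj (v 1) • LinearMap.proj 1)

/-- The map `w ↦ v ∧ w / |v|²` from `ℂ² ⊗ L` to `L`. -/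
def wedgeMap (v : Fin 2 → ℂ) : (Fin 2 → Lx) →ₗ[ℂ] Lx :=
  (sqLen v)⁻¹ • (v 0 • LinearMap.proj 1 - v 1 • LinearMap.proj 0)

lemma dotMap_apply (v : Fin 2 → ℂ) (w : Fin 2 → Lx) :
    dotMap v w = (sqLen v)⁻¹ • (conj (v 0) • w 0 + conj (v 1) • w 1) := rfl

lemma wedgeMap_apply (v : Fin 2 → ℂ) (w : Fin 2 → Lx) :
    wedgeMap v w = (sqLen v)⁻¹ • (v 0 • w 1 - v 1 • w 0) := rfl

/-- The splitting `[e, ψ] ↦ (e + φ ⟨v, ψ v⟩ / |v|², v ∧ ψ v / |v|²)` of the fibre over the line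
spanned by `v`. The first component does not depend on `v`, the second one only up to a phase. -/
def split (φ : Lx →ₗ[ℂ] Ex) (p : P1) (v : p.submodule) (hv : v.1 ≠ 0) :
    FibAt φ p →ₗ[ℂ] Ex × Lx :=
  Submodule.liftQ _
    (LinearMap.prod
      (LinearMap.fst _ _ _ + φ ∘ₗ dotMap v.1 ∘ₗ LinearMap.applyₗ v ∘ₗ LinearMap.snd _ _ _)
      (wedgeMap v.1 ∘ₗ LinearMap.applyₗ v ∘ₗ LinearMap.snd _ _ _))
    (by
      rintro _ ⟨l, rfl⟩
      have h := sqLen_ne_zero hv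
      have h1 : dotMap v.1 (eulerMap p l v) = l := by
        rw [dotMap_apply, eulerMap_apply, eulerMap_apply, smul_smul, smul_smul, ← add_smul,
          smul_smul, ← sqLen, inv_mul_cancel₀ h, one_smul]
      have h2 : wedgeMap v.1 (eulerMap p l v) = 0 := by
        rw [wedgeMap_apply, eulerMap_apply, eulerMap_apply, smul_smul, smul_smul, mul_comm,
          sub_self, smul_zero]
      rw [LinearMap.mem_ker]
      refine Prod.ext ?_ h2
      change -φ l + φ (dotMap v.1 (eulerMap p l v)) = 0
      rw [h1, neg_add_cancel])

lemma split_mk (φ : Lx →ₗ[ℂ] Ex) (p : P1) (v : p.submodule) (hv : v.1 ≠ 0) (e : Ex)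
    (ψ : p.submodule →ₗ[ℂ] (Fin 2 → Lx)) :
    split φ p v hv (Submodule.mkQ _ (e, ψ)) = (e + φ (dotMap v.1 (ψ v)), wedgeMap v.1 (ψ v)) := rfl

lemma split_smul (φ : Lx →ₗ[ℂ] Ex) (p : P1) (v : p.submodule) (hv : v.1 ≠ 0) (c : ℂ)
    (hcv : (c • v).1 ≠ 0) (ξ : FibAt φ p) :
    split φ p (c • v) hcv ξ = ((split φ p v hv ξ).1, (c / conj c) • (split φ p v hv ξ).2) := by
  obtain ⟨⟨e, ψ⟩, rfl⟩ := Submodule.mkQ_surjective (LinearMap.range (relMap φ p)) ξ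
  have hc : c ≠ 0 := by rintro rfl; simp at hcv
  have hc' : conj c ≠ 0 := by simpa using hc
  have h := sqLen_ne_zero hv
  rw [split_mk, split_mk, map_smul]
  have e1 : (c • v : p.submodule).1 = c • v.1 := rfl
  refine Prod.ext ?_ ?_
  · change e + φ _ = e + φ _
    congr 2
    simp only [dotMap_apply, e1, sqLen_smul, Pi.smul_apply, smul_eq_mul, map_mul, smul_add,
      smul_smul]
    congr 2 <;> field_simp
  · change _ = (c / conj c) • wedgeMap v.1 (ψ v)
    simp only [wedgeMap_apply, e1, sqLen_smul, Pi.smul_apply, smul_eq_mul, smul_sub,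
      smul_smul]
    congr 2 <;> field_simp

/-- The sign by which the `i`-th frame of the quotient differs from the wedge product. -/
def frameSign (i : Fin 2) : ℂ := if i = 0 then 1 else -1

lemma conj_frameSign_mul (i : Fin 2) : conj (frameSign i) * frameSign i = 1 := by
  unfold frameSign; split_ifs <;> simp

lemma normVec_ne_zero {i : Fin 2} {p : P1} (hp : p ∈ P1.U i) : P1.normVec i p ≠ 0 :=
  fun h => hp (congrFun h i)

lemma sqLen_normVec {i : Fin 2} {p : P1} (hp : p ∈ P1.U i) :
    sqLen (P1.normVec i p) = q (P1.coord i p) := by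
  have h := P1.normVec_self hp
  fin_cases i
  · change sqLen (P1.normVec 0 p) = 1 + P1.normVec 0 p 1 * conj (P1.normVec 0 p 1)
    change P1.normVec 0 p 0 = 1 at h
    rw [sqLen, h, map_one]; ring
  · change sqLen (P1.normVec 1 p) = 1 + P1.normVec 1 p 0 * conj (P1.normVec 1 p 0)
    change P1.normVec 1 p 1 = 1 at h
    rw [sqLen, h, map_one]; ring

/-- The splitting in the `i`-th frame. -/
lemma split_ofProd (φ : Lx →ₗ[ℂ] Ex) (i : Fin 2) (p : P1) (hp : p ∈ P1.U i) (s : Ex × Lx) :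
    split φ p ⟨_, P1.normVec_mem i p⟩ (normVec_ne_zero hp) (ofProd φ i p s) =
      (s.1 + mu (P1.coord i p) • φ s.2, (frameSign i * (q (P1.coord i p))⁻¹) • s.2) := by
  obtain ⟨e, l⟩ := s
  have h := P1.normVec_self hp
  rw [ofProd_mk, split_mk]
  refine Prod.ext ?_ ?_
  · change e + φ _ = e + mu (P1.coord i p) • φ l
    rw [← map_smul]
    congr 2
    rw [dotMap_apply, coordMap_apply, coordMap_apply, sqLen_normVec hp, mu]
    change (q (P1.coord i p))⁻¹ • (conj (P1.normVec i p 0) • _ + conj (P1.normVec i p 1) • _) = _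
    simp only [h, one_smul]
    fin_cases i <;> simp [P1.coord, smul_smul, mul_comm]
  · change _ = (frameSign i * (q (P1.coord i p))⁻¹) • l
    rw [wedgeMap_apply, coordMap_apply, coordMap_apply, sqLen_normVec hp]
    change (q (P1.coord i p))⁻¹ • (P1.normVec i p 0 • _ - P1.normVec i p 1 • _) = _
    simp only [h, one_smul]
    fin_cases i
    · change P1.normVec 0 p 0 = 1 at h
      simp [frameSign, h]
    · change P1.normVec 1 p 1 = 1 at h
      simp [frameSign, h]

lemma su2Lin_mem (s : Matrix.specialUnitaryGroup (Fin 2) ℂ) (p : P1) {v : Fin 2 → ℂ}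
    (hv : v ∈ p.submodule) : su2Lin s v ∈ (su2P1 s p).submodule := by
  induction p using Projectivization.ind with
  | h w hw =>
    rw [Projectivization.submodule_mk, Submodule.mem_span_singleton] at hv
    obtain ⟨a, rfl⟩ := hv
    rw [su2P1, Projectivization.map_mk, Projectivization.submodule_mk, map_smul]
    exact Submodule.smul_mem _ _ (Submodule.mem_span_singleton_self _)

lemma su2_star_mul (s : Matrix.specialUnitaryGroup (Fin 2) ℂ) :
    star s.1 * s.1 = 1 := (Matrix.mem_unitaryGroup_iff'.1 s.2.1)

lemma su2_det (s : Matrix.specialUnitaryGroup (Fin 2) ℂ) :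
    s.1 0 0 * s.1 1 1 - s.1 0 1 * s.1 1 0 = 1 := by
  rw [← Matrix.det_fin_two]; exact s.2.2

lemma su2_relations (s : Matrix.specialUnitaryGroup (Fin 2) ℂ) (i j : Fin 2) :
    conj (s.1 0 i) * s.1 0 j + conj (s.1 1 i) * s.1 1 j = if i = j then 1 else 0 := by
  have h := congrFun (congrFun (su2_star_mul s) i) j
  rw [Matrix.mul_apply, Fin.sum_univ_two, Matrix.one_apply] at h
  exact h

lemma su2Lin_apply (s : Matrix.specialUnitaryGroup (Fin 2) ℂ) (v : Fin 2 → ℂ) (i : Fin 2) :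
    su2Lin s v i = s.1 i 0 * v 0 + s.1 i 1 * v 1 := by
  simp [Matrix.toLin'_apply, Matrix.mulVec, dotProduct, Fin.sum_univ_two]

lemma su2Tensor_apply (s : Matrix.specialUnitaryGroup (Fin 2) ℂ) (w : Fin 2 → Lx) (i : Fin 2) :
    su2Tensor s w i = s.1 i 0 • w 0 + s.1 i 1 • w 1 := by
  simp [su2Tensor, Fin.sum_univ_two]

lemma sqLen_su2Lin (s : Matrix.specialUnitaryGroup (Fin 2) ℂ) (v : Fin 2 → ℂ) :
    sqLen (su2Lin s v) = sqLen v := by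
  have h00 := su2_relations s 0 0
  have h01 := su2_relations s 0 1
  have h10 := su2_relations s 1 0
  have h11 := su2_relations s 1 1
  simp at h00 h01 h10 h11
  simp only [sqLen, su2Lin_apply, map_add, map_mul]
  linear_combination conj (v 0) * v 0 * h00 + conj (v 0) * v 1 * h01 + conj (v 1) * v 0 * h10 +
    conj (v 1) * v 1 * h11

lemma dotMap_su2 (s : Matrix.specialUnitaryGroup (Fin 2) ℂ) (v : Fin 2 → ℂ) (w : Fin 2 → Lx) :
    dotMap (su2Lin s v) (su2Tensor s w) = dotMap v w := by
  have h00 := su2_relations s 0 0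
  have h01 := su2_relations s 0 1
  have h10 := su2_relations s 1 0
  have h11 := su2_relations s 1 1
  simp at h00 h01 h10 h11
  rw [dotMap_apply, dotMap_apply, sqLen_su2Lin]
  congr 1
  simp only [su2Lin_apply, su2Tensor_apply, map_add, map_mul]
  match_scalars
  · linear_combination conj (v 0) * h00 + conj (v 1) * h10
  · linear_combination conj (v 0) * h01 + conj (v 1) * h11

lemma wedgeMap_su2 (s : Matrix.specialUnitaryGroup (Fin 2) ℂ) (v : Fin 2 → ℂ) (w : Fin 2 → Lx) :
    wedgeMap (su2Lin s v) (su2Tensor s w) = wedgeMap v w := by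
  have h := su2_det s
  rw [wedgeMap_apply, wedgeMap_apply, sqLen_su2Lin]
  congr 1
  simp only [su2Lin_apply, su2Tensor_apply]
  match_scalars
  · linear_combination -v 1 * h
  · linear_combination v 0 * h

/-- The splitting is `SU(2)`-equivariant. -/
lemma split_su2FibAt (φ : Lx →ₗ[ℂ] Ex) (s : Matrix.specialUnitaryGroup (Fin 2) ℂ) (p : P1)
    (v : p.submodule) (hv : v.1 ≠ 0) (hsv : su2Lin s v.1 ≠ 0) (ξ : FibAt φ p) :
    split φ (su2P1 s p) ⟨_, su2Lin_mem s p v.2⟩ hsv (su2FibAt φ s p ξ) = split φ p v hv ξ := by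
  obtain ⟨⟨e, ψ⟩, rfl⟩ := Submodule.mkQ_surjective (LinearMap.range (relMap φ p)) ξ
  have h1 : su2InvOn s p ⟨_, su2Lin_mem s p v.2⟩ = v := by
    have h2 := su2Lin_inv s⁻¹ v.1
    rw [inv_inv] at h2
    exact Subtype.ext h2
  change (e + φ (dotMap (su2Lin s v.1) (su2Tensor s (ψ (su2InvOn s p ⟨_, su2Lin_mem s p v.2⟩)))),
    wedgeMap (su2Lin s v.1) (su2Tensor s (ψ (su2InvOn s p ⟨_, su2Lin_mem s p v.2⟩)))) = _
  rw [h1, dotMap_su2, wedgeMap_su2]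
  rfl

/-- Two nonzero vectors of a line are proportional. -/
lemma exists_smul_eq (p : P1) (v w : p.submodule) (hv : v.1 ≠ 0) : ∃ c : ℂ, w = c • v := by
  induction p using Projectivization.ind with
  | h u hu =>
    obtain ⟨v, hv'⟩ := v
    obtain ⟨w, hw'⟩ := w
    rw [Projectivization.submodule_mk, Submodule.mem_span_singleton] at hv' hw'
    obtain ⟨a, rfl⟩ := hv'
    obtain ⟨b, rfl⟩ := hw'
    have ha : a ≠ 0 := by rintro rfl; simp at hv
    exact ⟨b / a, Subtype.ext (by
      change b • u = (b / a) • a • u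
      rw [smul_smul, div_mul_cancel₀ _ ha])⟩

/-- Only the second component of the splitting depends on the vector, through a factor of modulus
`1`: the sesquilinear form `H ⊕ c K` on a fibre does not depend on the vector used to split it. -/
lemma splitForm_indep (φ : Lx →ₗ[ℂ] Ex) (p : P1) (v w : p.submodule) (hv : v.1 ≠ 0) (hw : w.1 ≠ 0)
    (H : Ex → Ex → ℂ) (c : ℂ) (K : Lx → Lx → ℂ)
    (hK : ∀ (a : ℂ) l l', K (a • l) (a • l') = conj a * a * K l l') (ξ η : FibAt φ p) :
    H (split φ p v hv ξ).1 (split φ p v hv η).1 + c * K (split φ p v hv ξ).2 (split φ p v hv η).2 =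
    H (split φ p w hw ξ).1 (split φ p w hw η).1 +
      c * K (split φ p w hw ξ).2 (split φ p w hw η).2 := by
  obtain ⟨a, rfl⟩ := exists_smul_eq p v w hv
  have ha : a ≠ 0 := by rintro rfl; simp at hw
  have ha' : conj a ≠ 0 := by simpa using ha
  rw [split_smul φ p v hv a hw, split_smul φ p v hv a hw]
  simp only [hK]
  have : conj (a / conj a) * (a / conj a) = 1 := by
    rw [map_div₀, Complex.conj_conj]; field_simp
  rw [this, one_mul]

end Algebra

end Triple

/-! ### The metric on the extension in the preferred frames -/

namespace Triple

open FibreDirection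

section Frames

variable {EX : Type*} [NormedAddCommGroup EX] [NormedSpace ℂ EX]
  {X : Type*} [TopologicalSpace X] [ChartedSpace EX X]
  {FE : Type*} [NormedAddCommGroup FE] [NormedSpace ℂ FE]
  {E : X → Type*} [TopologicalSpace (TotalSpace FE E)]
  [∀ x, AddCommGroup (E x)] [∀ x, Module ℂ (E x)] [∀ x, TopologicalSpace (E x)]
  [∀ x, IsTopologicalAddGroup (E x)] [∀ x, ContinuousSMul ℂ (E x)]
  [FiberBundle FE E] [VectorBundle ℂ FE E]
  {L : X → Type*} [TopologicalSpace (TotalSpace ℂ L)]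
  [∀ x, AddCommGroup (L x)] [∀ x, Module ℂ (L x)] [∀ x, TopologicalSpace (L x)]
  [FiberBundle ℂ L] [VectorBundle ℂ ℂ L]

lemma extChartAt_symm_prod (b₀ : X × P1) (y : EX × ℂ) :
    (extChartAt (𝓘(ℂ, EX).prod 𝓘(ℂ)) b₀).symm y =
      ((extChartAt 𝓘(ℂ, EX) b₀.1).symm y.1, (P1.chart (P1.idx b₀.2)).symm y.2) := by
  rw [extChartAt_prod]
  rfl

lemma extChartAt_target_prod (b₀ : X × P1) :
    (extChartAt (𝓘(ℂ, EX).prod 𝓘(ℂ)) b₀).target =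
      (extChartAt 𝓘(ℂ, EX) b₀.1).target ×ˢ univ := by
  rw [extChartAt_prod, PartialEquiv.prod_target]
  congr 1
  simp [extChartAt, P1.chartAt_eq]
  rfl

variable (φ : HolHom EX FE E L)

lemma coord_chart_symm (i : Fin 2) (w : ℂ) : P1.coord i ((P1.chart i).symm w) = w :=
  (P1.chart i).right_inv (mem_univ w)

lemma chart_symm_mem (i : Fin 2) (w : ℂ) : (P1.chart i).symm w ∈ P1.U i :=
  (P1.chart i).map_target (mem_univ w)

/-- The homomorphism `φ` in the preferred chart and frames at `x₀`. -/
def frameHom (x₀ : X) (z : EX) : ℂ →L[ℂ] FE :=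
  (trivializationAt FE E x₀).continuousLinearMapAt ℂ ((extChartAt 𝓘(ℂ, EX) x₀).symm z) ∘L
    φ ((extChartAt 𝓘(ℂ, EX) x₀).symm z) ∘L
      (trivializationAt ℂ L x₀).symmL ℂ ((extChartAt 𝓘(ℂ, EX) x₀).symm z)

lemma symmL_frameHom (x₀ : X) (z : EX)
    (hz : (extChartAt 𝓘(ℂ, EX) x₀).symm z ∈ (trivializationAt FE E x₀).baseSet) (l : ℂ) :
    (trivializationAt FE E x₀).symmL ℂ ((extChartAt 𝓘(ℂ, EX) x₀).symm z) (frameHom φ x₀ z l) =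
      φ ((extChartAt 𝓘(ℂ, EX) x₀).symm z)
        ((trivializationAt ℂ L x₀).symmL ℂ ((extChartAt 𝓘(ℂ, EX) x₀).symm z) l) :=
  (trivializationAt FE E x₀).symmL_continuousLinearMapAt hz _

lemma frameHom_center (x : X) : frameHom φ x (extChartAt 𝓘(ℂ, EX) x x) =
    (trivializationAt FE E x).continuousLinearMapAt ℂ x ∘L φ x ∘L
      (trivializationAt ℂ L x).symmL ℂ x :=
  congrArg (fun y => (trivializationAt FE E x).continuousLinearMapAt ℂ y ∘L φ y ∘L
    (trivializationAt ℂ L x).symmL ℂ y) (extChartAt_to_inv (I := 𝓘(ℂ, EX)) x)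

/-- The relation between a metric on the extension and metrics `H` on `E` and `K` on `L` which says
that it is the orthogonal sum of `H` and `c K` with respect to the splitting of the fibres; the
factor `1 / |v|²` in the splitting means that `K` is multiplied by the Fubini–Study metric. -/
def IsSplit (h : ∀ b, Fib φ b →L⋆[ℂ] Fib φ b →L[ℂ] ℂ) (H : ∀ x, E x →L⋆[ℂ] E x →L[ℂ] ℂ) (c : ℝ)
    (K : ∀ x, L x →L⋆[ℂ] L x →L[ℂ] ℂ) : Prop :=
  ∀ (x : X) (p : P1) (v : p.submodule) (hv : v.1 ≠ 0) (ξ η : Fib φ (x, p)),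
    h (x, p) ξ η =
      H x (split (φ x : L x →ₗ[ℂ] E x) p v hv ξ).1 (split (φ x : L x →ₗ[ℂ] E x) p v hv η).1 +
      c * K x (split (φ x : L x →ₗ[ℂ] E x) p v hv ξ).2 (split (φ x : L x →ₗ[ℂ] E x) p v hv η).2

variable {φ}

lemma IsSplit.fibEquiv_symm {h : ∀ b, Fib φ b →L⋆[ℂ] Fib φ b →L[ℂ] ℂ}
    {H : ∀ x, E x →L⋆[ℂ] E x →L[ℂ] ℂ} {c : ℝ} {K : ∀ x, L x →L⋆[ℂ] L x →L[ℂ] ℂ}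
    (hs : IsSplit φ h H c K) (i : Fin 2) (b : X × P1) (hb : b.2 ∈ P1.U i) (s t : E b.1 × L b.1) :
    h b ((fibEquiv φ i b hb).symm s) ((fibEquiv φ i b hb).symm t) =
      H b.1 (s.1 + mu (P1.coord i b.2) • φ b.1 s.2) (t.1 + mu (P1.coord i b.2) • φ b.1 t.2) +
        c * rho (P1.coord i b.2) * K b.1 s.2 t.2 := by
  obtain ⟨x, p⟩ := b
  have h1 := hs x p ⟨_, P1.normVec_mem i p⟩ (normVec_ne_zero hb) ((fibEquiv φ i (x, p) hb).symm s)
    ((fibEquiv φ i (x, p) hb).symm t)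
  have h2 : ∀ s, split (φ x : L x →ₗ[ℂ] E x) p ⟨_, P1.normVec_mem i p⟩ (normVec_ne_zero hb)
      ((fibEquiv φ i (x, p) hb).symm s) = _ := fun s =>
    split_ofProd (φ x : L x →ₗ[ℂ] E x) i p hb s
  rw [h1, h2, h2]
  simp only [map_smulₛₗ, smul_apply, map_mul, map_inv₀, conj_q, smul_eq_mul,
    RingHom.id_apply, rho]
  have h3 := conj_frameSign_mul i
  change _ + _ = _ + _
  congr 1
  linear_combination (c * ((q (P1.coord i p))⁻¹) ^ 2 * K x s.2 t.2) * h3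

variable [IsManifold 𝓘(ℂ, EX) ω X] [ContMDiffVectorBundle ω FE E 𝓘(ℂ, EX)]
  [ContMDiffVectorBundle ω ℂ L 𝓘(ℂ, EX)]

variable (φ) in
lemma symmL_trivializationAt (b₀ b : X × P1)
    (hb : b ∈ (trivializationAt (FE × ℂ) (Fib φ) b₀).baseSet) (s : FE × ℂ) :
    (trivializationAt (FE × ℂ) (Fib φ) b₀).symmL ℂ b s =
      (fibEquiv φ (P1.idx b₀.2) b hb.2).symm ((trivializationAt FE E b₀.1).symmL ℂ b.1 s.1,
        (trivializationAt ℂ L b₀.1).symmL ℂ b.1 s.2) :=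
  (Trivialization.symmL_apply _ hb s).trans ((pretriv_symm_apply φ (trivializationAt FE E b₀.1)
    (trivializationAt ℂ L b₀.1) _ b hb s))

variable (φ) in
lemma contDiffOn_frameHom (x₀ : X) : ContDiffOn ℂ ω (frameHom φ x₀)
    ((extChartAt 𝓘(ℂ, EX) x₀).target ∩ (extChartAt 𝓘(ℂ, EX) x₀).symm ⁻¹'
      ((trivializationAt FE E x₀).baseSet ∩ (trivializationAt ℂ L x₀).baseSet)) := by
  have h := (((trivializationAt ℂ L x₀).continuousLinearMap (RingHom.id ℂ)
    (trivializationAt FE E x₀)).contMDiffOn_section_baseSet_iff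
      (IB := 𝓘(ℂ, EX)) (n := ω) (s := φ)).1 φ.contMDiff.contMDiffOn
  rw [← contMDiffOn_iff_contDiffOn]
  refine (h.comp ((contMDiffOn_extChartAt_symm x₀).mono inter_subset_left) ?_)
  intro z hz
  exact ⟨hz.2.2, hz.2.1⟩

/-- In the preferred frames, a split metric is given by the model. -/
lemma IsSplit.gram_eq {h : ∀ b, Fib φ b →L⋆[ℂ] Fib φ b →L[ℂ] ℂ}
    {H : ∀ x, E x →L⋆[ℂ] E x →L[ℂ] ℂ} {c : ℝ} {K : ∀ x, L x →L⋆[ℂ] L x →L[ℂ] ℂ}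
    (hs : IsSplit φ h H c K) (b₀ : X × P1) (y : EX × ℂ)
    (hy : (extChartAt 𝓘(ℂ, EX) b₀.1).symm y.1 ∈
      (trivializationAt FE E b₀.1).baseSet ∩ (trivializationAt ℂ L b₀.1).baseSet) :
    gram (𝓘(ℂ, EX).prod 𝓘(ℂ)) (FE × ℂ) (Fib φ) h b₀ y =
      modelForm (gram 𝓘(ℂ, EX) FE E H b₀.1) c (gram 𝓘(ℂ, EX) ℂ L K b₀.1) (frameHom φ b₀.1) y := by
  have hb : ((extChartAt 𝓘(ℂ, EX) b₀.1).symm y.1, (P1.chart (P1.idx b₀.2)).symm y.2) ∈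
      (trivializationAt (FE × ℂ) (Fib φ) b₀).baseSet := ⟨hy, chart_symm_mem _ _⟩
  refine ContinuousLinearMap.ext fun s => ContinuousLinearMap.ext fun t => ?_
  change h ((extChartAt (𝓘(ℂ, EX).prod 𝓘(ℂ)) b₀).symm y)
    ((trivializationAt (FE × ℂ) (Fib φ) b₀).symmL ℂ _ t)
    ((trivializationAt (FE × ℂ) (Fib φ) b₀).symmL ℂ _ s) = _
  rw [extChartAt_symm_prod, symmL_trivializationAt φ b₀ _ hb, symmL_trivializationAt φ b₀ _ hb,
    hs.fibEquiv_symm, coord_chart_symm]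
  change _ = H _ ((trivializationAt FE E b₀.1).symmL ℂ _ (shear _ _ t).1)
    ((trivializationAt FE E b₀.1).symmL ℂ _ (shear _ _ s).1) + c * rho y.2 * K _
    ((trivializationAt ℂ L b₀.1).symmL ℂ _ (shear _ _ t).2)
    ((trivializationAt ℂ L b₀.1).symmL ℂ _ (shear _ _ s).2)
  simp only [shear_apply, map_add, map_smul, symmL_frameHom φ b₀.1 y.1 hy.1]

end Frames
end Triple

/-! ### Smoothness of metrics, and the metric on the extension given by `H` and `K` -/

lemma ContDiffAt.compC {EM W₁ W₂ W₃ : Type*} [NormedAddCommGroup EM] [NormedSpace ℂ EM]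
    [NormedAddCommGroup W₁] [NormedSpace ℂ W₁]
    [NormedAddCommGroup W₂] [NormedSpace ℂ W₂] [NormedAddCommGroup W₃] [NormedSpace ℂ W₃]
    {n : WithTop ℕ∞} {f : EM → W₂ →L[ℂ] W₃} {g : EM → W₁ →L[ℂ] W₂} {z : EM}
    (hf : ContDiffAt ℝ n f z) (hg : ContDiffAt ℝ n g z) :
    ContDiffAt ℝ n (fun y => f y ∘L g y) z :=
  ((ContinuousLinearMap.compL ℂ W₁ W₂ W₃).bilinearRestrictScalars
    ℝ).isBoundedBilinearMap.contDiff.contDiffAt.comp z (hf.prodMk hg)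

lemma ContDiffAt.smulC {EM W : Type*} [NormedAddCommGroup EM] [NormedSpace ℂ EM]
    [NormedAddCommGroup W] [NormedSpace ℂ W]
    {n : WithTop ℕ∞} {f : EM → ℂ} {g : EM → W} {z : EM}
    (hf : ContDiffAt ℝ n f z) (hg : ContDiffAt ℝ n g z) :
    ContDiffAt ℝ n (fun y => f y • g y) z :=
  ((ContinuousLinearMap.lsmul ℂ ℂ (E := W)).bilinearRestrictScalars
    ℝ).isBoundedBilinearMap.contDiff.contDiffAt.comp z (hf.prodMk hg)

lemma ContDiffAt.conjC {EM W₁ W₂ : Type*} [NormedAddCommGroup EM] [NormedSpace ℂ EM]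
    [NormedAddCommGroup W₁] [NormedSpace ℂ W₁]
    [NormedAddCommGroup W₂] [NormedSpace ℂ W₂] (B : W₁ →L⋆[ℂ] W₂)
    {n : WithTop ℕ∞} {f : EM → W₁} {z : EM} (hf : ContDiffAt ℝ n f z) :
    ContDiffAt ℝ n (fun y => B (f y)) z :=
  (realOfConj B).contDiff.contDiffAt.comp z hf

lemma contDiffAt_pullForm {EM F G : Type*} [NormedAddCommGroup EM] [NormedSpace ℂ EM]
    [NormedAddCommGroup F] [NormedSpace ℂ F] [NormedAddCommGroup G] [NormedSpace ℂ G]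
    {n : WithTop ℕ∞} {S : EM → F →L[ℂ] G} {B : EM → G →L[ℂ] G →L⋆[ℂ] ℂ} {z : EM}
    (hS : ContDiffAt ℝ n S z) (hB : ContDiffAt ℝ n B z) :
    ContDiffAt ℝ n (fun y => pullForm (S y) (B y)) z := by
  have h1 : ContDiffAt ℝ n (fun y => conjTranspose F G (S y)) z :=
    ContDiffAt.conjC (W₂ := (G →L⋆[ℂ] ℂ) →L[ℂ] (F →L⋆[ℂ] ℂ)) (conjTranspose F G) hS
  exact h1.compC (hB.compC hS)

lemma contDiffAt_modelForm {EX F G : Type*} [NormedAddCommGroup EX] [NormedSpace ℂ EX]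
    [NormedAddCommGroup F] [NormedSpace ℂ F] [NormedAddCommGroup G] [NormedSpace ℂ G]
    {n : WithTop ℕ∞} {a : EX → F →L[ℂ] F →L⋆[ℂ] ℂ} (c : ℝ) {k : EX → G →L[ℂ] G →L⋆[ℂ] ℂ}
    {f : EX → G →L[ℂ] F} {y : EX × ℂ} (ha : ContDiffAt ℝ n a y.1) (hk : ContDiffAt ℝ n k y.1)
    (hf : ContDiffAt ℝ n f y.1) : ContDiffAt ℝ n (modelForm a c k f) y := by
  have ha' : ContDiffAt ℝ n (fun y : EX × ℂ => a y.1) y := ha.comp y contDiffAt_fst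
  have hk' : ContDiffAt ℝ n (fun y : EX × ℂ => k y.1) y := hk.comp y contDiffAt_fst
  have hf' : ContDiffAt ℝ n (fun y : EX × ℂ => f y.1) y := hf.comp y contDiffAt_fst
  have hmu : ContDiffAt ℝ n (fun y : EX × ℂ => FibreDirection.mu y.2) y :=
    FibreDirection.contDiff_mu.contDiffAt.comp y contDiffAt_snd
  have hrho : ContDiffAt ℝ n (fun y : EX × ℂ => (c : ℂ) * FibreDirection.rho y.2) y :=
    contDiffAt_const.mul (FibreDirection.contDiff_rho.contDiffAt.comp y contDiffAt_snd)
  have hS : ContDiffAt ℝ n (fun y : EX × ℂ => shear (FibreDirection.mu y.2) (f y.1)) y :=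
    contDiffAt_const.add (hmu.smulC (hf'.constCompC _ _))
  have hD : ContDiffAt ℝ n (fun y : EX × ℂ =>
      sumForm (a y.1) (c * FibreDirection.rho y.2) (k y.1)) y := by
    have h1 : ContDiffAt ℝ n (fun y : EX × ℂ => ((c : ℂ) * FibreDirection.rho y.2) •
        conjTranspose (F × G) G (.snd ℂ F G)) y :=
      ContDiffAt.smulC (W := (G →L⋆[ℂ] ℂ) →L[ℂ] (F × G →L⋆[ℂ] ℂ)) hrho contDiffAt_const
    exact (ha'.constCompC _ _).add (h1.compC (hk'.compC contDiffAt_const))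
  exact contDiffAt_pullForm hS hD

section Center

variable {EM : Type*} [NormedAddCommGroup EM] [NormedSpace ℂ EM]
  {HM : Type*} [TopologicalSpace HM] {I : ModelWithCorners ℂ EM HM}
  {M : Type*} [TopologicalSpace M] [ChartedSpace HM M]
  {F : Type*} [NormedAddCommGroup F] [NormedSpace ℂ F]
  {V : M → Type*} [TopologicalSpace (TotalSpace F V)]
  [∀ b, AddCommGroup (V b)] [∀ b, Module ℂ (V b)] [∀ b, TopologicalSpace (V b)]
  [FiberBundle F V] [VectorBundle ℂ F V]

lemma re_gram_pos (h : HermitianMetric I F V) (b₀ : M) (z : EM)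
    (hz : (extChartAt I b₀).symm z ∈ (trivializationAt F V b₀).baseSet) (s : F) (hs : s ≠ 0) :
    0 < (gram I F V h.inner b₀ z s s).re := by
  refine h.pos _ _ fun h0 => hs ?_
  have h1 := congrArg ((trivializationAt F V b₀).continuousLinearMapAt ℂ _) h0
  exact ((trivializationAt F V b₀).continuousLinearMapAt_symmL hz s).symm.trans
    (h1.trans (map_zero _))

lemma frame_domain_mem_nhds [I.Boundaryless] (b₀ : M) {S : Set M} (hS : S ∈ 𝓝 b₀) :
    (extChartAt I b₀).target ∩ (extChartAt I b₀).symm ⁻¹' S ∈ 𝓝 (extChartAt I b₀ b₀) := by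
  refine Filter.inter_mem (extChartAt_target_mem_nhds b₀) ?_
  refine (continuousAt_extChartAt_symm b₀).preimage_mem_nhds ?_
  rwa [extChartAt_to_inv]

lemma isOpen_frame_domain [I.Boundaryless] (b₀ : M) {S : Set M} (hS : IsOpen S) :
    IsOpen ((extChartAt I b₀).target ∩ (extChartAt I b₀).symm ⁻¹' S) :=
  (continuousOn_extChartAt_symm b₀).isOpen_inter_preimage (isOpen_extChartAt_target b₀) hS

lemma contDiffAt_gram [I.Boundaryless] (h : HermitianMetric I F V) (b₀ : M) :
    ContDiffAt ℝ ∞ (gram I F V h.inner b₀) (extChartAt I b₀ b₀) :=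
  (h.smooth b₀).contDiffAt (frame_domain_mem_nhds b₀
    ((trivializationAt F V b₀).open_baseSet.mem_nhds (mem_baseSet_trivializationAt F V b₀)))

end Center

namespace Triple

open FibreDirection

section Construction

variable {EX : Type*} [NormedAddCommGroup EX] [NormedSpace ℂ EX]
  {X : Type*} [TopologicalSpace X] [ChartedSpace EX X]
  {FE : Type*} [NormedAddCommGroup FE] [NormedSpace ℂ FE]
  {E : X → Type*} [TopologicalSpace (TotalSpace FE E)]
  [∀ x, AddCommGroup (E x)] [∀ x, Module ℂ (E x)] [∀ x, TopologicalSpace (E x)]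
  [∀ x, IsTopologicalAddGroup (E x)] [∀ x, ContinuousSMul ℂ (E x)]
  [FiberBundle FE E] [VectorBundle ℂ FE E]
  {L : X → Type*} [TopologicalSpace (TotalSpace ℂ L)]
  [∀ x, AddCommGroup (L x)] [∀ x, Module ℂ (L x)] [∀ x, TopologicalSpace (L x)]
  [FiberBundle ℂ L] [VectorBundle ℂ ℂ L]
  (φ : HolHom EX FE E L)

/-- The identification of a fibre with `E x × L x` in the preferred frame is continuous. -/
def fibCoord (b : X × P1) : Fib φ b →L[ℂ] E b.1 × L b.1 where
  toLinearMap := (fibEquiv φ (P1.idx b.2) b (P1.mem_U_idx b.2) : Fib φ b →ₗ[ℂ] E b.1 × L b.1)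
  cont := continuous_induced_dom

/-- The component in `E` of the orthogonal splitting. -/
def fibPar (b : X × P1) : Fib φ b →L[ℂ] E b.1 :=
  (ContinuousLinearMap.fst ℂ _ _ + mu (P1.coord (P1.idx b.2) b.2) •
    (φ b.1 ∘L ContinuousLinearMap.snd ℂ _ _)) ∘L fibCoord φ b

/-- The component in `L` of the orthogonal splitting, in the preferred frame. -/
def fibPerp (b : X × P1) : Fib φ b →L[ℂ] L b.1 :=
  ContinuousLinearMap.snd ℂ _ _ ∘L fibCoord φ b

lemma fibPar_apply (b : X × P1) (ξ : Fib φ b) : fibPar φ b ξ =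
    (fibCoord φ b ξ).1 + mu (P1.coord (P1.idx b.2) b.2) • φ b.1 (fibCoord φ b ξ).2 := rfl

lemma fibPerp_apply (b : X × P1) (ξ : Fib φ b) : fibPerp φ b ξ = (fibCoord φ b ξ).2 := rfl

/-- The sesquilinear forms on the fibres of the extension given by forms on `E` and `L`. -/
def splitInner (H : ∀ x, E x →L⋆[ℂ] E x →L[ℂ] ℂ) (c : ℝ) (K : ∀ x, L x →L⋆[ℂ] L x →L[ℂ] ℂ)
    (b : X × P1) : Fib φ b →L⋆[ℂ] Fib φ b →L[ℂ] ℂ :=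
  (ContinuousLinearMap.precomp ℂ (fibPar φ b)).comp ((H b.1).comp (fibPar φ b)) +
    (c * rho (P1.coord (P1.idx b.2) b.2)) •
      (ContinuousLinearMap.precomp ℂ (fibPerp φ b)).comp ((K b.1).comp (fibPerp φ b))

lemma splitInner_apply (H : ∀ x, E x →L⋆[ℂ] E x →L[ℂ] ℂ) (c : ℝ)
    (K : ∀ x, L x →L⋆[ℂ] L x →L[ℂ] ℂ) (b : X × P1) (ξ η : Fib φ b) :
    splitInner φ H c K b ξ η = H b.1 (fibPar φ b ξ) (fibPar φ b η) +
      c * rho (P1.coord (P1.idx b.2) b.2) * K b.1 (fibPerp φ b ξ) (fibPerp φ b η) := rfl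

lemma isSplit_splitInner (H : ∀ x, E x →L⋆[ℂ] E x →L[ℂ] ℂ) (c : ℝ)
    (K : ∀ x, L x →L⋆[ℂ] L x →L[ℂ] ℂ) : IsSplit φ (splitInner φ H c K) H c K := by
  intro x p v hv ξ η
  have hi := P1.mem_U_idx p
  refine Eq.trans ?_ (splitForm_indep (φ x : L x →ₗ[ℂ] E x) p ⟨_, P1.normVec_mem (P1.idx p) p⟩ v
    (normVec_ne_zero hi) hv (fun e e' => H x e e') c (fun l l' => K x l l') (by
      intro a l l'
      simp only [map_smulₛₗ, smul_apply, smul_eq_mul, RingHom.id_apply]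
      ring) ξ η)
  have h2 : ∀ ξ : Fib φ (x, p), split (φ x : L x →ₗ[ℂ] E x) p ⟨_, P1.normVec_mem (P1.idx p) p⟩
      (normVec_ne_zero hi) ξ = (fibPar φ (x, p) ξ,
        (frameSign (P1.idx p) * (q (P1.coord (P1.idx p) p))⁻¹) • fibPerp φ (x, p) ξ) := fun ξ =>
    (congrArg _ ((fibEquiv φ (P1.idx p) (x, p) hi).symm_apply_apply ξ).symm).trans
    (split_ofProd (φ x : L x →ₗ[ℂ] E x) (P1.idx p) p hi (fibEquiv φ (P1.idx p) (x, p) hi ξ))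
  rw [splitInner_apply]
  have h3 := conj_frameSign_mul (P1.idx p)
  have e1 := h2 ξ
  have e2 := h2 η
  rw [e1, e2]
  simp only [map_smulₛₗ, smul_apply, map_mul, map_inv₀, conj_q, smul_eq_mul,
    RingHom.id_apply, rho]
  linear_combination -(c * ((q (P1.coord (P1.idx p) p))⁻¹) ^ 2 *
    K x (fibPerp φ (x, p) ξ) (fibPerp φ (x, p) η)) * h3

variable [IsManifold 𝓘(ℂ, EX) ω X] [ContMDiffVectorBundle ω FE E 𝓘(ℂ, EX)]
  [ContMDiffVectorBundle ω ℂ L 𝓘(ℂ, EX)]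

/-- The Hermitian metric on the extension which is the orthogonal sum of `H` and of `c` times the
product of `K` with the Fubini–Study metric. -/
def splitMetric (H : HermitianMetric 𝓘(ℂ, EX) FE E) (c : ℝ) (hc : 0 < c)
    (K : HermitianMetric 𝓘(ℂ, EX) ℂ L) :
    HermitianMetric (𝓘(ℂ, EX).prod 𝓘(ℂ)) (FE × ℂ) (Fib φ) where
  inner := splitInner φ H.inner c K.inner
  conj_symm b ξ η := by
    rw [splitInner_apply, splitInner_apply, map_add, map_mul, H.conj_symm, K.conj_symm, rho_eq,
      ← Complex.ofReal_mul, Complex.conj_ofReal]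
  pos b ξ hξ := by
    have hr : 0 < c * ((1 + ‖P1.coord (P1.idx b.2) b.2‖ ^ 2) ^ 2)⁻¹ := by positivity
    rw [splitInner_apply, rho_eq, ← Complex.ofReal_mul, Complex.add_re, Complex.re_ofReal_mul]
    by_cases h0 : fibPerp φ b ξ = 0
    · have h1 : fibPar φ b ξ ≠ 0 := by
        intro h1
        apply hξ
        rw [fibPar_apply, ← fibPerp_apply, h0, map_zero, smul_zero, add_zero] at h1
        rw [← (fibEquiv φ (P1.idx b.2) b (P1.mem_U_idx b.2)).map_eq_zero_iff]
        exact Prod.ext h1 h0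
      rw [h0, map_zero]
      simpa using H.pos _ _ h1
    · refine add_pos_of_nonneg_of_pos ?_ (mul_pos hr (K.pos _ _ h0))
      by_cases h1 : fibPar φ b ξ = 0
      · simp [h1]
      · exact (H.pos _ _ h1).le
  smooth b₀ := by
    intro y hy
    rw [extChartAt_target_prod] at hy
    have hy2 := hy.2
    rw [mem_preimage, extChartAt_symm_prod] at hy2
    obtain ⟨⟨h1, h2⟩, -⟩ := hy2
    have hnE := (isOpen_frame_domain (I := 𝓘(ℂ, EX)) b₀.1
      (trivializationAt FE E b₀.1).open_baseSet).mem_nhds ⟨hy.1.1, h1⟩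
    have hnL := (isOpen_frame_domain (I := 𝓘(ℂ, EX)) b₀.1
      (trivializationAt ℂ L b₀.1).open_baseSet).mem_nhds ⟨hy.1.1, h2⟩
    have hn : (extChartAt 𝓘(ℂ, EX) b₀.1).target ∩ (extChartAt 𝓘(ℂ, EX) b₀.1).symm ⁻¹'
      ((trivializationAt FE E b₀.1).baseSet ∩ (trivializationAt ℂ L b₀.1).baseSet) ∈ 𝓝 y.1 := by
      filter_upwards [hnE, hnL] with z hE hL using ⟨hE.1, hE.2, hL.2⟩
    have hf : ContDiffAt ℝ ∞ (frameHom φ b₀.1) y.1 :=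
      (((contDiffOn_frameHom φ b₀.1).contDiffAt hn).restrict_scalars ℝ).of_le le_top
    have hm := contDiffAt_modelForm c ((H.smooth b₀.1).contDiffAt hnE)
      ((K.smooth b₀.1).contDiffAt hnL) hf
    have hev : gram (𝓘(ℂ, EX).prod 𝓘(ℂ)) (FE × ℂ) (Fib φ) (splitInner φ H.inner c K.inner) b₀
        =ᶠ[𝓝 y] modelForm (gram 𝓘(ℂ, EX) FE E H.inner b₀.1) c (gram 𝓘(ℂ, EX) ℂ L K.inner b₀.1)
          (frameHom φ b₀.1) := by
      filter_upwards [continuousAt_fst.preimage_mem_nhds hn] with y' hy'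
      exact (isSplit_splitInner φ H.inner c K.inner).gram_eq b₀ y' hy'.2
    exact (hm.congr_of_eventuallyEq hev).contDiffWithinAt

end Construction
end Triple

/-! ### A criterion for the smoothness of a metric -/

section Smoothness

variable {EM : Type*} [NormedAddCommGroup EM] [NormedSpace ℂ EM]
  {HM : Type*} [TopologicalSpace HM] {I : ModelWithCorners ℂ EM HM}
  {M : Type*} [TopologicalSpace M] [ChartedSpace HM M]
  {F : Type*} [NormedAddCommGroup F] [NormedSpace ℂ F]
  {V : M → Type*} [TopologicalSpace (TotalSpace F V)]
  [∀ b, AddCommGroup (V b)] [∀ b, Module ℂ (V b)] [∀ b, TopologicalSpace (V b)]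
  [FiberBundle F V] [VectorBundle ℂ F V]

variable (F V) in
/-- The Gram matrix at `b` of a family of forms, in the preferred frame at `b₀`. -/
def gramAt (h : ∀ b, V b →L⋆[ℂ] V b →L[ℂ] ℂ) (b₀ b : M) : F →L[ℂ] F →L⋆[ℂ] ℂ :=
  ContinuousLinearMap.flip
    ((ContinuousLinearMap.precomp ℂ ((trivializationAt F V b₀).symmL ℂ b)).comp
      ((h b).comp ((trivializationAt F V b₀).symmL ℂ b)))

lemma gram_eq_gramAt (h : ∀ b, V b →L⋆[ℂ] V b →L[ℂ] ℂ) (b₀ : M) (z : EM) :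
    gram I F V h b₀ z = gramAt F V h b₀ ((extChartAt I b₀).symm z) := rfl

lemma gramAt_apply (h : ∀ b, V b →L⋆[ℂ] V b →L[ℂ] ℂ) (b₀ b : M) (s t : F) :
    gramAt F V h b₀ b s t = h b ((trivializationAt F V b₀).symmL ℂ b t)
      ((trivializationAt F V b₀).symmL ℂ b s) := rfl

/-- Change of frame for Gram matrices. -/
lemma gramAt_eq_pullForm (h : ∀ b, V b →L⋆[ℂ] V b →L[ℂ] ℂ) (b₀ b₁ b : M)
    (h₀ : b ∈ (trivializationAt F V b₀).baseSet) (h₁ : b ∈ (trivializationAt F V b₁).baseSet) :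
    gramAt F V h b₀ b = pullForm
      ((trivializationAt F V b₀).coordChangeL ℂ (trivializationAt F V b₁) b : F →L[ℂ] F)
      (gramAt F V h b₁ b) := by
  refine ContinuousLinearMap.ext fun s => ContinuousLinearMap.ext fun t => ?_
  have hs : ∀ s, (trivializationAt F V b₁).symmL ℂ b
      (((trivializationAt F V b₀).coordChangeL ℂ (trivializationAt F V b₁) b : F →L[ℂ] F) s) =
        (trivializationAt F V b₀).symmL ℂ b s := by
    intro s
    have h2 : ((trivializationAt F V b₀).coordChangeL ℂ (trivializationAt F V b₁) b : F →L[ℂ] F) s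
        = (trivializationAt F V b₁).continuousLinearMapAt ℂ b
          ((trivializationAt F V b₀).symmL ℂ b s) := by
      rw [Trivialization.symmL_apply _ h₀]
      exact ((trivializationAt F V b₀).coordChangeL_apply (trivializationAt F V b₁)
        ⟨h₀, h₁⟩ s).trans (by
          rw [Trivialization.continuousLinearMapAt_apply,
            Trivialization.coe_linearMapAt_of_mem _ h₁])
    rw [h2]
    exact (trivializationAt F V b₁).symmL_continuousLinearMapAt h₁ _
  rw [pullForm_apply, gramAt_apply, gramAt_apply, hs, hs]

/-- For smoothness in every preferred frame it suffices to have it at the centre of each. This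
allows frames of `E` and of `L`, which are defined over different open sets, to be used together. -/
lemma contDiffOn_gram_of_center [I.Boundaryless] [IsManifold I ω M]
    [ContMDiffVectorBundle ω F V I] (h : ∀ b, V b →L⋆[ℂ] V b →L[ℂ] ℂ)
    (hc : ∀ b, ContDiffAt ℝ ∞ (gram I F V h b) (extChartAt I b b)) (b₀ : M) :
    ContDiffOn ℝ ∞ (gram I F V h b₀)
      ((extChartAt I b₀).target ∩
        (extChartAt I b₀).symm ⁻¹' (trivializationAt F V b₀).baseSet) := by
  intro y hy
  -- Near `b₁` the Gram matrix in the frame at `b₀` is that in the frame at `b₁`, transformed by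
  -- the holomorphic changes of frame and of chart.
  set b₁ := (extChartAt I b₀).symm y with hb₁
  have hcont : ContinuousAt (extChartAt I b₀).symm y := continuousAt_extChartAt_symm'' hy.1
  have n1 : ∀ᶠ z in 𝓝 y, z ∈ (extChartAt I b₀).target :=
    (isOpen_extChartAt_target b₀).mem_nhds hy.1
  have n2 : ∀ᶠ z in 𝓝 y, (extChartAt I b₀).symm z ∈ (trivializationAt F V b₀).baseSet :=
    hcont ((trivializationAt F V b₀).open_baseSet.mem_nhds hy.2)
  have n3 : ∀ᶠ z in 𝓝 y, (extChartAt I b₀).symm z ∈ (trivializationAt F V b₁).baseSet :=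
    hcont ((trivializationAt F V b₁).open_baseSet.mem_nhds (mem_baseSet_trivializationAt F V b₁))
  have n4 : ∀ᶠ z in 𝓝 y, (extChartAt I b₀).symm z ∈ (extChartAt I b₁).source :=
    hcont (extChartAt_source_mem_nhds b₁)
  have hsymm : ContMDiffAt 𝓘(ℂ, EM) I ω (extChartAt I b₀).symm y :=
    (contMDiffOn_extChartAt_symm b₀).contMDiffAt n1
  have hC : ContDiffAt ℝ ∞ (fun z => ((trivializationAt F V b₀).coordChangeL ℂ
      (trivializationAt F V b₁) ((extChartAt I b₀).symm z) : F →L[ℂ] F)) y := by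
    have h1 := (contMDiffOn_coordChangeL (IB := I) (trivializationAt F V b₀)
      (trivializationAt F V b₁) (n := ω)).contMDiffAt (x := b₁)
      ((((trivializationAt F V b₀).open_baseSet.inter
        (trivializationAt F V b₁).open_baseSet)).mem_nhds
          ⟨hy.2, mem_baseSet_trivializationAt F V b₁⟩)
    exact ((contMDiffAt_iff_contDiffAt.1 (h1.comp y hsymm)).restrict_scalars ℝ).of_le le_top
  have hchi : ContDiffAt ℝ ∞ (fun z => extChartAt I b₁ ((extChartAt I b₀).symm z)) y := by
    have h1 : ContMDiffAt I 𝓘(ℂ, EM) ω (extChartAt I b₁) b₁ := contMDiffAt_extChartAt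
    exact ((contMDiffAt_iff_contDiffAt.1 (h1.comp y hsymm)).restrict_scalars ℝ).of_le le_top
  have hG : ContDiffAt ℝ ∞ (fun z => gram I F V h b₁
      (extChartAt I b₁ ((extChartAt I b₀).symm z))) y :=
    ContDiffAt.comp (g := gram I F V h b₁) y (hc b₁) hchi
  refine ((contDiffAt_pullForm hC hG).congr_of_eventuallyEq ?_).contDiffWithinAt
  filter_upwards [n1, n2, n3, n4] with z h1 h2 h3 h4
  rw [gram_eq_gramAt, gram_eq_gramAt, (extChartAt I b₁).left_inv h4]
  exact gramAt_eq_pullForm h b₀ b₁ _ h2 h3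

end Smoothness

/-! ### The restriction of an invariant metric to a slice `X × {p}` -/

namespace Triple

open FibreDirection

/-- The point `[1 : 0]` of the projective line. -/
def basePoint : P1 := (P1.chart 0).symm 0

lemma idx_basePoint : P1.idx basePoint = 0 := if_pos (chart_symm_mem 0 0)

lemma coord_basePoint : P1.coord (P1.idx basePoint) basePoint = 0 := by
  rw [idx_basePoint]; exact coord_chart_symm 0 0

section BaseSets

variable {EX : Type*} [NormedAddCommGroup EX] [NormedSpace ℂ EX]
  {X : Type*} [TopologicalSpace X] [ChartedSpace EX X]
  {FE : Type*} [NormedAddCommGroup FE]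
  {E : X → Type*} [TopologicalSpace (TotalSpace FE E)]
  [∀ x, TopologicalSpace (E x)] [FiberBundle FE E]
  {L : X → Type*} [TopologicalSpace (TotalSpace ℂ L)]
  [∀ x, TopologicalSpace (L x)] [FiberBundle ℂ L]

lemma eventually_mem_baseSets (x₁ : X) : ∀ᶠ z in 𝓝 (extChartAt 𝓘(ℂ, EX) x₁ x₁),
    (extChartAt 𝓘(ℂ, EX) x₁).symm z ∈
      (trivializationAt FE E x₁).baseSet ∩ (trivializationAt ℂ L x₁).baseSet :=
  (frame_domain_mem_nhds (I := 𝓘(ℂ, EX)) x₁ (((trivializationAt FE E x₁).open_baseSet.inter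
    (trivializationAt ℂ L x₁).open_baseSet).mem_nhds ⟨mem_baseSet_trivializationAt FE E x₁,
      mem_baseSet_trivializationAt ℂ L x₁⟩)) |> Filter.Eventually.mono <| fun _ h => h.2

end BaseSets

section Slice

variable {EX : Type*} [NormedAddCommGroup EX] [NormedSpace ℂ EX]
  {X : Type*} [TopologicalSpace X] [ChartedSpace EX X]
  {FE : Type*} [NormedAddCommGroup FE] [NormedSpace ℂ FE]
  {E : X → Type*} [TopologicalSpace (TotalSpace FE E)]
  [∀ x, AddCommGroup (E x)] [∀ x, Module ℂ (E x)] [∀ x, TopologicalSpace (E x)]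
  [∀ x, IsTopologicalAddGroup (E x)] [∀ x, ContinuousSMul ℂ (E x)]
  [FiberBundle FE E] [VectorBundle ℂ FE E]
  {L : X → Type*} [TopologicalSpace (TotalSpace ℂ L)]
  [∀ x, AddCommGroup (L x)] [∀ x, Module ℂ (L x)] [∀ x, TopologicalSpace (L x)]
  [FiberBundle ℂ L] [VectorBundle ℂ ℂ L]
  (φ : HolHom EX FE E L)

/-- The identification of `E x × L x` with the fibre over `(x, basePoint)`. -/
def slice (x : X) : E x × L x →L[ℂ] Fib φ (x, basePoint) where
  toLinearMap := (fibEquiv φ (P1.idx basePoint) (x, basePoint) (P1.mem_U_idx basePoint)).symm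
  cont := continuous_induced_rng.2 (by
    refine continuous_id.congr fun s => ?_
    exact ((fibEquiv φ (P1.idx basePoint) (x, basePoint)
      (P1.mem_U_idx basePoint)).apply_symm_apply s).symm)

lemma slice_injective (x : X) : Function.Injective (slice φ x) :=
  (fibEquiv φ (P1.idx basePoint) (x, basePoint) (P1.mem_U_idx basePoint)).symm.injective

lemma split_slice (x : X) (s : E x × L x) :
    split (φ x : L x →ₗ[ℂ] E x) basePoint ⟨_, P1.normVec_mem (P1.idx basePoint) basePoint⟩
      (normVec_ne_zero (P1.mem_U_idx basePoint)) (slice φ x s) = s := by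
  refine (split_ofProd (φ x : L x →ₗ[ℂ] E x) (P1.idx basePoint) basePoint
    (P1.mem_U_idx basePoint) s).trans ?_
  rw [coord_basePoint, idx_basePoint]
  simp [mu, q, frameSign]

/-- The form on `E` given by restriction to `X × {basePoint}`. -/
def sliceE (h : ∀ b, Fib φ b →L⋆[ℂ] Fib φ b →L[ℂ] ℂ) (x : X) : E x →L⋆[ℂ] E x →L[ℂ] ℂ :=
  (ContinuousLinearMap.precomp ℂ (slice φ x ∘L .inl ℂ (E x) (L x))).comp
    ((h (x, basePoint)).comp (slice φ x ∘L .inl ℂ (E x) (L x)))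

/-- The form on `L` given by restriction to `X × {basePoint}`, divided by `c`. -/
def sliceL (h : ∀ b, Fib φ b →L⋆[ℂ] Fib φ b →L[ℂ] ℂ) (c : ℝ) (x : X) : L x →L⋆[ℂ] L x →L[ℂ] ℂ :=
  ((c⁻¹ : ℝ) : ℂ) • (ContinuousLinearMap.precomp ℂ (slice φ x ∘L .inr ℂ (E x) (L x))).comp
    ((h (x, basePoint)).comp (slice φ x ∘L .inr ℂ (E x) (L x)))

lemma sliceE_apply (h : ∀ b, Fib φ b →L⋆[ℂ] Fib φ b →L[ℂ] ℂ) (x : X) (e e' : E x) :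
    sliceE φ h x e e' = h (x, basePoint) (slice φ x (e, 0)) (slice φ x (e', 0)) := rfl

lemma sliceL_apply (h : ∀ b, Fib φ b →L⋆[ℂ] Fib φ b →L[ℂ] ℂ) (c : ℝ) (x : X) (l l' : L x) :
    sliceL φ h c x l l' =
      ((c⁻¹ : ℝ) : ℂ) * h (x, basePoint) (slice φ x (0, l)) (slice φ x (0, l')) := rfl

variable [IsManifold 𝓘(ℂ, EX) ω X] [ContMDiffVectorBundle ω FE E 𝓘(ℂ, EX)]
  [ContMDiffVectorBundle ω ℂ L 𝓘(ℂ, EX)]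

lemma slice_symmL (x₁ x : X) (hE : x ∈ (trivializationAt FE E x₁).baseSet)
    (hL : x ∈ (trivializationAt ℂ L x₁).baseSet) (s : FE × ℂ) :
    slice φ x ((trivializationAt FE E x₁).symmL ℂ x s.1, (trivializationAt ℂ L x₁).symmL ℂ x s.2) =
      (trivializationAt (FE × ℂ) (Fib φ) (x₁, basePoint)).symmL ℂ (x, basePoint) s :=
  (symmL_trivializationAt φ (x₁, basePoint) (x, basePoint)
    ⟨⟨hE, hL⟩, P1.mem_U_idx basePoint⟩ s).symm

lemma slice_symmL_inl (x₁ x : X) (hE : x ∈ (trivializationAt FE E x₁).baseSet)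
    (hL : x ∈ (trivializationAt ℂ L x₁).baseSet) (s : FE) :
    slice φ x ((trivializationAt FE E x₁).symmL ℂ x s, 0) =
      (trivializationAt (FE × ℂ) (Fib φ) (x₁, basePoint)).symmL ℂ (x, basePoint) (s, 0) :=
  (congrArg (fun l => slice φ x ((trivializationAt FE E x₁).symmL ℂ x s, l))
    (ContinuousLinearMap.map_zero ((trivializationAt ℂ L x₁).symmL ℂ x)).symm).trans
    (slice_symmL φ x₁ x hE hL (s, 0))

lemma slice_symmL_inr (x₁ x : X) (hE : x ∈ (trivializationAt FE E x₁).baseSet)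
    (hL : x ∈ (trivializationAt ℂ L x₁).baseSet) (s : ℂ) :
    slice φ x (0, (trivializationAt ℂ L x₁).symmL ℂ x s) =
      (trivializationAt (FE × ℂ) (Fib φ) (x₁, basePoint)).symmL ℂ (x, basePoint) (0, s) :=
  (congrArg (fun e => slice φ x (e, (trivializationAt ℂ L x₁).symmL ℂ x s))
    (ContinuousLinearMap.map_zero ((trivializationAt FE E x₁).symmL ℂ x)).symm).trans
    (slice_symmL φ x₁ x hE hL (0, s))

lemma contDiffAt_gramAt_slice
    (h : HermitianMetric (𝓘(ℂ, EX).prod 𝓘(ℂ)) (FE × ℂ) (Fib φ)) (x₁ : X) :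
    ContDiffAt ℝ ∞ (fun z => gramAt (FE × ℂ) (Fib φ) h.inner (x₁, basePoint)
      ((extChartAt 𝓘(ℂ, EX) x₁).symm z, basePoint)) (extChartAt 𝓘(ℂ, EX) x₁ x₁) := by
  have h1 := contDiffAt_gram h (x₁, basePoint)
  have e1 : extChartAt (𝓘(ℂ, EX).prod 𝓘(ℂ)) (x₁, basePoint) (x₁, basePoint) =
    (extChartAt 𝓘(ℂ, EX) x₁ x₁, P1.coord (P1.idx basePoint) basePoint) := rfl
  rw [e1] at h1
  have h2 : ContDiffAt ℝ ∞ (fun z : EX => (z, P1.coord (P1.idx basePoint) basePoint))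
    (extChartAt 𝓘(ℂ, EX) x₁ x₁) := contDiffAt_id.prodMk contDiffAt_const
  refine (ContDiffAt.comp (g := gram (𝓘(ℂ, EX).prod 𝓘(ℂ)) (FE × ℂ) (Fib φ) h.inner
    (x₁, basePoint)) (extChartAt 𝓘(ℂ, EX) x₁ x₁) h1 h2).congr_of_eventuallyEq
      (Filter.Eventually.of_forall fun z => ?_)
  change _ = gramAt (FE × ℂ) (Fib φ) h.inner (x₁, basePoint) _
  rw [extChartAt_symm_prod]
  have e2 : (P1.chart (P1.idx basePoint)).symm (P1.coord (P1.idx basePoint) basePoint) =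
    basePoint := (P1.chart (P1.idx basePoint)).left_inv (P1.mem_U_idx basePoint)
  rw [e2]

/-- The metric on `E` given by restriction to `X × {basePoint}`. -/
def sliceMetricE (h : HermitianMetric (𝓘(ℂ, EX).prod 𝓘(ℂ)) (FE × ℂ) (Fib φ)) :
    HermitianMetric 𝓘(ℂ, EX) FE E where
  inner := sliceE φ h.inner
  conj_symm x e e' := h.conj_symm _ _ _
  pos x e he := h.pos _ _ fun h0 => he
    (congrArg Prod.fst (slice_injective φ x (h0.trans (map_zero (slice φ x)).symm)))
  smooth := contDiffOn_gram_of_center _ fun x₁ => by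
    refine (contDiffAt_pullForm (contDiffAt_const (c := ContinuousLinearMap.inl ℂ FE ℂ))
      (contDiffAt_gramAt_slice φ h x₁)).congr_of_eventuallyEq ?_
    filter_upwards [eventually_mem_baseSets (FE := FE) (E := E) (L := L) x₁] with z hz
    refine ContinuousLinearMap.ext fun s => ContinuousLinearMap.ext fun t => ?_
    rw [gram_eq_gramAt, gramAt_apply, pullForm_apply, gramAt_apply, sliceE_apply,
      slice_symmL_inl φ x₁ _ hz.1 hz.2, slice_symmL_inl φ x₁ _ hz.1 hz.2]
    rfl

/-- The metric on `L` given by restriction to `X × {basePoint}`, divided by `c`. -/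
def sliceMetricL (h : HermitianMetric (𝓘(ℂ, EX).prod 𝓘(ℂ)) (FE × ℂ) (Fib φ)) (c : ℝ)
    (hc : 0 < c) : HermitianMetric 𝓘(ℂ, EX) ℂ L where
  inner := sliceL φ h.inner c
  conj_symm x l l' := by
    rw [sliceL_apply, sliceL_apply, map_mul, Complex.conj_ofReal, h.conj_symm]
  pos x l hl := by
    rw [sliceL_apply, Complex.re_ofReal_mul]
    refine mul_pos (inv_pos.2 hc) (h.pos _ _ fun h0 => hl ?_)
    exact congrArg Prod.snd (slice_injective φ x (h0.trans (map_zero (slice φ x)).symm))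
  smooth := contDiffOn_gram_of_center _ fun x₁ => by
    refine (ContDiffAt.smulC (W := ℂ →L[ℂ] ℂ →L⋆[ℂ] ℂ) (f := fun _ => ((c⁻¹ : ℝ) : ℂ))
      contDiffAt_const (contDiffAt_pullForm (contDiffAt_const (c := ContinuousLinearMap.inr ℂ FE ℂ))
      (contDiffAt_gramAt_slice φ h x₁))).congr_of_eventuallyEq ?_
    filter_upwards [eventually_mem_baseSets (FE := FE) (E := E) (L := L) x₁] with z hz
    refine ContinuousLinearMap.ext fun s => ContinuousLinearMap.ext fun t => ?_
    change _ = ((c⁻¹ : ℝ) : ℂ) * pullForm _ _ s t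
    rw [gram_eq_gramAt, gramAt_apply, pullForm_apply, gramAt_apply, sliceL_apply,
      slice_symmL_inr φ x₁ _ hz.1 hz.2, slice_symmL_inr φ x₁ _ hz.1 hz.2]
    rfl

end Slice
end Triple

/-! ### Invariant metrics are orthogonal sums -/

namespace Triple

open FibreDirection

/-- `SU(2)` acts transitively on the unit vectors of `ℂ²`. -/
lemma exists_su2Lin_eq (v : Fin 2 → ℂ) (hv : sqLen v = 1) :
    ∃ s : Matrix.specialUnitaryGroup (Fin 2) ℂ, su2Lin s ![1, 0] = v := by
  have h : conj (v 0) * v 0 + conj (v 1) * v 1 = 1 := hv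
  refine ⟨⟨!![v 0, -conj (v 1); v 1, conj (v 0)], ?_⟩, ?_⟩
  · rw [Matrix.mem_specialUnitaryGroup_iff, Matrix.mem_unitaryGroup_iff', Matrix.det_fin_two]
    constructor
    · ext i j
      fin_cases i <;> fin_cases j <;> simp [Matrix.mul_apply, Fin.sum_univ_two]
      · exact h
      · ring
      · ring
      · linear_combination h
    · simp
      linear_combination h
  · funext k
    rw [su2Lin_apply]
    fin_cases k <;> simp

lemma exists_su2Lin_eq_I_smul :
    ∃ s : Matrix.specialUnitaryGroup (Fin 2) ℂ, su2Lin s ![1, 0] = Complex.I • ![1, 0] := by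
  refine exists_su2Lin_eq _ ?_
  simp [sqLen]

lemma exists_smul_sqLen_eq_one (v : Fin 2 → ℂ) (hv : v ≠ 0) : ∃ r : ℂ, sqLen (r • v) = 1 := by
  have h := sqLen_ne_zero hv
  set R : ℝ := ‖v 0‖ ^ 2 + ‖v 1‖ ^ 2 with hR
  have hR0 : 0 ≤ R := by positivity
  have h2 : ((Real.sqrt R : ℝ) : ℂ) * (Real.sqrt R : ℝ) = sqLen v := by
    rw [← Complex.ofReal_mul, Real.mul_self_sqrt hR0, sqLen_eq]
  refine ⟨((Real.sqrt R : ℝ) : ℂ)⁻¹, ?_⟩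
  rw [sqLen_smul, map_inv₀, Complex.conj_ofReal, ← mul_inv, h2, inv_mul_cancel₀ h]

section Algebra

variable {Ex Lx : Type*} [AddCommGroup Ex] [Module ℂ Ex] [AddCommGroup Lx] [Module ℂ Lx]

lemma split_injective (φ : Lx →ₗ[ℂ] Ex) (p : P1) (v : p.submodule) (hv : v.1 ≠ 0) :
    Function.Injective (split φ p v hv) := by
  have hi := P1.mem_U_idx p
  refine (injective_iff_map_eq_zero _).2 fun ξ hξ => ?_
  obtain ⟨a, ha⟩ := exists_smul_eq p v ⟨_, P1.normVec_mem (P1.idx p) p⟩ hv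
  have hav : (a • v).1 ≠ 0 := ha ▸ normVec_ne_zero hi
  have h1 : split φ p ⟨_, P1.normVec_mem (P1.idx p) p⟩ (normVec_ne_zero hi) ξ = 0 := by
    have h2 := split_smul φ p v hv a hav ξ
    rw [hξ] at h2
    simp only [← ha] at h2
    rw [h2]
    simp
  rw [← ofProd_toProd φ _ p hi ξ] at h1 ⊢
  rw [split_ofProd φ _ p hi] at h1
  have h2 := congrArg Prod.snd h1
  have h1 := congrArg Prod.fst h1
  have h3 : frameSign (P1.idx p) * (q (P1.coord (P1.idx p) p))⁻¹ ≠ 0 := by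
    refine mul_ne_zero (fun h => by simpa [h] using conj_frameSign_mul (P1.idx p)) ?_
    rw [← sqLen_normVec hi]
    exact inv_ne_zero (sqLen_ne_zero (normVec_ne_zero hi))
  have h4 := (smul_eq_zero.1 h2).resolve_left h3
  simp only [h4, map_zero, smul_zero, add_zero, Prod.fst_zero] at h1
  rw [show toProd φ _ p hi ξ = 0 from Prod.ext h1 h4, map_zero]

end Algebra

section Invariant

variable {EX : Type*} [NormedAddCommGroup EX] [NormedSpace ℂ EX]
  {X : Type*} [TopologicalSpace X] [ChartedSpace EX X] [IsManifold 𝓘(ℂ, EX) ω X]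
  {FE : Type*} [NormedAddCommGroup FE] [NormedSpace ℂ FE]
  {E : X → Type*} [TopologicalSpace (TotalSpace FE E)]
  [∀ x, AddCommGroup (E x)] [∀ x, Module ℂ (E x)] [∀ x, TopologicalSpace (E x)]
  [∀ x, IsTopologicalAddGroup (E x)] [∀ x, ContinuousSMul ℂ (E x)]
  [FiberBundle FE E] [VectorBundle ℂ FE E] [ContMDiffVectorBundle ω FE E 𝓘(ℂ, EX)]
  {L : X → Type*} [TopologicalSpace (TotalSpace ℂ L)]
  [∀ x, AddCommGroup (L x)] [∀ x, Module ℂ (L x)] [∀ x, TopologicalSpace (L x)]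
  [FiberBundle ℂ L] [VectorBundle ℂ ℂ L] [ContMDiffVectorBundle ω ℂ L 𝓘(ℂ, EX)]
  {φ : HolHom EX FE E L} {h : HermitianMetric (𝓘(ℂ, EX).prod 𝓘(ℂ)) (FE × ℂ) (Fib φ)}

/-- Orthogonal sums are invariant, because the splitting is equivariant. -/
lemma IsSplit.isSU2Invariant {H : ∀ x, E x →L⋆[ℂ] E x →L[ℂ] ℂ} {c : ℝ}
    {K : ∀ x, L x →L⋆[ℂ] L x →L[ℂ] ℂ} (hs : IsSplit φ h.inner H c K) : IsSU2Invariant h := by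
  intro s x p ξ η
  have hv := normVec_ne_zero (P1.mem_U_idx p)
  have hsv : su2Lin s (P1.normVec (P1.idx p) p) ≠ 0 := fun h0 =>
    hv (su2Lin_injective s (h0.trans (map_zero _).symm))
  have h1 : ∀ ξ : Fib φ (x, p), _ = _ :=
    split_su2FibAt (φ x : L x →ₗ[ℂ] E x) s p ⟨_, P1.normVec_mem (P1.idx p) p⟩ hv hsv
  have h2 := hs x (su2P1 s p) ⟨_, su2Lin_mem s p (P1.normVec_mem (P1.idx p) p)⟩ hsv
    (su2Fib φ s x p ξ) (su2Fib φ s x p η)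
  have h3 := hs x p ⟨_, P1.normVec_mem (P1.idx p) p⟩ hv ξ η
  rw [h2, h3]
  exact congrArg₂ (fun a b : E x × L x => H x a.1 b.1 + c * K x a.2 b.2) (h1 ξ) (h1 η)

/-- Invariance in terms of the splitting. The points `p`, `q` and the vectors over them are
independent variables, so that no transport along `su2P1 s p = q` is needed. -/
lemma IsSU2Invariant.inner_eq (hh : IsSU2Invariant h) (s : Matrix.specialUnitaryGroup (Fin 2) ℂ)
    (x : X) (p q : P1) (v : p.submodule) (hv : v.1 ≠ 0) (w : q.submodule) (hw : w.1 ≠ 0)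
    (hvw : su2Lin s v.1 = w.1) (ξ η : Fib φ (x, p)) (ξ' η' : Fib φ (x, q))
    (hξ : split (φ x : L x →ₗ[ℂ] E x) q w hw ξ' = split (φ x : L x →ₗ[ℂ] E x) p v hv ξ)
    (hη : split (φ x : L x →ₗ[ℂ] E x) q w hw η' = split (φ x : L x →ₗ[ℂ] E x) p v hv η) :
    h.inner (x, q) ξ' η' = h.inner (x, p) ξ η := by
  have hq : q = su2P1 s p := by
    have h1 : w.1 ∈ (su2P1 s p).submodule := hvw ▸ su2Lin_mem s p v.2
    have h2 := w.2
    obtain ⟨w, hw'⟩ := w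
    change w ≠ 0 at hw
    have aux : ∀ r : P1, w ∈ r.submodule → r = Projectivization.mk ℂ w hw := by
      intro r hr
      induction r using Projectivization.ind with
      | h u hu =>
        rw [Projectivization.submodule_mk, Submodule.mem_span_singleton] at hr
        obtain ⟨a, ha⟩ := hr
        have ha0 : a ≠ 0 := by rintro rfl; exact hw (by rw [← ha, zero_smul])
        rw [Projectivization.mk_eq_mk_iff']
        exact ⟨a⁻¹, by rw [← ha, smul_smul, inv_mul_cancel₀ ha0, one_smul]⟩
    rw [aux q h2, aux _ h1]
  subst hq
  obtain ⟨w, hw'⟩ := w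
  change su2Lin s v.1 = w at hvw
  subst hvw
  have e : ∀ (ξ : Fib φ (x, p)) (ξ' : Fib φ (x, su2P1 s p)),
      split (φ x : L x →ₗ[ℂ] E x) _ _ hw ξ' = split (φ x : L x →ₗ[ℂ] E x) p v hv ξ →
        ξ' = su2Fib φ s x p ξ := fun ξ ξ' hξ =>
    split_injective (φ x : L x →ₗ[ℂ] E x) _ _ hw
      (hξ.trans (split_su2FibAt (φ x : L x →ₗ[ℂ] E x) s p v hv hw ξ).symm)
  rw [e ξ ξ' hξ, e η η' hη]
  exact hh s x p ξ η

lemma normVec_basePoint : P1.normVec (P1.idx basePoint) basePoint = ![1, 0] := by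
  rw [idx_basePoint]
  change P1.normVec 0 (Projectivization.mk ℂ (P1.affVec 0 0) (P1.affVec_ne_zero 0 0)) = _
  rw [P1.normVec_mk]
  funext k
  fin_cases k <;> simp [P1.affVec]

/-- `E` and `L` are orthogonal over the base point: a diagonal element of `SU(2)` fixes the point,
and acts on them by different characters. -/
lemma IsSU2Invariant.inner_slice_eq_zero (hh : IsSU2Invariant h) (x : X) (e : E x) (l : L x) :
    h.inner (x, basePoint) (slice φ x (e, 0)) (slice φ x (0, l)) = 0 := by
  obtain ⟨s, hs⟩ := exists_su2Lin_eq_I_smul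
  let v : basePoint.submodule := ⟨_, P1.normVec_mem (P1.idx basePoint) basePoint⟩
  have hv : v.1 ≠ 0 := normVec_ne_zero (P1.mem_U_idx basePoint)
  have hIv : (Complex.I • v).1 ≠ 0 := smul_ne_zero Complex.I_ne_zero hv
  have hsv : su2Lin s v.1 = (Complex.I • v).1 := by
    change su2Lin s (P1.normVec _ _) = Complex.I • P1.normVec _ _
    rw [normVec_basePoint, hs]
  have hI : Complex.I / conj Complex.I = -1 := by
    rw [Complex.conj_I, div_neg, div_self Complex.I_ne_zero]
  have h1 : ∀ t : E x × L x, split (φ x : L x →ₗ[ℂ] E x) basePoint (Complex.I • v) hIv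
      (slice φ x (t.1, -t.2)) = split (φ x : L x →ₗ[ℂ] E x) basePoint v hv (slice φ x t) := by
    intro t
    refine (split_smul (φ x : L x →ₗ[ℂ] E x) basePoint v hv Complex.I hIv _).trans ?_
    have e1 : split (φ x : L x →ₗ[ℂ] E x) basePoint v hv (slice φ x (t.1, -t.2)) = (t.1, -t.2) :=
      split_slice φ x (t.1, -t.2)
    have e2 : split (φ x : L x →ₗ[ℂ] E x) basePoint v hv (slice φ x t) = t := split_slice φ x t
    rw [e1, e2, hI]
    simp
  -- In terms of the splitting, the element acts on `E ⊕ L` as `(e, l) ↦ (e, -l)`.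
  have h2 := hh.inner_eq s x basePoint basePoint v hv (Complex.I • v) hIv hsv _ _ _ _
    (h1 (e, 0)) (h1 (0, l))
  have h3 : slice φ x ((0 : E x), -l) = - slice φ x (0, l) := by
    rw [← map_neg]; simp
  rw [neg_zero, h3, map_neg] at h2
  linear_combination -(1 / 2 : ℂ) * h2

/-- An invariant metric is the orthogonal sum of metrics on `E` and on `L ⊗ O(2)`, where `O(2)`
carries the Fubini–Study metric. -/
lemma IsSU2Invariant.isSplit (hh : IsSU2Invariant h) (c : ℝ) (hc : 0 < c) :
    IsSplit φ h.inner (sliceMetricE φ h).inner c (sliceMetricL φ h c hc).inner := by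
  have h0 : ∀ (x : X) (t t' : E x × L x), h.inner (x, basePoint) (slice φ x t) (slice φ x t') =
      (sliceMetricE φ h).inner x t.1 t'.1 + c * (sliceMetricL φ h c hc).inner x t.2 t'.2 := by
    intro x t t'
    have e : ∀ t : E x × L x, slice φ x t = slice φ x (t.1, 0) + slice φ x (0, t.2) := by
      intro t; rw [← map_add]; simp
    have h1 := hh.inner_slice_eq_zero x t.1 t'.2
    have h2 := hh.inner_slice_eq_zero x t'.1 t.2
    have h3 := h.conj_symm (x, basePoint) (slice φ x (0, t.2)) (slice φ x (t'.1, 0))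
    rw [h2, map_zero] at h3
    have hc' : (c : ℂ) ≠ 0 := by exact_mod_cast hc.ne'
    rw [e t, e t', map_add, map_add, add_apply, add_apply, h1, ← h3]
    change _ = _ + c * (((c⁻¹ : ℝ) : ℂ) * _)
    rw [← mul_assoc, Complex.ofReal_inv, mul_inv_cancel₀ hc', one_mul, add_zero, zero_add]
    rfl
  intro x p v hv ξ η
  obtain ⟨r, hr⟩ := exists_smul_sqLen_eq_one v.1 hv
  -- An element of `SU(2)` carries the base vector to the unit vector `r v`.
  obtain ⟨s, hs⟩ := exists_su2Lin_eq _ hr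
  have hrv : (r • v).1 ≠ 0 := by
    intro h1
    have h2 : r • v.1 = 0 := h1
    rw [h2] at hr
    simp [sqLen] at hr
  refine Eq.trans ?_ (splitForm_indep (φ x : L x →ₗ[ℂ] E x) p (r • v) v hrv hv
    (fun e e' => (sliceMetricE φ h).inner x e e') c
    (fun l l' => (sliceMetricL φ h c hc).inner x l l') (by
      intro a l l'
      simp only [map_smulₛₗ, smul_apply, smul_eq_mul, RingHom.id_apply]
      ring) ξ η)
  refine Eq.trans ?_ (h0 x (split (φ x : L x →ₗ[ℂ] E x) p (r • v) hrv ξ)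
    (split (φ x : L x →ₗ[ℂ] E x) p (r • v) hrv η))
  refine hh.inner_eq s x basePoint p ⟨_, P1.normVec_mem (P1.idx basePoint) basePoint⟩
    (normVec_ne_zero (P1.mem_U_idx basePoint)) (r • v) hrv ?_ _ _ ξ η ?_ ?_
  · exact (congrArg (su2Lin s) normVec_basePoint).trans hs
  · exact (split_slice φ x _).symm
  · exact (split_slice φ x _).symm

end Invariant
end Triple

/-! ### The curvature in the preferred frame -/

section FrameEnd

variable {EM : Type*} [NormedAddCommGroup EM] [NormedSpace ℂ EM]
  {HM : Type*} [TopologicalSpace HM] {I : ModelWithCorners ℂ EM HM}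
  {M : Type*} [TopologicalSpace M] [ChartedSpace HM M]
  {F : Type*} [NormedAddCommGroup F] [NormedSpace ℂ F]
  {V : M → Type*} [TopologicalSpace (TotalSpace F V)]
  [∀ b, AddCommGroup (V b)] [∀ b, Module ℂ (V b)] [∀ b, TopologicalSpace (V b)]
  [FiberBundle F V] [VectorBundle ℂ F V]

lemma contraction_map {T W W' : Type*} [AddCommGroup T] [Module ℂ T] [FiniteDimensional ℂ T]
    [AddCommGroup W] [AddCommGroup W'] (g : InnerProductSpace.Core ℂ T) (f : W →+ W')
    (α : T → T → W) : contraction g (fun u v => f (α u v)) = f (contraction g α) :=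
  (map_sum f _ _).symm

variable (F V) in
/-- The endomorphism of the fibre at `b` with a given matrix in the preferred frame at `b`. -/
def frameEnd (b : M) : (F →L[ℂ] F) →ₗ[ℂ] (V b →ₗ[ℂ] V b) where
  toFun T := (trivializationAt F V b).symmₗ ℂ b ∘ₗ (T : F →ₗ[ℂ] F) ∘ₗ
    (trivializationAt F V b).linearMapAt ℂ b
  map_add' S T := by
    refine LinearMap.ext fun v => ?_
    exact map_add ((trivializationAt F V b).symmₗ ℂ b) _ _
  map_smul' c T := by
    refine LinearMap.ext fun v => ?_
    exact map_smul ((trivializationAt F V b).symmₗ ℂ b) c _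

lemma frameEnd_apply (b : M) (T : F →L[ℂ] F) (v : V b) : frameEnd F V b T v =
    (trivializationAt F V b).symmₗ ℂ b (T ((trivializationAt F V b).linearMapAt ℂ b v)) := rfl

lemma frameEnd_id (b : M) : frameEnd F V b (.id ℂ F) = LinearMap.id :=
  LinearMap.ext fun v => (trivializationAt F V b).symmₗ_linearMapAt (R := ℂ)
    (mem_baseSet_trivializationAt F V b) v

lemma frameEnd_injective (b : M) : Function.Injective (frameEnd F V b) := by
  have hb := mem_baseSet_trivializationAt F V b
  intro S T hST
  refine ContinuousLinearMap.ext fun s => ?_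
  have h := congrArg ((trivializationAt F V b).linearMapAt ℂ b)
    (LinearMap.congr_fun hST ((trivializationAt F V b).symmₗ ℂ b s))
  rwa [frameEnd_apply, frameEnd_apply, Trivialization.linearMapAt_symmₗ _ hb,
    Trivialization.linearMapAt_symmₗ _ hb, Trivialization.linearMapAt_symmₗ _ hb] at h

lemma frameEnd_eq_smul_id_iff (b : M) (T : F →L[ℂ] F) (c : ℂ) :
    frameEnd F V b T = c • LinearMap.id ↔ T = c • .id ℂ F := by
  rw [← frameEnd_id (F := F), ← map_smul, (frameEnd_injective b).eq_iff]

lemma iLambdaCurvature_eq_frameEnd [FiniteDimensional ℂ EM] (h : HermitianMetric I F V)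
    (g : ∀ b : M, InnerProductSpace.Core ℂ (TangentSpace I b)) (b : M)
    (g₀ : InnerProductSpace.Core ℂ EM) (hg : g b = g₀) :
    h.iLambdaCurvature g b = frameEnd F V b (Complex.I • contraction g₀
      (chernCurvature (gram I F V h.inner b) (extChartAt I b b))) := by
  subst hg
  rw [map_smul]
  exact congrArg (Complex.I • ·) (contraction_map _
    (frameEnd F V b).toAddMonoidHom (chernCurvature (gram I F V h.inner b) (extChartAt I b b)))

lemma gram_center (h : ∀ b, V b →L⋆[ℂ] V b →L[ℂ] ℂ) (b : M) (s t : F) :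
    gram I F V h b (extChartAt I b b) s t = h b ((trivializationAt F V b).symmL ℂ b t)
      ((trivializationAt F V b).symmL ℂ b s) := by
  rw [gram_eq_gramAt, extChartAt_to_inv, gramAt_apply]

end FrameEnd

lemma conj_shear_diagOp_eq_smul_id_iff {F G : Type*} [NormedAddCommGroup F] [NormedSpace ℂ F]
    [NormedAddCommGroup G] [NormedSpace ℂ G] (m : ℂ) (f : G →L[ℂ] F) (P : F →L[ℂ] F)
    (Q : G →L[ℂ] G) (c : ℂ) :
    shear (-m) f ∘L diagOp P Q ∘L shear m f = c • .id ℂ (F × G) ↔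
      P = c • .id ℂ F ∧ Q = c • .id ℂ G := by
  constructor
  · intro h
    have h1 : ∀ s : F × G, diagOp P Q s = c • s := by
      intro s
      have h2 := congrArg (fun T : F × G →L[ℂ] F × G => shear m f (T (shear (-m) f s))) h
      have h3 : shear m f (shear (-m) f (diagOp P Q (shear m f (shear (-m) f s)))) =
        shear m f (c • shear (-m) f s) := h2
      rwa [shear_shear_neg, shear_shear_neg, map_smul, shear_shear_neg] at h3
    refine ⟨ContinuousLinearMap.ext fun s => ?_, ContinuousLinearMap.ext fun s => ?_⟩
    · have := congrArg Prod.fst (h1 (s, 0))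
      rwa [diagOp_apply] at this
    · have := congrArg Prod.snd (h1 (0, s))
      rwa [diagOp_apply] at this
  · rintro ⟨rfl, rfl⟩
    refine ContinuousLinearMap.ext fun s => ?_
    change shear (-m) f (diagOp _ _ (shear m f s)) = c • s
    have : ∀ s : F × G, diagOp (c • .id ℂ F) (c • .id ℂ G) s = c • s := fun s => by
      rw [diagOp_apply]; rfl
    rw [this, map_smul, shear_neg_shear]

namespace Triple

section Pointwise

variable {EX : Type*} [NormedAddCommGroup EX] [NormedSpace ℂ EX]
  {X : Type*} [TopologicalSpace X] [ChartedSpace EX X]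
  {FE : Type*} [NormedAddCommGroup FE] [NormedSpace ℂ FE]
  {E : X → Type*} [TopologicalSpace (TotalSpace FE E)]
  [∀ x, AddCommGroup (E x)] [∀ x, Module ℂ (E x)] [∀ x, TopologicalSpace (E x)]
  [∀ x, IsTopologicalAddGroup (E x)] [∀ x, ContinuousSMul ℂ (E x)]
  [FiberBundle FE E] [VectorBundle ℂ FE E]
  {L : X → Type*} [TopologicalSpace (TotalSpace ℂ L)]
  [∀ x, AddCommGroup (L x)] [∀ x, Module ℂ (L x)] [∀ x, TopologicalSpace (L x)]
  [FiberBundle ℂ L] [VectorBundle ℂ ℂ L]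
  {φ : HolHom EX FE E L}

/-- The matrix in the preferred frames of a linear map from `E x` to `L x`. -/
def frameAdj [FiniteDimensional ℂ FE] (x : X) (φs : E x →ₗ[ℂ] L x) : FE →L[ℂ] ℂ :=
  ((trivializationAt ℂ L x).linearMapAt ℂ x ∘ₗ φs ∘ₗ
    (trivializationAt FE E x).symmₗ ℂ x).toContinuousLinearMap

lemma frameEnd_frameHom_comp_frameAdj [FiniteDimensional ℂ FE] (x : X) (φs : E x →ₗ[ℂ] L x) :
    frameEnd FE E x (frameHom φ x (extChartAt 𝓘(ℂ, EX) x x) ∘L frameAdj x φs) =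
      (φ x : L x →ₗ[ℂ] E x) ∘ₗ φs := by
  have hE := mem_baseSet_trivializationAt FE E x
  have hL := mem_baseSet_trivializationAt ℂ L x
  refine LinearMap.ext fun e => ?_
  rw [frameHom_center]
  change (trivializationAt FE E x).symmₗ ℂ x ((trivializationAt FE E x).linearMapAt ℂ x (φ x
    ((trivializationAt ℂ L x).symmL ℂ x ((trivializationAt ℂ L x).linearMapAt ℂ x
      (φs ((trivializationAt FE E x).symmₗ ℂ x ((trivializationAt FE E x).linearMapAt ℂ x e))))))) =
    φ x (φs e)
  rw [Trivialization.symmₗ_linearMapAt _ hE, Trivialization.symmₗ_linearMapAt _ hE]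
  exact congrArg (φ x) ((trivializationAt ℂ L x).symmₗ_linearMapAt (R := ℂ) hL _)

lemma frameEnd_frameAdj_comp_frameHom [FiniteDimensional ℂ FE] (x : X) (φs : E x →ₗ[ℂ] L x) :
    frameEnd ℂ L x (frameAdj x φs ∘L frameHom φ x (extChartAt 𝓘(ℂ, EX) x x)) =
      φs ∘ₗ (φ x : L x →ₗ[ℂ] E x) := by
  have hE := mem_baseSet_trivializationAt FE E x
  have hL := mem_baseSet_trivializationAt ℂ L x
  refine LinearMap.ext fun l => ?_
  rw [frameHom_center]
  change (trivializationAt ℂ L x).symmₗ ℂ x ((trivializationAt ℂ L x).linearMapAt ℂ x (φs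
    ((trivializationAt FE E x).symmₗ ℂ x ((trivializationAt FE E x).linearMapAt ℂ x
      (φ x ((trivializationAt ℂ L x).symmₗ ℂ x ((trivializationAt ℂ L x).linearMapAt ℂ x l))))))) =
    φs (φ x l)
  rw [Trivialization.symmₗ_linearMapAt _ hL, Trivialization.symmₗ_linearMapAt _ hE,
    Trivialization.symmₗ_linearMapAt _ hL]

/-- The Gram matrix of a metric is positive near the centre of a preferred frame. -/
lemma eventually_re_gram_pos {EM HM M F : Type*} [NormedAddCommGroup EM] [NormedSpace ℂ EM]
    [TopologicalSpace HM] {I : ModelWithCorners ℂ EM HM} [I.Boundaryless]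
    [TopologicalSpace M] [ChartedSpace HM M] [NormedAddCommGroup F] [NormedSpace ℂ F]
    {V : M → Type*} [TopologicalSpace (TotalSpace F V)]
    [∀ b, AddCommGroup (V b)] [∀ b, Module ℂ (V b)] [∀ b, TopologicalSpace (V b)]
    [FiberBundle F V] [VectorBundle ℂ F V] (h : HermitianMetric I F V) (b : M) :
    ∀ᶠ z in 𝓝 (extChartAt I b b), ∀ s, s ≠ 0 → 0 < (gram I F V h.inner b z s s).re := by
  filter_upwards [frame_domain_mem_nhds (I := I) b ((trivializationAt F V b).open_baseSet.mem_nhds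
    (mem_baseSet_trivializationAt F V b))] with z hz s hs using re_gram_pos h b z hz.2 s hs

variable [IsManifold 𝓘(ℂ, EX) ω X] [ContMDiffVectorBundle ω FE E 𝓘(ℂ, EX)]
  [ContMDiffVectorBundle ω ℂ L 𝓘(ℂ, EX)]

/-- Pointwise form of the correspondence: for an orthogonal sum with `c = 2 π / σ`, the weak
Hermitian–Einstein equation at `(x, p)` amounts to the coupled vortex equations at `x`. -/
lemma IsSplit.iLambdaCurvature_eq_iff [FiniteDimensional ℂ EX] [FiniteDimensional ℂ FE]
    {h : HermitianMetric (𝓘(ℂ, EX).prod 𝓘(ℂ)) (FE × ℂ) (Fib φ)}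
    {H : HermitianMetric 𝓘(ℂ, EX) FE E} {K : HermitianMetric 𝓘(ℂ, EX) ℂ L} {c σ : ℝ}
    (hs : IsSplit φ h.inner H.inner c K.inner) (hσ : 0 < σ) (hcσ : c = 2 * Real.pi / σ)
    (g : KahlerMetric EX X) (x : X) (p : P1) (φs : E x →ₗ[ℂ] L x)
    (hφs : ∀ e l, K.inner x (φs e) l = H.inner x e (φ x l)) (t t' : ℝ)
    (ht : t - t' = 4 * Real.pi / σ) :
    h.iLambdaCurvature (g.prodP1 σ hσ) (x, p) = (t : ℂ) • LinearMap.id ↔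
      H.iLambdaCurvature g.core x + (φ x : L x →ₗ[ℂ] E x) ∘ₗ φs = (t : ℂ) • LinearMap.id ∧
      K.iLambdaCurvature g.core x - φs ∘ₗ (φ x : L x →ₗ[ℂ] E x) = (t' : ℂ) • LinearMap.id := by
  have hE := mem_baseSet_trivializationAt FE E x
  have hL := mem_baseSet_trivializationAt ℂ L x
  have hn := eventually_mem_baseSets (EX := EX) (FE := FE) (E := E) (L := L) x
  have hf : ContDiffAt ℂ 2 (frameHom φ x) (extChartAt 𝓘(ℂ, EX) x x) :=
    ((contDiffOn_frameHom φ x).contDiffAt (frame_domain_mem_nhds x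
      (((trivializationAt FE E x).open_baseSet.inter
        (trivializationAt ℂ L x).open_baseSet).mem_nhds ⟨hE, hL⟩))).of_le le_top
  have hfs : ∀ e l, gram 𝓘(ℂ, EX) ℂ L K.inner x (extChartAt 𝓘(ℂ, EX) x x) (frameAdj x φs e) l =
      gram 𝓘(ℂ, EX) FE E H.inner x (extChartAt 𝓘(ℂ, EX) x x) e
        (frameHom φ x (extChartAt 𝓘(ℂ, EX) x x) l) := by
    intro e l
    rw [gram_center, gram_center, frameHom_center, ← K.conj_symm, ← H.conj_symm]
    have e1 : (trivializationAt ℂ L x).symmL ℂ x (frameAdj x φs e) =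
        φs ((trivializationAt FE E x).symmL ℂ x e) :=
      (trivializationAt ℂ L x).symmₗ_linearMapAt (R := ℂ) hL _
    have e2 : (trivializationAt FE E x).symmL ℂ x (((trivializationAt FE E x).continuousLinearMapAt
        ℂ x ∘L φ x ∘L (trivializationAt ℂ L x).symmL ℂ x) l) =
          φ x ((trivializationAt ℂ L x).symmL ℂ x l) :=
      (trivializationAt FE E x).symmL_continuousLinearMapAt hE _
    rw [e1, e2, hφs]
  have hAm : gram (𝓘(ℂ, EX).prod 𝓘(ℂ)) (FE × ℂ) (Fib φ) h.inner (x, p)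
      =ᶠ[𝓝 (extChartAt 𝓘(ℂ, EX) x x, chartAt ℂ p p)]
        modelForm (gram 𝓘(ℂ, EX) FE E H.inner x) c (gram 𝓘(ℂ, EX) ℂ L K.inner x)
          (frameHom φ x) := by
    filter_upwards [continuousAt_fst.eventually hn] with y hy using hs.gram_eq (x, p) y hy
  have hA : ContDiffAt ℝ 2 (gram (𝓘(ℂ, EX).prod 𝓘(ℂ)) (FE × ℂ) (Fib φ) h.inner (x, p))
      (extChartAt 𝓘(ℂ, EX) x x, chartAt ℂ p p) :=
    (contDiffAt_gram h (x, p)).of_le (by norm_cast)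
  have key := I_smul_contraction_modelForm (EX := EX) (g.core x) σ hσ hcσ
    ((contDiffAt_gram H x).of_le (by norm_cast)) ((contDiffAt_gram K x).of_le (by norm_cast)) hf
    (eventually_re_gram_pos H x) (eventually_re_gram_pos K x) (frameAdj x φs) hfs (chartAt ℂ p p)
    hA hAm (by positivity)
  rw [iLambdaCurvature_eq_frameEnd h _ _ _ rfl, iLambdaCurvature_eq_frameEnd H _ _ _ rfl,
    iLambdaCurvature_eq_frameEnd K _ _ _ rfl, ← frameEnd_frameHom_comp_frameAdj,
    ← frameEnd_frameAdj_comp_frameHom, ← map_add, ← map_sub, frameEnd_eq_smul_id_iff,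
    frameEnd_eq_smul_id_iff, frameEnd_eq_smul_id_iff]
  refine (Eq.congr_left key).trans ?_
  rw [conj_shear_diagOp_eq_smul_id_iff, ← ht, Complex.ofReal_sub, sub_smul]
  refine and_congr Iff.rfl ?_
  generalize Complex.I • contraction (T := EX) (W := ℂ →L[ℂ] ℂ) _ _ - _ = T
  rw [← eq_sub_iff_add_eq, sub_sub_cancel]

end Pointwise

end Triple

/-! ### The adjoint of a map from a line bundle -/

namespace Triple

/-- The adjoint of `φ : L → E` with respect to Hermitian metrics exists, as `L` has rank one. -/
lemma exists_adjoint {EX : Type*} [NormedAddCommGroup EX] [NormedSpace ℂ EX]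
    {X : Type*} [TopologicalSpace X] [ChartedSpace EX X]
    {FE : Type*} [NormedAddCommGroup FE] [NormedSpace ℂ FE]
    {E : X → Type*} [TopologicalSpace (TotalSpace FE E)]
    [∀ x, AddCommGroup (E x)] [∀ x, Module ℂ (E x)] [∀ x, TopologicalSpace (E x)]
    [FiberBundle FE E] [VectorBundle ℂ FE E]
    {L : X → Type*} [TopologicalSpace (TotalSpace ℂ L)]
    [∀ x, AddCommGroup (L x)] [∀ x, Module ℂ (L x)] [∀ x, TopologicalSpace (L x)]
    [FiberBundle ℂ L] [VectorBundle ℂ ℂ L] (φ : ∀ x, L x →L[ℂ] E x)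
    (H : HermitianMetric 𝓘(ℂ, EX) FE E) (K : HermitianMetric 𝓘(ℂ, EX) ℂ L) (x : X) :
    ∃ φs : E x →ₗ[ℂ] L x, ∀ e l, K.inner x (φs e) l = H.inner x e (φ x l) := by
  have hL := mem_baseSet_trivializationAt ℂ L x
  let l₀ : L x := (trivializationAt ℂ L x).symmₗ ℂ x 1
  have hspan : ∀ l : L x, ∃ m : ℂ, l = m • l₀ := fun l => by
    refine ⟨(trivializationAt ℂ L x).linearMapAt ℂ x l, ?_⟩
    rw [← map_smul, smul_eq_mul, mul_one, Trivialization.symmₗ_linearMapAt _ hL]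
  have hl₀ : l₀ ≠ 0 := fun h0 => by
    have := congrArg ((trivializationAt ℂ L x).linearMapAt ℂ x) h0
    rw [Trivialization.linearMapAt_symmₗ _ hL, map_zero] at this
    exact one_ne_zero this
  have hκ : K.inner x l₀ l₀ ≠ 0 := fun h0 => by
    have := K.pos x l₀ hl₀
    rw [h0] at this
    exact lt_irrefl _ this
  refine ⟨(((K.inner x l₀ l₀)⁻¹ • H.inner x (φ x l₀) : E x →L[ℂ] ℂ) : E x →ₗ[ℂ] ℂ).smulRight l₀,
    fun e l => ?_⟩
  obtain ⟨m, rfl⟩ := hspan l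
  change K.inner x (((K.inner x l₀ l₀)⁻¹ * H.inner x (φ x l₀) e) • l₀) (m • l₀) = _
  simp only [map_smulₛₗ, smul_apply, smul_eq_mul, RingHom.id_apply, map_mul, map_inv₀,
    K.conj_symm, H.conj_symm]
  field_simp

end Triple

end

theorem mainTheorem10
    -- a compact complex manifold with a Kähler metric
    {EX : Type*} [NormedAddCommGroup EX] [NormedSpace ℂ EX] [FiniteDimensional ℂ EX]
    {X : Type*} [TopologicalSpace X] [CompactSpace X] [T2Space X]
    [ChartedSpace EX X] [IsManifold 𝓘(ℂ, EX) ω X] (g : KahlerMetric EX X)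
    -- a holomorphic vector bundle of finite rank
    {FE : Type*} [NormedAddCommGroup FE] [NormedSpace ℂ FE] [FiniteDimensional ℂ FE]
    {E : X → Type*} [TopologicalSpace (TotalSpace FE E)]
    [∀ x, AddCommGroup (E x)] [∀ x, Module ℂ (E x)] [∀ x, TopologicalSpace (E x)]
    [∀ x, IsTopologicalAddGroup (E x)] [∀ x, ContinuousSMul ℂ (E x)]
    [FiberBundle FE E] [VectorBundle ℂ FE E] [ContMDiffVectorBundle ω FE E 𝓘(ℂ, EX)]
    -- a holomorphic line bundle
    {L : X → Type*} [TopologicalSpace (TotalSpace ℂ L)]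
    [∀ x, AddCommGroup (L x)] [∀ x, Module ℂ (L x)] [∀ x, TopologicalSpace (L x)]
    [FiberBundle ℂ L] [VectorBundle ℂ ℂ L] [ContMDiffVectorBundle ω ℂ L 𝓘(ℂ, EX)]
    -- a holomorphic map `L → E`
    (φ : Triple.HolHom EX FE E L)
    (t t' : X → ℝ) (ht : ContMDiff 𝓘(ℝ, EX) 𝓘(ℝ, ℝ) ∞ t) (ht' : ContMDiff 𝓘(ℝ, EX) 𝓘(ℝ, ℝ) ∞ t')
    (σ : ℝ) (hσ : 0 < σ) (htt' : ∀ x, t x - t' x = 4 * Real.pi / σ) :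
    (∃ (H : HermitianMetric 𝓘(ℂ, EX) FE E) (K : HermitianMetric 𝓘(ℂ, EX) ℂ L),
      Triple.CoupledVortex g φ t t' H K) ↔
    ∃ h : HermitianMetric (𝓘(ℂ, EX).prod 𝓘(ℂ)) (FE × ℂ) (Triple.Fib φ),
      Triple.IsSU2Invariant h ∧ Triple.WeakHermitianEinstein g σ hσ t h := by
  -- With this multiple of `K` the contribution of `ℙ¹` is `φ φ^* ⊕ (4 π / σ - φ^* φ)`.
  have hc : 0 < 2 * Real.pi / σ := by positivity
  constructor
  · rintro ⟨H, K, φs, h1, h2, h3⟩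
    have hs : Triple.IsSplit φ (Triple.splitMetric φ H (2 * Real.pi / σ) hc K).inner H.inner
        (2 * Real.pi / σ) K.inner := Triple.isSplit_splitInner φ H.inner _ K.inner
    refine ⟨_, hs.isSU2Invariant, fun b => ?_⟩
    exact (hs.iLambdaCurvature_eq_iff hσ rfl g b.1 b.2 (φs b.1) (h1 b.1) (t b.1) (t' b.1)
      (htt' b.1)).2 ⟨h2 b.1, h3 b.1⟩
  · rintro ⟨h, hinv, hHE⟩
    have hs := hinv.isSplit _ hc
    choose φs h1 using Triple.exists_adjoint φ (Triple.sliceMetricE φ h)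
      (Triple.sliceMetricL φ h _ hc)
    have h2 := fun x => (hs.iLambdaCurvature_eq_iff hσ rfl g x Triple.basePoint (φs x) (h1 x) (t x)
      (t' x) (htt' x)).1 (hHE (x, Triple.basePoint))
    exact ⟨_, _, φs, h1, fun x => (h2 x).1, fun x => (h2 x).2⟩
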